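/- **Definitions.** Let $\mathcal C$ be a monoidal category with tensor unit $I$. A *central idempotent* is an object $U$ with an (invertible) half-braiding $\sigma_A\colon U\otimes A\to A\otimes U$ (an object of the Drinfeld centre) and a morphism $u\colon U\to I$ such that, up to unitors, $u\otimes U=U\otimes u\colon U\otimes U\to U$ is invertible and $(A\otimes u)\circ\sigma_A=u\otimes A$ for all $A$. Put $u\le v$ when $u=v\circ m$ for some $m\colon U\to V$ respecting the half-braidings; identifying $u,v$ when such an $m$ is invertible (equivalently $u\le v\le u$) gives a partially ordered set $\mathrm{ZI}(\mathcal C)$, with meets $u\wedge v=u\otimes v$. $\mathcal C$ is *stiff* when for all $A$ and all central idempotents $u,v$ the square $$A\otimes U\otimes V\to A\otimes U,\quad A\otimes U\otimes V\to A\otimes V,\quad A\otimes U\to A,\quad A\otimes V\to A$$ is a pullback. $\mathcal C$ *has universal joins of central idempotents* when $\mathrm{ZI}(\mathcal C)$ has all joins and, for each family $S$ of central idempotents closed under binary meets with join $j\colon J\to I$ and each object $A$, the cocone $(A\otimes U\to A\otimes J)_{u\in S}$ is a colimit of the diagram of the $A\otimes U$, $u\in S$. A lax monoidal functor $F\colon\mathcal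 C\to\mathcal D$ *preserves central idempotents* when $I\to F(I)$ is invertible and, for each central idempotent $u$, all $F(A)\otimes F(U)\to F(A\otimes U)$ are invertible and $F(U)$ has a half-braiding that is compatible with the one of $U$ and makes $F(U)\to F(I)\cong I$ a central idempotent. It *preserves joins* when moreover the induced map $\mathrm{ZI}(\mathcal C)\to\mathrm{ZI}(\mathcal D)$ preserves all existing joins. $\mathbf{MonCat_s}$ consists of small stiff monoidal categories and lax monoidal functors preserving central idempotents; $\mathbf{MonCat_j}$ is its subcategory of those $\mathcal C$ that have universal joins of central idempotents and for which $\mathrm{ZI}(\mathcal C)$ is a spatial frame, with the functors that also preserve joins. For $\mathcal C$ stiff, the category $D[\mathcal C]$ has as objects pairs $\langle D,A\rangle$ of a down-closed set $D\subseteq\mathrm{ZI}(\mathcal C)$ and an object $A$ of $\mathcal C$. A morphism $\langle D,A\rangle\to\langle E,B\rangle$ is a family of morphisms $\eta_u\colon A\otimes U\to B$, $u\in D$, with $\eta_u=\eta_{u'}\circ(A\otimes m)$ whenever $u=u'\circ m$ witnesses $u\le u'$, and such that each $\eta_u$ factors through $B\otimes v\colon B\otimes V\to B$ for some $v\in E$.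 The identity is $(A\otimes u)_{u}$; the composite with $\zeta\colon\langle E,B\rangle\to\langle G,C\rangle$ has components $\zeta_v\circ\tilde\eta$, where $\eta_u=(B\otimes v)\circ\tilde\eta$ with $v\in E$. The tensor product is $\langle D\cap E,A\otimes B\rangle$ with unit $\langle\mathrm{ZI}(\mathcal C),I\rangle$, and $(\eta\otimes\zeta)_u$ is obtained by duplicating $U$ (via $U\cong U\otimes U$), moving one copy to its place with the inverse half-braiding, and applying $\eta_u\otimes\zeta_u$. The embedding $\mathcal C\to D[\mathcal C]$ sends $A$ to $\langle\mathrm{ZI}(\mathcal C),A\rangle$ and $f\colon A\to B$ to $(f\otimes u)_u$, with identity coherence morphisms. **Theorem.** Let $\mathcal C$ be a small stiff monoidal category. Then $D[\mathcal C]$ is an object of $\mathbf{MonCat_j}$ and the embedding $E\colon\mathcal C\to D[\mathcal C]$ is a lax monoidal functor that preserves central idempotents. Let $\mathcal D$ be a stiff monoidal category with universal joins of central idempotents. 1. For every lax monoidal functor $F\colon\mathcal C\to\mathcal D$ preserving central idempotents there is a lax monoidal functor $\widehat F\colon D[\mathcal C]\to\mathcal D$ preserving central idempotents and their joins with $\widehat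 F\circ E=F$. 2. It is unique up to unique monoidal natural isomorphism: if $G_1,G_2\colon D[\mathcal C]\to\mathcal D$ are lax monoidal functors preserving central idempotents and their joins, then every monoidal natural isomorphism $\gamma\colon G_1\circ E\cong G_2\circ E$ is the restriction along $E$ of exactly one monoidal natural isomorphism $G_1\cong G_2$. Consequently, when functors are identified if they are monoidally naturally isomorphic, $\mathcal C\mapsto D[\mathcal C]$ is the object part of a left adjoint to the forgetful functor $\mathbf{MonCat_j}\to\mathbf{MonCat_s}$, with the (class of the) embedding $\mathcal C\to D[\mathcal C]$ as unit. -/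

import Mathlib

open CategoryTheory MonoidalCategory

universe w v u

namespace CentralIdem

section Basic

variable {C : Type u} [Category.{v} C] [MonoidalCategory C]

/-- The conditions on a morphism `e : U ⟶ I` and a half-braiding `σ` on `U` that make them into a
central idempotent. -/
structure IsCentralIdempotent {U : C} (σ : HalfBraiding U) (e : U ⟶ 𝟙_ C) : Prop where
  isIso : IsIso (e ▷ U ≫ (λ_ U).hom)
  central : e ▷ U ≫ (λ_ U).hom = U ◁ e ≫ (ρ_ U).hom
  braid : ∀ A : C, (σ.β A).hom ≫ A ◁ e ≫ (ρ_ A).hom = e ▷ A ≫ (λ_ A).hom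

variable (C) in
/-- A (representative of a) central idempotent. -/
structure CentralIdempotent where
  obj : C
  σ : HalfBraiding obj
  counit : obj ⟶ 𝟙_ C
  isCentral : IsCentralIdempotent σ counit

/-- The morphism `A ⊗ u : A ⊗ U ⟶ A`. -/
def proj (A : C) (u : CentralIdempotent C) : A ⊗ u.obj ⟶ A :=
  A ◁ u.counit ≫ (ρ_ A).hom

namespace CentralIdempotent

/-- Morphisms `m : U ⟶ V` with `u = v ∘ m` that respect the half-braidings. -/
@[ext]
structure Hom (u v : CentralIdempotent C) where
  f : u.obj ⟶ v.obj
  w : f ≫ v.counit = u.counit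
  comm : ∀ A : C, f ▷ A ≫ (v.σ.β A).hom = (u.σ.β A).hom ≫ A ◁ f

/-- The identity. -/
def Hom.id (u : CentralIdempotent C) : Hom u u := ⟨𝟙 _, by simp, by simp⟩

/-- Composition. -/
def Hom.comp {u v w : CentralIdempotent C} (m : Hom u v) (n : Hom v w) : Hom u w :=
  ⟨m.f ≫ n.f, by simp [m.w, n.w], fun A => by
    rw [comp_whiskerRight, Category.assoc, n.comm, ← Category.assoc, m.comm, Category.assoc,
      ← MonoidalCategory.whiskerLeft_comp]⟩

instance : Preorder (CentralIdempotent C) where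
  le u v := Nonempty (Hom u v)
  le_refl u := ⟨Hom.id u⟩
  le_trans _ _ _ := fun ⟨m⟩ ⟨n⟩ => ⟨m.comp n⟩

end CentralIdempotent

variable (C) in
/-- The partially ordered set of central idempotents. Representatives `u`, `v` are identified
when `u ≤ v ≤ u`; by `toZI_eq_iff` this means that `u = v ∘ m` for an isomorphism `m` respecting
the half-braidings. -/
abbrev ZI := Antisymmetrization (CentralIdempotent C) (· ≤ ·)

/-- The class of a central idempotent. -/
def toZI (u : CentralIdempotent C) : ZI C := toAntisymmetrization (· ≤ ·) u

theorem toZI_le_toZI {u v : CentralIdempotent C} : toZI u ≤ toZI v ↔ u ≤ v := Iff.rfl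

theorem proj_naturality {A B : C} (f : A ⟶ B) (u : CentralIdempotent C) :
    f ▷ u.obj ≫ proj B u = proj A u ≫ f := by
  simp only [proj, Category.assoc, ← rightUnitor_naturality]
  rw [whisker_exchange_assoc]

theorem proj_naturality_assoc {A B : C} (f : A ⟶ B) (u : CentralIdempotent C) {Z : C} (h : B ⟶ Z) :
    f ▷ u.obj ≫ proj B u ≫ h = proj A u ≫ f ≫ h := by
  simp only [← Category.assoc, proj_naturality]

theorem whiskerLeft_hom_proj (A : C) {u v : CentralIdempotent C} (m : u.Hom v) :
    A ◁ m.f ≫ proj A v = proj A u := by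
  simp [proj, ← m.w]

theorem whiskerLeft_hom_proj_assoc (A : C) {u v : CentralIdempotent C} (m : u.Hom v) {Z : C} (h : A ⟶ Z) :
    A ◁ m.f ≫ proj A v ≫ h = proj A u ≫ h := by
  simp only [← Category.assoc, whiskerLeft_hom_proj]

theorem proj_tensor (A B : C) (u : CentralIdempotent C) :
    proj (A ⊗ B) u = (α_ A B u.obj).hom ≫ A ◁ proj B u := by
  simp [proj]

theorem proj_whiskerRight (A : C) (u : CentralIdempotent C) :
    proj A u ▷ u.obj = proj (A ⊗ u.obj) u := by
  have h := u.isCentral.central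
  rw [proj_tensor]
  simp only [proj, ← h]
  simp

instance (A : C) (u : CentralIdempotent C) : IsIso (proj (A ⊗ u.obj) u) := by
  have h := u.isCentral.central
  have := u.isCentral.isIso
  rw [proj_tensor]
  unfold proj
  rw [← h]
  infer_instance

/-- Comultiplication `A ⊗ U ⟶ A ⊗ U ⊗ U`. -/
noncomputable def copy (A : C) (u : CentralIdempotent C) : A ⊗ u.obj ⟶ (A ⊗ u.obj) ⊗ u.obj :=
  inv (proj (A ⊗ u.obj) u)

@[simp]
theorem copy_proj (A : C) (u : CentralIdempotent C) :
    copy A u ≫ proj (A ⊗ u.obj) u = 𝟙 _ := by simp [copy]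

@[simp]
theorem copy_proj_assoc (A : C) (u : CentralIdempotent C) {Z : C} (h : A ⊗ u.obj ⟶ Z) :
    copy A u ≫ proj (A ⊗ u.obj) u ≫ h = h := by
  simp only [← Category.assoc, copy_proj, Category.id_comp]

@[simp]
theorem copy_proj' (A : C) (u : CentralIdempotent C) :
    copy A u ≫ proj A u ▷ u.obj = 𝟙 _ := by simp [copy, proj_whiskerRight]

@[simp]
theorem copy_proj'_assoc (A : C) (u : CentralIdempotent C) {Z : C} (h : A ⊗ u.obj ⟶ Z) :
    copy A u ≫ proj A u ▷ u.obj ≫ h = h := by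
  simp only [← Category.assoc, copy_proj', Category.id_comp]

theorem cancel_proj {Z A : C} (v : CentralIdempotent C) [Epi (proj Z v)] {f g : Z ⟶ A ⊗ v.obj}
    (h : f ≫ proj A v = g ≫ proj A v) : f = g := by
  rw [← cancel_epi (proj Z v), ← proj_naturality, ← proj_naturality, ← proj_whiskerRight,
    ← comp_whiskerRight, ← comp_whiskerRight, h]

theorem cancel_counit {Z : C} (v : CentralIdempotent C) [Epi (proj Z v)] {f g : Z ⟶ v.obj}
    (h : f ≫ v.counit = g ≫ v.counit) : f = g := by
  have : f ≫ (λ_ _).inv = g ≫ (λ_ _).inv := by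
    apply cancel_proj v
    simp only [proj, Category.assoc, ← leftUnitor_inv_naturality_assoc, reassoc_of% h]
  simpa using this =≫ (λ_ _).hom

theorem isIso_proj_of_iso {Z Z' : C} (e : Z ≅ Z') (v : CentralIdempotent C) [IsIso (proj Z' v)] :
    IsIso (proj Z v) := by
  have : proj Z v = e.hom ▷ v.obj ≫ proj Z' v ≫ e.inv := by
    rw [proj_naturality_assoc]; simp
  rw [this]; infer_instance

theorem isIso_proj_tensor_left (A Z : C) (v : CentralIdempotent C) [IsIso (proj Z v)] :
    IsIso (proj (A ⊗ Z) v) := by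
  rw [proj_tensor]; infer_instance

theorem isIso_proj_obj_tensor (A : C) (v : CentralIdempotent C) :
    IsIso (proj (v.obj ⊗ A) v) := isIso_proj_of_iso (v.σ.β A) v

theorem epi_proj_of_hom (A : C) {u v : CentralIdempotent C} (f : u.obj ⟶ v.obj)
    (w : f ≫ v.counit = u.counit) : Epi (proj (A ⊗ u.obj) v) := by
  have h : (A ⊗ u.obj) ◁ f ≫ proj (A ⊗ u.obj) v = proj (A ⊗ u.obj) u := by
    simp [proj, ← w]
  have : Epi ((A ⊗ u.obj) ◁ f ≫ proj (A ⊗ u.obj) v) := by rw [h]; infer_instance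
  exact epi_of_epi ((A ⊗ u.obj) ◁ f) _

theorem epi_proj_of_iso {Z Z' : C} (e : Z ≅ Z') (v : CentralIdempotent C) [Epi (proj Z' v)] :
    Epi (proj Z v) := by
  have : proj Z v = e.hom ▷ v.obj ≫ proj Z' v ≫ e.inv := by
    rw [proj_naturality_assoc]; simp
  rw [this]; infer_instance

/-- A morphism over the tensor unit between central idempotents automatically respects the
half-braidings. -/
def CentralIdempotent.Hom.mk' {u v : CentralIdempotent C} (f : u.obj ⟶ v.obj)
    (w : f ≫ v.counit = u.counit) : u.Hom v :=
  ⟨f, w, fun A => by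
    have := epi_proj_of_hom A f w
    have := epi_proj_of_iso (u.σ.β A) v
    apply cancel_proj v
    have h1 := v.isCentral.braid A
    have h2 := u.isCentral.braid A
    simp only [proj, Category.assoc]
    rw [h1, ← comp_whiskerRight_assoc, w, ← h2, ← w]
    simp⟩

instance (u v : CentralIdempotent C) : Subsingleton (u.Hom v) := ⟨fun m n => by
  have := epi_proj_of_hom (𝟙_ C) m.f m.w
  have := epi_proj_of_iso (λ_ u.obj).symm v
  ext
  exact cancel_counit v (m.w.trans n.w.symm)⟩

theorem toZI_eq_iff {u v : CentralIdempotent C} :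
    toZI u = toZI v ↔ ∃ m : u.Hom v, IsIso m.f := by
  constructor
  · intro h
    obtain ⟨m⟩ : u ≤ v := toZI_le_toZI.1 h.le
    obtain ⟨n⟩ : v ≤ u := toZI_le_toZI.1 h.ge
    refine ⟨m, n.f, ?_, ?_⟩
    · exact congrArg CentralIdempotent.Hom.f (Subsingleton.elim (m.comp n) (.id u))
    · exact congrArg CentralIdempotent.Hom.f (Subsingleton.elim (n.comp m) (.id v))
  · rintro ⟨m, hm⟩
    apply le_antisymm
    · exact toZI_le_toZI.2 ⟨m⟩
    · exact toZI_le_toZI.2 ⟨.mk' (inv m.f) (by simp [← m.w])⟩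

/-- The half-braiding of a central idempotent is determined by the underlying morphism. -/
theorem halfBraiding_unique {U : C} {σ τ : HalfBraiding U} {e : U ⟶ 𝟙_ C}
    (hσ : IsCentralIdempotent σ e) (hτ : IsCentralIdempotent τ e) : σ = τ := by
  have key : ∀ A, (σ.β A).hom = (τ.β A).hom := fun A => by
    have := isIso_proj_obj_tensor A ⟨U, σ, e, hσ⟩
    exact cancel_proj ⟨U, σ, e, hσ⟩ ((hσ.braid A).trans (hτ.braid A).symm)
  cases σ; cases τ
  congr
  ext A
  exact key A

/-- A central idempotent as an object of the centre. -/
def CentralIdempotent.toCenter (u : CentralIdempotent C) : Center C := ⟨u.obj, u.σ⟩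

theorem tensor_β (u v : CentralIdempotent C) (A : C) :
    ((u.toCenter ⊗ v.toCenter).2.β A).hom =
      (α_ u.obj v.obj A).hom ≫ u.obj ◁ (v.σ.β A).hom ≫ (α_ u.obj A v.obj).inv ≫
        (u.σ.β A).hom ▷ v.obj ≫ (α_ A u.obj v.obj).hom := rfl

/-- The meet `u ∧ v`: the tensor product, with the tensor product half-braiding. -/
noncomputable def CentralIdempotent.inf (u v : CentralIdempotent C) : CentralIdempotent C where
  obj := u.obj ⊗ v.obj
  σ := (u.toCenter ⊗ v.toCenter).2
  counit := (u.counit ⊗ₘ v.counit) ≫ (λ_ _).hom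
  isCentral := by
    have hu := u.isCentral
    have hv := v.isCentral
    set w := (u.counit ⊗ₘ v.counit) ≫ (λ_ (𝟙_ C)).hom with hw
    have hpr : ∀ A : C, A ◁ w ≫ (ρ_ A).hom =
        (α_ A u.obj v.obj).inv ≫ proj (A ⊗ u.obj) v ≫ proj A u := by
      intro A
      simp only [proj, hw, tensorHom_def', unitors_equal]
      simp
    have hpr2 : w = proj u.obj v ≫ u.counit := by
      simp only [proj, hw, tensorHom_def', unitors_equal]
      simp
    have hpr3 : w = u.counit ▷ v.obj ≫ (λ_ _).hom ≫ v.counit := by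
      simp only [hw, MonoidalCategory.tensorHom_def]
      simp
    -- absorption
    have a1 : IsIso (proj (u.obj ⊗ v.obj) u) := isIso_proj_obj_tensor _ _
    have a2 : IsIso (proj ((u.obj ⊗ v.obj) ⊗ u.obj) v) := by
      have := isIso_proj_obj_tensor u.obj v
      have := isIso_proj_tensor_left u.obj (v.obj ⊗ u.obj) v
      exact isIso_proj_of_iso (α_ u.obj v.obj u.obj) v
    have a3 : IsIso (proj ((u.obj ⊗ v.obj) ⊗ (u.obj ⊗ v.obj)) v) :=
      isIso_proj_tensor_left (u.obj ⊗ v.obj) (u.obj ⊗ v.obj) v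
    have a4 : IsIso (proj ((u.obj ⊗ v.obj) ⊗ (u.obj ⊗ v.obj)) u) :=
      isIso_proj_tensor_left (u.obj ⊗ v.obj) (u.obj ⊗ v.obj) u
    have hc : w ▷ (u.obj ⊗ v.obj) ≫ (λ_ (u.obj ⊗ v.obj)).hom =
        (u.obj ⊗ v.obj) ◁ w ≫ (ρ_ (u.obj ⊗ v.obj)).hom := by
      apply cancel_proj v
      apply cancel_counit u
      simp only [Category.assoc, ← hpr2]
      rw [← leftUnitor_naturality, ← rightUnitor_naturality, whisker_exchange_assoc,
        unitors_equal]
    refine ⟨?_, hc, ?_⟩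
    · rw [hc, hpr]
      infer_instance
    · have key : ∀ A : C, ((α_ u.obj v.obj A).hom ≫ u.obj ◁ (v.σ.β A).hom ≫
          (α_ u.obj A v.obj).inv ≫ (u.σ.β A).hom ▷ v.obj ≫ (α_ A u.obj v.obj).hom) ≫
            A ◁ w ≫ (ρ_ A).hom = w ▷ A ≫ (λ_ A).hom := by
        intro A
        have h1 := hu.braid A
        have h2 := hv.braid A
        rw [hpr]
        simp only [Category.assoc, Iso.hom_inv_id_assoc]
        rw [proj_naturality_assoc]
        change _ ≫ _ ≫ _ ≫ _ ≫ (u.σ.β A).hom ≫ A ◁ u.counit ≫ (ρ_ A).hom = _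
        rw [h1, proj_tensor]
        simp only [Iso.inv_hom_id_assoc, Category.assoc]
        rw [← MonoidalCategory.whiskerLeft_comp_assoc]
        unfold proj
        rw [h2, hpr3]
        rw [whisker_exchange_assoc]
        simp
      exact key

theorem CentralIdempotent.inf_le_left (u v : CentralIdempotent C) : u.inf v ≤ u :=
  ⟨.mk' (proj u.obj v) (by
    simp only [proj, CentralIdempotent.inf, tensorHom_def', unitors_equal]; simp)⟩

theorem CentralIdempotent.inf_le_right (u v : CentralIdempotent C) : u.inf v ≤ v :=
  ⟨.mk' (u.counit ▷ v.obj ≫ (λ_ _).hom) (by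
    simp only [CentralIdempotent.inf, MonoidalCategory.tensorHom_def]; simp)⟩

/-- The morphism `f : Z ⟶ B` restricts to `v`: it factors through `B ⊗ v : B ⊗ V ⟶ B`. -/
def RestrictsTo {Z B : C} (f : Z ⟶ B) (v : CentralIdempotent C) : Prop :=
  ∃ g : Z ⟶ B ⊗ v.obj, g ≫ proj B v = f

variable (C) in
/-- Stiff monoidal categories. -/
class IsStiff : Prop where
  isPullback : ∀ (A : C) (u v : CentralIdempotent C),
    IsPullback (proj A u ▷ v.obj) (proj (A ⊗ u.obj) v) (proj A v) (proj A u)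

theorem RestrictsTo.mono {Z B : C} {f : Z ⟶ B} {u v : CentralIdempotent C}
    (h : RestrictsTo f u) (huv : u ≤ v) : RestrictsTo f v := by
  obtain ⟨g, rfl⟩ := h
  obtain ⟨m⟩ := huv
  exact ⟨g ≫ B ◁ m.f, by simp [whiskerLeft_hom_proj]⟩

theorem RestrictsTo.precomp {Z Z' B : C} {f : Z ⟶ B} {u : CentralIdempotent C}
    (h : RestrictsTo f u) (k : Z' ⟶ Z) : RestrictsTo (k ≫ f) u := by
  obtain ⟨g, rfl⟩ := h
  exact ⟨k ≫ g, by simp⟩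

theorem RestrictsTo.postcomp {Z B B' : C} {f : Z ⟶ B} {u : CentralIdempotent C}
    (h : RestrictsTo f u) (k : B ⟶ B') : RestrictsTo (f ≫ k) u := by
  obtain ⟨g, rfl⟩ := h
  exact ⟨g ≫ k ▷ u.obj, by simp [proj_naturality]⟩

theorem copy_comp {A B : C} (u : CentralIdempotent C) (f : A ⊗ u.obj ⟶ B) :
    (copy A u ≫ f ▷ u.obj) ≫ proj B u = f := by
  simp [proj_naturality]

theorem restrictsTo_self {A B : C} (u : CentralIdempotent C) (f : A ⊗ u.obj ⟶ B) :
    RestrictsTo f u := ⟨_, copy_comp u f⟩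

theorem RestrictsTo.whiskerLeft {Z B : C} {f : Z ⟶ B} {u : CentralIdempotent C}
    (h : RestrictsTo f u) (A : C) : RestrictsTo (A ◁ f) u := by
  obtain ⟨g, rfl⟩ := h
  exact ⟨A ◁ g ≫ (α_ _ _ _).inv, by simp [proj_tensor]⟩

/-- Moving `U` past `B`: the morphism `A ⊗ B ⊗ U ⟶ A ⊗ U ⊗ B`. -/
def swap (A B : C) (u : CentralIdempotent C) : (A ⊗ B) ⊗ u.obj ≅ (A ⊗ u.obj) ⊗ B :=
  α_ A B u.obj ≪≫ whiskerLeftIso A (u.σ.β B).symm ≪≫ (α_ A u.obj B).symm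

theorem swap_proj (A B : C) (u : CentralIdempotent C) :
    (swap A B u).hom ≫ proj A u ▷ B = proj (A ⊗ B) u := by
  have h := u.isCentral.braid B
  rw [← Iso.eq_inv_comp] at h
  rw [proj_tensor]
  simp only [swap, proj, Iso.trans_hom, whiskerLeftIso_hom, Iso.symm_hom, h, Category.assoc]
  simp

theorem swap_proj_assoc (A B : C) (u : CentralIdempotent C) {Z : C} (h : A ⊗ B ⟶ Z) :
    (swap A B u).hom ≫ proj A u ▷ B ≫ h = proj (A ⊗ B) u ≫ h := by
  simp only [← Category.assoc, swap_proj]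

theorem swap_inv_proj (A B : C) (u : CentralIdempotent C) :
    (swap A B u).inv ≫ proj (A ⊗ B) u = proj A u ▷ B := by
  rw [← swap_proj]; simp

theorem RestrictsTo.whiskerRight {Z B : C} {f : Z ⟶ B} {u : CentralIdempotent C}
    (h : RestrictsTo f u) (A : C) : RestrictsTo (f ▷ A) u := by
  obtain ⟨g, rfl⟩ := h
  exact ⟨g ▷ A ≫ (swap B A u).inv, by simp [swap_inv_proj]⟩

theorem swap_hom_naturality (A B : C) {u v : CentralIdempotent C} (m : u.Hom v) :
    (A ⊗ B) ◁ m.f ≫ (swap A B v).hom = (swap A B u).hom ≫ (A ◁ m.f) ▷ B := by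
  have h : B ◁ m.f ≫ (v.σ.β B).inv = (u.σ.β B).inv ≫ m.f ▷ B := by
    rw [Iso.comp_inv_eq, Category.assoc, m.comm, Iso.inv_hom_id_assoc]
  simp only [swap, Iso.trans_hom, whiskerLeftIso_hom, Iso.symm_hom, Category.assoc]
  rw [tensor_whiskerLeft]
  simp only [Category.assoc, Iso.inv_hom_id_assoc]
  rw [← MonoidalCategory.whiskerLeft_comp_assoc, h]
  simp

theorem swap_hom_naturality_assoc (A B : C) {u v : CentralIdempotent C} (m : u.Hom v) {Z : C}
    (h : (A ⊗ v.obj) ⊗ B ⟶ Z) :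
    (A ⊗ B) ◁ m.f ≫ (swap A B v).hom ≫ h = (swap A B u).hom ≫ (A ◁ m.f) ▷ B ≫ h := by
  simp only [← Category.assoc, swap_hom_naturality]

theorem swap_naturality_right (A : C) {B B' : C} (f : B ⟶ B') (u : CentralIdempotent C) :
    (A ◁ f) ▷ u.obj ≫ (swap A B' u).hom = (swap A B u).hom ≫ (A ⊗ u.obj) ◁ f := by
  have h : f ▷ u.obj ≫ (u.σ.β B').inv = (u.σ.β B).inv ≫ u.obj ◁ f := by
    rw [Iso.comp_inv_eq, Category.assoc, u.σ.naturality, Iso.inv_hom_id_assoc]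
  simp only [swap, Iso.trans_hom, whiskerLeftIso_hom, Iso.symm_hom, Category.assoc]
  rw [whisker_assoc, tensor_whiskerLeft]
  simp only [Category.assoc, Iso.inv_hom_id_assoc]
  rw [← MonoidalCategory.whiskerLeft_comp_assoc, h]
  simp

theorem swap_naturality_right_assoc (A : C) {B B' : C} (f : B ⟶ B') (u : CentralIdempotent C) {Z : C}
    (h : (A ⊗ u.obj) ⊗ B' ⟶ Z) :
    (A ◁ f) ▷ u.obj ≫ (swap A B' u).hom ≫ h =
      (swap A B u).hom ≫ (A ⊗ u.obj) ◁ f ≫ h := by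
  simp only [← Category.assoc, swap_naturality_right]

theorem swap_naturality_left {A A' : C} (f : A ⟶ A') (B : C) (u : CentralIdempotent C) :
    (f ▷ B) ▷ u.obj ≫ (swap A' B u).hom = (swap A B u).hom ≫ (f ▷ u.obj) ▷ B := by
  simp only [swap, Iso.trans_hom, whiskerLeftIso_hom, Iso.symm_hom, Category.assoc]
  rw [associator_naturality_left_assoc, ← whisker_exchange_assoc, associator_inv_naturality_left]

theorem swap_tensor_right (A B B' : C) (u : CentralIdempotent C) :
    (swap A (B ⊗ B') u).hom = (α_ A B B').inv ▷ u.obj ≫ (swap (A ⊗ B) B' u).hom ≫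
      (swap A B u).hom ▷ B' ≫ (α_ (A ⊗ u.obj) B B').hom := by
  have h : (u.σ.β (B ⊗ B')).inv = (α_ _ _ _).hom ≫ B ◁ (u.σ.β B').inv ≫ (α_ _ _ _).inv ≫
      (u.σ.β B).inv ▷ B' ≫ (α_ _ _ _).hom := by
    rw [← cancel_epi (u.σ.β (B ⊗ B')).hom, Iso.hom_inv_id, u.σ.monoidal]
    simp
  simp only [swap, Iso.trans_hom, whiskerLeftIso_hom, Iso.symm_hom, Category.assoc, h]
  monoidal

theorem swap_tensor_left (A A' B : C) (u : CentralIdempotent C) :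
    (swap (A ⊗ A') B u).hom = (α_ A A' B).hom ▷ u.obj ≫ (α_ _ _ _).hom ≫
      A ◁ (swap A' B u).hom ≫ (α_ _ _ _).inv ≫ (α_ A A' u.obj).inv ▷ B := by
  simp only [swap, Iso.trans_hom, whiskerLeftIso_hom, Iso.symm_hom]
  monoidal

section Stiff

variable [IsStiff C]

instance (A : C) (u : CentralIdempotent C) : Mono (proj A u) := ⟨fun f g h => by
  have hp := IsStiff.isPullback A u u
  have h1 : hp.lift f f rfl ≫ proj A u ▷ u.obj = f := hp.lift_fst _ _ _
  have h1' : hp.lift f f rfl ≫ proj (A ⊗ u.obj) u = f := hp.lift_snd _ _ _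
  have h2 : hp.lift f g h ≫ proj A u ▷ u.obj = f := hp.lift_fst _ _ _
  have h3 : hp.lift f g h ≫ proj (A ⊗ u.obj) u = g := hp.lift_snd _ _ _
  have e : ∀ {Z : C} (k : Z ⟶ (A ⊗ u.obj) ⊗ u.obj), k ≫ proj A u ▷ u.obj = k ≫ proj (A ⊗ u.obj) u :=
    fun _ => by rw [proj_whiskerRight]
  exact h2.symm.trans ((e _).trans h3)⟩

/-- A common restriction: two factorisations through `v` and `v'` come from one
through `v ∧ v'`. -/
theorem exists_restriction {Z B : C} (v v' : CentralIdempotent C) (g : Z ⟶ B ⊗ v.obj)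
    (g' : Z ⟶ B ⊗ v'.obj) (h : g ≫ proj B v = g' ≫ proj B v') :
    ∃ (w : CentralIdempotent C) (m : w.Hom v) (m' : w.Hom v') (k : Z ⟶ B ⊗ w.obj),
      k ≫ B ◁ m.f = g ∧ k ≫ B ◁ m'.f = g' := by
  obtain ⟨m⟩ := CentralIdempotent.inf_le_left v v'
  obtain ⟨m'⟩ := CentralIdempotent.inf_le_right v v'
  have hp := IsStiff.isPullback B v v'
  have hk : (hp.lift g' g h.symm ≫ (α_ B v.obj v'.obj).hom) ≫ proj B (v.inf v') =
      g ≫ proj B v := by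
    have e : (α_ B v.obj v'.obj).hom ≫ proj B (v.inf v') =
        proj (B ⊗ v.obj) v' ≫ proj B v := by
      simp only [proj, CentralIdempotent.inf, MonoidalCategory.tensorHom_def', unitors_equal]
      simp
    refine (Category.assoc _ _ _).trans ((congrArg (hp.lift g' g h.symm ≫ ·) e).trans ?_)
    exact (Category.assoc _ _ _).symm.trans
      (congrArg (· ≫ proj B v) (hp.lift_snd g' g h.symm))
  refine ⟨v.inf v', m, m', hp.lift g' g h.symm ≫ (α_ _ _ _).hom, ?_, ?_⟩
  · rw [← cancel_mono (proj B v), Category.assoc, whiskerLeft_hom_proj]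
    exact hk
  · rw [← cancel_mono (proj B v'), Category.assoc, whiskerLeft_hom_proj]
    exact hk.trans h

theorem RestrictsTo.exists_inf {Z B : C} {f : Z ⟶ B} {v v' : CentralIdempotent C}
    (h : RestrictsTo f v) (h' : RestrictsTo f v') :
    ∃ w : CentralIdempotent C, w ≤ v ∧ w ≤ v' ∧ RestrictsTo f w := by
  obtain ⟨g, rfl⟩ := h
  obtain ⟨g', hg'⟩ := h'
  obtain ⟨w, m, m', k, h1, h2⟩ := exists_restriction v v' g g' hg'.symm
  exact ⟨w, ⟨m⟩, ⟨m'⟩, k, by rw [← h1, Category.assoc, whiskerLeft_hom_proj]⟩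

end Stiff

variable (C) in
/-- Objects of the completion `D[C]`: pairs of a down-closed set of central idempotents and an
object of `C`. -/
structure Completion where
  D : LowerSet (ZI C)
  A : C

namespace Completion

theorem mem_left {D E : LowerSet (ZI C)} {a : ZI C} (h : a ∈ D ⊓ E) : a ∈ D := h.1

theorem mem_right {D E : LowerSet (ZI C)} {a : ZI C} (h : a ∈ D ⊓ E) : a ∈ E := h.2

/-- Morphisms of `D[C]`: compatible families of morphisms `A ⊗ U ⟶ B` for `u ∈ D`, each of which
restricts to some element of `E`. -/
@[ext]
structure Hom (X Y : Completion C) where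
  app : ∀ u : CentralIdempotent C, toZI u ∈ X.D → (X.A ⊗ u.obj ⟶ Y.A)
  restricts : ∀ (u : CentralIdempotent C) (hu : toZI u ∈ X.D),
    ∃ v : CentralIdempotent C, toZI v ∈ Y.D ∧ RestrictsTo (app u hu) v
  compat : ∀ (u u' : CentralIdempotent C) (m : u.Hom u') (hu : toZI u ∈ X.D)
    (hu' : toZI u' ∈ X.D), app u hu = X.A ◁ m.f ≫ app u' hu'

/-- The morphism with components `f ∘ (A ⊗ u)`. -/
def lift {X Y : Completion C} (h : X.D ≤ Y.D) (f : X.A ⟶ Y.A) : Hom X Y where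
  app u _ := proj X.A u ≫ f
  restricts u hu := ⟨u, h hu, (restrictsTo_self u (proj X.A u)).postcomp f⟩
  compat u u' m hu hu' := by rw [whiskerLeft_hom_proj_assoc]

/-- A choice of `v ∈ E` to which `η_u` restricts. -/
noncomputable def Hom.idx {X Y : Completion C} (η : Hom X Y) (u : CentralIdempotent C)
    (hu : toZI u ∈ X.D) : CentralIdempotent C := (η.restricts u hu).choose

theorem Hom.idx_mem {X Y : Completion C} (η : Hom X Y) (u : CentralIdempotent C)
    (hu : toZI u ∈ X.D) : toZI (η.idx u hu) ∈ Y.D := (η.restricts u hu).choose_spec.1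

/-- A choice of `η̃` with `η_u = (B ⊗ v) ∘ η̃`. -/
noncomputable def Hom.fac {X Y : Completion C} (η : Hom X Y) (u : CentralIdempotent C)
    (hu : toZI u ∈ X.D) : X.A ⊗ u.obj ⟶ Y.A ⊗ (η.idx u hu).obj :=
  (η.restricts u hu).choose_spec.2.choose

theorem Hom.fac_proj {X Y : Completion C} (η : Hom X Y) (u : CentralIdempotent C)
    (hu : toZI u ∈ X.D) : η.fac u hu ≫ proj Y.A (η.idx u hu) = η.app u hu :=
  (η.restricts u hu).choose_spec.2.choose_spec

theorem Hom.fac_proj_assoc {X Y : Completion C} (η : Hom X Y) (u : CentralIdempotent C)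
    (hu : toZI u ∈ X.D) {Z : C} (h : Y.A ⟶ Z) :
    η.fac u hu ≫ proj Y.A (η.idx u hu) ≫ h = η.app u hu ≫ h := by
  simp only [← Category.assoc, Hom.fac_proj]

theorem Hom.comp_aux [IsStiff C] {Y Z : Completion C} (ζ : Hom Y Z) {W : C}
    {v v' : CentralIdempotent C} (g : W ⟶ Y.A ⊗ v.obj) (g' : W ⟶ Y.A ⊗ v'.obj)
    (h : g ≫ proj Y.A v = g' ≫ proj Y.A v') (hv' : toZI v' ∈ Y.D) (k : Y.A ⊗ v.obj ⟶ Z.A)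
    (hk : ∀ w (hw : toZI w ∈ Y.D) (m : w.Hom v), ζ.app w hw = Y.A ◁ m.f ≫ k) :
    g' ≫ ζ.app v' hv' = g ≫ k := by
  obtain ⟨w, n, n', l, h1, h2⟩ := exists_restriction _ _ _ _ h
  have hw : toZI w ∈ Y.D := Y.D.lower (toZI_le_toZI.2 ⟨n'⟩) hv'
  rw [← h1, ← h2, Category.assoc, Category.assoc, ← ζ.compat w v' n' hw hv', ← hk w hw n]

/-- Composition: the component at `u` is `ζ_v ∘ η̃`, for any factorisation of `η_u` as
`(B ⊗ v) ∘ η̃` with `v ∈ E`; see `comp_app` for independence of the choice. -/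
noncomputable def Hom.comp [IsStiff C] {X Y Z : Completion C} (η : Hom X Y) (ζ : Hom Y Z) :
    Hom X Z where
  app u hu := η.fac u hu ≫ ζ.app (η.idx u hu) (η.idx_mem u hu)
  restricts u hu := by
    obtain ⟨v, hv, h⟩ := ζ.restricts (η.idx u hu) (η.idx_mem u hu)
    exact ⟨v, hv, h.precomp _⟩
  compat u u' m hu hu' := by
    symm
    rw [← Category.assoc]
    apply ζ.comp_aux
    · rw [Category.assoc, η.fac_proj, η.fac_proj, η.compat u u' m hu hu']
    · exact fun w hw m' => ζ.compat _ _ m' hw _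

section

variable [IsStiff C]

theorem Hom.comp_app_of_local {X Y Z : Completion C} (η : Hom X Y) (ζ : Hom Y Z)
    {u : CentralIdempotent C} (hu : toZI u ∈ X.D) {v : CentralIdempotent C}
    (g : X.A ⊗ u.obj ⟶ Y.A ⊗ v.obj) (hg : g ≫ proj Y.A v = η.app u hu) (k : Y.A ⊗ v.obj ⟶ Z.A)
    (hk : ∀ w (hw : toZI w ∈ Y.D) (m : w.Hom v), ζ.app w hw = Y.A ◁ m.f ≫ k) :
    (η.comp ζ).app u hu = g ≫ k :=
  ζ.comp_aux _ _ (hg.trans (η.fac_proj u hu).symm) _ k hk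

theorem Hom.comp_app {X Y Z : Completion C} (η : Hom X Y) (ζ : Hom Y Z)
    {u : CentralIdempotent C} (hu : toZI u ∈ X.D) {v : CentralIdempotent C} (hv : toZI v ∈ Y.D)
    (g : X.A ⊗ u.obj ⟶ Y.A ⊗ v.obj) (hg : g ≫ proj Y.A v = η.app u hu) :
    (η.comp ζ).app u hu = g ≫ ζ.app v hv :=
  η.comp_app_of_local ζ hu g hg _ fun w hw m => ζ.compat w v m hw hv

noncomputable instance : Category (Completion C) where
  Hom := Hom
  id X := lift le_rfl (𝟙 _)
  comp := Hom.comp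
  id_comp {X Y} η := by
    ext u hu
    refine (Hom.comp_app (lift le_rfl (𝟙 X.A)) η hu hu (𝟙 _) ?_).trans (Category.id_comp _)
    simp [lift]
  comp_id {X Y} η := by
    ext u hu
    refine (Hom.comp_app η (lift le_rfl (𝟙 Y.A)) hu (η.idx_mem u hu) _ (η.fac_proj u hu)).trans ?_
    simp [lift, Hom.fac_proj]
  assoc {W X Y Z} η ζ ξ := by
    ext u hu
    have h1 := ζ.fac_proj (η.idx u hu) (η.idx_mem u hu)
    refine (Hom.comp_app (η.comp ζ) ξ hu (ζ.idx_mem _ (η.idx_mem u hu))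
      (η.fac u hu ≫ ζ.fac _ (η.idx_mem u hu)) ?_).trans ?_
    · rw [Category.assoc, h1]
      rfl
    · rw [Category.assoc]
      rfl

@[ext]
theorem hom_ext {X Y : Completion C} {η ζ : X ⟶ Y}
    (h : ∀ u hu, Hom.app η u hu = Hom.app ζ u hu) : η = ζ :=
  Hom.ext (funext fun u => funext fun hu => h u hu)

/-- The components of a morphism. -/
def app {X Y : Completion C} (η : X ⟶ Y) (u : CentralIdempotent C) (hu : toZI u ∈ X.D) :
    X.A ⊗ u.obj ⟶ Y.A := Hom.app η u hu

/-- `lift` as a morphism. -/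
def ofHom {X Y : Completion C} (h : X.D ≤ Y.D) (f : X.A ⟶ Y.A) : X ⟶ Y := lift h f

theorem ofHom_app {X Y : Completion C} (h : X.D ≤ Y.D) (f : X.A ⟶ Y.A) (u : CentralIdempotent C)
    (hu : toZI u ∈ X.D) : Hom.app (ofHom h f) u hu = proj X.A u ≫ f := rfl

theorem comp_ofHom_app {X Y Z : Completion C} (η : X ⟶ Y) (h : Y.D ≤ Z.D) (f : Y.A ⟶ Z.A)
    (u : CentralIdempotent C) (hu : toZI u ∈ X.D) :
    Hom.app (η ≫ ofHom h f) u hu = Hom.app η u hu ≫ f := by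
  refine (Hom.comp_app η (lift h f) hu (Hom.idx_mem η u hu) _ (Hom.fac_proj η u hu)).trans ?_
  simp [lift, Hom.fac_proj_assoc]

theorem ofHom_comp_app {X Y Z : Completion C} (h : X.D ≤ Y.D) (f : X.A ⟶ Y.A) (η : Y ⟶ Z)
    (u : CentralIdempotent C) (hu : toZI u ∈ X.D) :
    Hom.app (ofHom h f ≫ η) u hu = f ▷ u.obj ≫ Hom.app η u (h hu) :=
  Hom.comp_app (lift h f) η hu (h hu) _ (proj_naturality f u)

@[simp]
theorem ofHom_comp_ofHom {X Y Z : Completion C} (h : X.D ≤ Y.D) (f : X.A ⟶ Y.A) (h' : Y.D ≤ Z.D)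
    (g : Y.A ⟶ Z.A) : (ofHom h f : X ⟶ Y) ≫ (ofHom h' g : Y ⟶ Z) = ofHom (h.trans h') (f ≫ g) := by
  ext u hu
  rw [comp_ofHom_app, ofHom_app, ofHom_app, Category.assoc]

@[simp]
theorem ofHom_comp_ofHom_assoc {X Y Z W : Completion C} (h : X.D ≤ Y.D) (f : X.A ⟶ Y.A)
    (h' : Y.D ≤ Z.D) (g : Y.A ⟶ Z.A) (k : Z ⟶ W) :
    (ofHom h f : X ⟶ Y) ≫ (ofHom h' g : Y ⟶ Z) ≫ k = ofHom (h.trans h') (f ≫ g) ≫ k := by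
  simp only [← Category.assoc, ofHom_comp_ofHom]

theorem id_eq_ofHom (X : Completion C) : 𝟙 X = ofHom le_rfl (𝟙 X.A) := rfl

/-- Isomorphisms between objects with the same down-closed set. -/
def ofIso {X Y : Completion C} (h : X.D = Y.D) (f : X.A ≅ Y.A) : X ≅ Y where
  hom := ofHom h.le f.hom
  inv := ofHom h.ge f.inv
  hom_inv_id := by simp [id_eq_ofHom]
  inv_hom_id := by simp [id_eq_ofHom]

/-- The tensor product of objects. -/
abbrev tensor (X Y : Completion C) : Completion C := ⟨X.D ⊓ Y.D, X.A ⊗ Y.A⟩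

/-- Left whiskering, with components `A ⊗ η_u`. -/
def whiskerL (X : Completion C) {Y Z : Completion C} (η : Y ⟶ Z) : tensor X Y ⟶ tensor X Z where
  app u hu := (α_ X.A Y.A u.obj).hom ≫ X.A ◁ Hom.app η u (mem_right hu)
  restricts u hu := by
    obtain ⟨v, hv, h⟩ := Hom.restricts η u (mem_right hu)
    obtain ⟨w, h1, h2, h3⟩ := h.exists_inf (restrictsTo_self u _)
    exact ⟨w, ⟨X.D.lower (toZI_le_toZI.2 h2) (mem_left hu), Z.D.lower (toZI_le_toZI.2 h1) hv⟩,
      (h3.whiskerLeft X.A).precomp _⟩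
  compat u u' m hu hu' := by
    rw [Hom.compat η u u' m (mem_right hu) (mem_right hu')]
    simp [tensor]

/-- Right whiskering, with components `(η_u ⊗ A) ∘ (B ⊗ σ⁻¹)`. -/
def whiskerR {X Y : Completion C} (η : X ⟶ Y) (Z : Completion C) : tensor X Z ⟶ tensor Y Z where
  app u hu := (swap X.A Z.A u).hom ≫ Hom.app η u (mem_left hu) ▷ Z.A
  restricts u hu := by
    obtain ⟨v, hv, h⟩ := Hom.restricts η u (mem_left hu)
    obtain ⟨w, h1, h2, h3⟩ := h.exists_inf (restrictsTo_self u _)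
    exact ⟨w, ⟨Y.D.lower (toZI_le_toZI.2 h1) hv, Z.D.lower (toZI_le_toZI.2 h2) (mem_right hu)⟩,
      (h3.whiskerRight Z.A).precomp _⟩
  compat u u' m hu hu' := by
    rw [Hom.compat η u u' m (mem_left hu) (mem_left hu'), comp_whiskerRight, ← swap_hom_naturality_assoc]

theorem whiskerL_app (X : Completion C) {Y Z : Completion C} (η : Y ⟶ Z)
    (u : CentralIdempotent C) (hu : toZI u ∈ X.D ⊓ Y.D) :
    Hom.app (whiskerL X η) u hu = (α_ X.A Y.A u.obj).hom ≫ X.A ◁ Hom.app η u (mem_right hu) := rfl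

theorem whiskerR_app {X Y : Completion C} (η : X ⟶ Y) (Z : Completion C)
    (u : CentralIdempotent C) (hu : toZI u ∈ X.D ⊓ Z.D) :
    Hom.app (whiskerR η Z) u hu = (swap X.A Z.A u).hom ≫ Hom.app η u (mem_left hu) ▷ Z.A := rfl

theorem whiskerL_ofHom (X : Completion C) {Y Z : Completion C} (h : Y.D ≤ Z.D) (f : Y.A ⟶ Z.A) :
    whiskerL X (ofHom h f) = ofHom (inf_le_inf_left _ h) (X.A ◁ f) := by
  ext u hu
  rw [whiskerL_app, ofHom_app, ofHom_app, proj_tensor]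
  simp

theorem whiskerR_ofHom {X Y : Completion C} (h : X.D ≤ Y.D) (f : X.A ⟶ Y.A) (Z : Completion C) :
    whiskerR (ofHom h f) Z = ofHom (inf_le_inf_right _ h) (f ▷ Z.A) := by
  ext u hu
  rw [whiskerR_app, ofHom_app, ofHom_app, comp_whiskerRight, swap_proj_assoc]

theorem whiskerL_comp (W : Completion C) {X Y Z : Completion C} (η : X ⟶ Y) (ζ : Y ⟶ Z) :
    whiskerL W (η ≫ ζ) = whiskerL W η ≫ whiskerL W ζ := by
  ext u hu
  have h1 := Hom.fac_proj η u (mem_right hu)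
  have h2 := Hom.comp_app η ζ (mem_right hu) (Hom.idx_mem η u (mem_right hu)) _ h1
  refine Eq.trans ?_ (Hom.comp_app_of_local (whiskerL W η) (whiskerL W ζ) hu
    ((α_ W.A X.A u.obj).hom ≫ W.A ◁ Hom.fac η u (mem_right hu) ≫ (α_ W.A Y.A _).inv) ?_
    ((α_ W.A Y.A _).hom ≫ W.A ◁ Hom.app ζ _ (Hom.idx_mem η u (mem_right hu))) ?_).symm
  · simp only [Category.assoc, Iso.inv_hom_id_assoc]
    rw [← MonoidalCategory.whiskerLeft_comp, ← h2]
    rfl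
  · simp only [tensor, proj_tensor, Category.assoc, Iso.inv_hom_id_assoc]
    rw [← MonoidalCategory.whiskerLeft_comp, h1]
    rfl
  · intro w hw m
    rw [whiskerL_app, Hom.compat ζ _ _ m (mem_right hw) (Hom.idx_mem η u (mem_right hu))]
    simp [tensor]

theorem whiskerR_comp {X Y Z : Completion C} (η : X ⟶ Y) (ζ : Y ⟶ Z) (W : Completion C) :
    whiskerR (η ≫ ζ) W = whiskerR η W ≫ whiskerR ζ W := by
  ext u hu
  have h1 := Hom.fac_proj η u (mem_left hu)
  have h2 := Hom.comp_app η ζ (mem_left hu) (Hom.idx_mem η u (mem_left hu)) _ h1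
  refine Eq.trans ?_ (Hom.comp_app_of_local (whiskerR η W) (whiskerR ζ W) hu
    ((swap X.A W.A u).hom ≫ Hom.fac η u (mem_left hu) ▷ W.A ≫ (swap Y.A W.A _).inv) ?_
    ((swap Y.A W.A _).hom ≫ Hom.app ζ _ (Hom.idx_mem η u (mem_left hu)) ▷ W.A) ?_).symm
  · simp only [Category.assoc, Iso.inv_hom_id_assoc]
    rw [← comp_whiskerRight, ← h2]
    rfl
  · simp only [tensor, Category.assoc, swap_inv_proj]
    rw [← comp_whiskerRight, h1]
    rfl
  · intro w hw m
    rw [whiskerR_app, Hom.compat ζ _ _ m (mem_left hw) (Hom.idx_mem η u (mem_left hu)), comp_whiskerRight,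
      ← swap_hom_naturality_assoc]

/-- The components of `η ⊗ ζ`: copy `U`, move one copy past `A₂`, and apply `η_u` and `ζ_u`. -/
theorem whiskerR_whiskerL_app {X₁ Y₁ X₂ Y₂ : Completion C} (η : X₁ ⟶ Y₁) (ζ : X₂ ⟶ Y₂)
    (u : CentralIdempotent C) (hu : toZI u ∈ X₁.D ⊓ X₂.D) :
    Hom.app (whiskerR η X₂ ≫ whiskerL Y₁ ζ) u hu =
      copy (X₁.A ⊗ X₂.A) u ≫ (swap X₁.A X₂.A u).hom ▷ u.obj ≫ (α_ _ _ _).hom ≫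
        (Hom.app η u (mem_left hu) ⊗ₘ Hom.app ζ u (mem_right hu)) := by
  refine (Hom.comp_app_of_local (whiskerR η X₂) (whiskerL Y₁ ζ) hu
    (copy (X₁.A ⊗ X₂.A) u ≫ Hom.app (whiskerR η X₂) u hu ▷ u.obj) (copy_comp u _)
    ((α_ _ _ _).hom ≫ Y₁.A ◁ Hom.app ζ u (mem_right hu)) ?_).trans ?_
  · intro w hw m
    rw [whiskerL_app, Hom.compat ζ _ _ m (mem_right hw) (mem_right hu)]
    simp [tensor]
  · rw [whiskerR_app]
    simp [MonoidalCategory.tensorHom_def, tensor]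

theorem whisker_exchange' {X₁ Y₁ X₂ Y₂ : Completion C} (η : X₁ ⟶ Y₁) (ζ : X₂ ⟶ Y₂) :
    whiskerL X₁ ζ ≫ whiskerR η Y₂ = whiskerR η X₂ ≫ whiskerL Y₁ ζ := by
  ext u hu
  rw [whiskerR_whiskerL_app]
  refine (Hom.comp_app_of_local (whiskerL X₁ ζ) (whiskerR η Y₂) hu
    (copy (X₁.A ⊗ X₂.A) u ≫ Hom.app (whiskerL X₁ ζ) u hu ▷ u.obj) (copy_comp u _)
    ((swap _ _ _).hom ≫ Hom.app η u (mem_left hu) ▷ Y₂.A) ?_).trans ?_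
  · intro w hw m
    rw [whiskerR_app, Hom.compat η _ _ m (mem_left hw) (mem_left hu), comp_whiskerRight,
      ← swap_hom_naturality_assoc]
  · rw [whiskerL_app]
    have h : copy (X₁.A ⊗ X₂.A) u ≫ (α_ X₁.A X₂.A u.obj).hom ▷ u.obj ≫
        (swap X₁.A (X₂.A ⊗ u.obj) u).hom =
        copy (X₁.A ⊗ X₂.A) u ≫ (swap X₁.A X₂.A u).hom ▷ u.obj ≫ (α_ _ _ _).hom := by
      have : Mono ((X₁.A ⊗ u.obj) ◁ proj X₂.A u) := by
        have e : (X₁.A ⊗ u.obj) ◁ proj X₂.A u =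
            (α_ _ _ _).inv ≫ proj ((X₁.A ⊗ u.obj) ⊗ X₂.A) u := by simp [proj_tensor]
        rw [e]
        infer_instance
      rw [← cancel_mono ((X₁.A ⊗ u.obj) ◁ proj X₂.A u)]
      simp only [Category.assoc]
      rw [← swap_naturality_right, ← comp_whiskerRight_assoc, ← proj_tensor, copy_proj'_assoc,
        ← proj_tensor, proj_naturality, copy_proj_assoc]
    have h' := h =≫ (Hom.app η u (mem_left hu) ⊗ₘ Hom.app ζ u (mem_right hu))
    simp only [Category.assoc] at h'
    rw [← h', MonoidalCategory.tensorHom_def', comp_whiskerRight]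
    simp only [Category.assoc]
    rw [swap_naturality_right_assoc]

/-- The associator of `D[C]`. -/
def assocIso (X Y Z : Completion C) : tensor (tensor X Y) Z ≅ tensor X (tensor Y Z) :=
  ofIso (inf_assoc _ _ _) (α_ X.A Y.A Z.A)

variable (C) in
/-- The tensor unit of `D[C]`. -/
abbrev unitObj : Completion C := ⟨⊤, 𝟙_ C⟩

/-- The left unitor of `D[C]`. -/
def leftUnitorIso (X : Completion C) : tensor (unitObj C) X ≅ X :=
  ofIso (top_inf_eq _) (λ_ X.A)

/-- The right unitor of `D[C]`. -/
def rightUnitorIso (X : Completion C) : tensor X (unitObj C) ≅ X :=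
  ofIso (inf_top_eq _) (ρ_ X.A)

theorem assoc_naturality_left {X X' : Completion C} (η : X ⟶ X') (Y Z : Completion C) :
    whiskerR (whiskerR η Y) Z ≫ (assocIso X' Y Z).hom =
      (assocIso X Y Z).hom ≫ whiskerR η (tensor Y Z) := by
  ext u hu
  dsimp only [assocIso, ofIso]
  rw [comp_ofHom_app, ofHom_comp_app, whiskerR_app, whiskerR_app, whiskerR_app, swap_tensor_right]
  simp

theorem assoc_naturality_middle (X : Completion C) {Y Y' : Completion C} (η : Y ⟶ Y')
    (Z : Completion C) :
    whiskerR (whiskerL X η) Z ≫ (assocIso X Y' Z).hom =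
      (assocIso X Y Z).hom ≫ whiskerL X (whiskerR η Z) := by
  ext u hu
  dsimp only [assocIso, ofIso]
  rw [comp_ofHom_app, ofHom_comp_app, whiskerR_app, whiskerL_app, whiskerL_app, whiskerR_app,
    swap_tensor_left]
  simp

theorem assoc_naturality_right (X Y : Completion C) {Z Z' : Completion C} (η : Z ⟶ Z') :
    whiskerL (tensor X Y) η ≫ (assocIso X Y Z').hom =
      (assocIso X Y Z).hom ≫ whiskerL X (whiskerL Y η) := by
  ext u hu
  dsimp only [assocIso, ofIso]
  rw [comp_ofHom_app, ofHom_comp_app, whiskerL_app, whiskerL_app, whiskerL_app]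
  simp

theorem leftUnitor_nat {X Y : Completion C} (η : X ⟶ Y) :
    whiskerL (unitObj C) η ≫ (leftUnitorIso Y).hom = (leftUnitorIso X).hom ≫ η := by
  ext u hu
  dsimp only [leftUnitorIso, ofIso]
  rw [comp_ofHom_app, ofHom_comp_app, whiskerL_app]
  simp

theorem rightUnitor_nat {X Y : Completion C} (η : X ⟶ Y) :
    whiskerR η (unitObj C) ≫ (rightUnitorIso Y).hom = (rightUnitorIso X).hom ≫ η := by
  ext u hu
  dsimp only [rightUnitorIso, ofIso]
  rw [comp_ofHom_app, ofHom_comp_app, whiskerR_app]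
  have h : (swap X.A (𝟙_ C) u).hom ≫ (ρ_ _).hom = (ρ_ X.A).hom ▷ u.obj := by
    rw [← cancel_mono (proj X.A u), proj_naturality, Category.assoc, ← rightUnitor_naturality,
      swap_proj_assoc]
  rw [← h]
  simp

noncomputable instance : MonoidalCategory (Completion C) where
  tensorObj := tensor
  whiskerLeft X _ _ η := whiskerL X η
  whiskerRight η Z := whiskerR η Z
  tensorHom {_ Y₁ X₂ _} η ζ := whiskerR η X₂ ≫ whiskerL Y₁ ζ
  tensorUnit := unitObj C
  associator := assocIso
  leftUnitor := leftUnitorIso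
  rightUnitor := rightUnitorIso
  tensorHom_def _ _ := rfl
  id_tensorHom_id X Y := by
    rw [id_eq_ofHom, id_eq_ofHom, whiskerR_ofHom, whiskerL_ofHom, ofHom_comp_ofHom]
    simp [id_eq_ofHom]
  tensorHom_comp_tensorHom {X₁ Y₁ Z₁ X₂ Y₂ Z₂} η₁ η₂ ζ₁ ζ₂ := by
    rw [whiskerR_comp, whiskerL_comp, Category.assoc, Category.assoc,
      ← Category.assoc (whiskerL Y₁ η₂), whisker_exchange', Category.assoc]
  whiskerLeft_id X Y := by
    rw [id_eq_ofHom, whiskerL_ofHom]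
    simp [id_eq_ofHom]
  id_whiskerRight X Y := by
    rw [id_eq_ofHom, whiskerR_ofHom]
    simp [id_eq_ofHom]
  associator_naturality {X₁ X₂ X₃ Y₁ Y₂ Y₃} f g h := by
    rw [whiskerR_comp, whiskerL_comp, Category.assoc, Category.assoc, assoc_naturality_right,
      ← Category.assoc (whiskerR (whiskerL _ _) _), assoc_naturality_middle, Category.assoc,
      ← Category.assoc, assoc_naturality_left, Category.assoc]
  leftUnitor_naturality := leftUnitor_nat
  rightUnitor_naturality := rightUnitor_nat
  pentagon W X Y Z := by
    dsimp only [assocIso, ofIso]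
    rw [whiskerR_ofHom, whiskerL_ofHom, ofHom_comp_ofHom, ofHom_comp_ofHom, ofHom_comp_ofHom]
    congr 1
    exact MonoidalCategory.pentagon _ _ _ _
  triangle X Y := by
    dsimp only [assocIso, ofIso, leftUnitorIso, rightUnitorIso]
    rw [whiskerR_ofHom, whiskerL_ofHom, ofHom_comp_ofHom]
    congr 1
    exact MonoidalCategory.triangle _ _

end

end Completion

/-! ### Universal joins -/

/-- The morphism witnessing `u ≤ v` (there is exactly one). -/
noncomputable def leHom {u v : CentralIdempotent C} (h : u ≤ v) : u.Hom v := Classical.choice h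

/-- The diagram `A ⊗ U` for `u ∈ S`, with morphisms `A ⊗ U ⟶ A ⊗ V` for `u ≤ v`. -/
noncomputable def joinDiagram (A : C) (S : Set (CentralIdempotent C)) : S ⥤ C where
  obj u := A ⊗ u.1.obj
  map f := A ◁ (leHom (leOfHom f)).f
  map_id u := by
    rw [Subsingleton.elim (leHom (leOfHom (𝟙 u))) (.id u.1)]
    simp [CentralIdempotent.Hom.id]
  map_comp f g := by
    rw [Subsingleton.elim (leHom (leOfHom (f ≫ g)))
      ((leHom (leOfHom f)).comp (leHom (leOfHom g)))]
    simp [CentralIdempotent.Hom.comp]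

/-- The cocone `A ⊗ U ⟶ A ⊗ J` for an upper bound `j` of `S`. -/
noncomputable def joinCocone (A : C) (S : Set (CentralIdempotent C)) (j : CentralIdempotent C)
    (h : ∀ u ∈ S, u ≤ j) : Limits.Cocone (joinDiagram A S) where
  pt := A ⊗ j.obj
  ι :=
    { app := fun u => A ◁ (leHom (h u.1 u.2)).f
      naturality := fun u v f => by
        rw [Subsingleton.elim (leHom (h u.1 u.2)) ((leHom (leOfHom f)).comp (leHom (h v.1 v.2)))]
        simp [CentralIdempotent.Hom.comp, joinDiagram] }

theorem le_of_isLUB {S : Set (CentralIdempotent C)} {j : CentralIdempotent C}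
    (h : IsLUB (toZI '' S) (toZI j)) : ∀ u ∈ S, u ≤ j :=
  fun u hu => toZI_le_toZI.1 (h.1 ⟨u, hu, rfl⟩)

variable (C) in
/-- Universal joins of central idempotents: all joins exist in `ZI C`, and for every set of central
idempotents closed under binary meets, with join `j`, and every object `A`, the cocone
`A ⊗ U ⟶ A ⊗ J` is a colimit. -/
structure HasUniversalJoins : Prop where
  exists_isLUB : ∀ S : Set (ZI C), ∃ a, IsLUB S a
  isColimit : ∀ S : Set (CentralIdempotent C),
    (∀ u ∈ S, ∀ v ∈ S, ∃ w ∈ S, IsGLB {toZI u, toZI v} (toZI w)) →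
    ∀ (j : CentralIdempotent C) (hj : IsLUB (toZI '' S) (toZI j)) (A : C),
      Nonempty (Limits.IsColimit (joinCocone A S j (le_of_isLUB hj)))

/-! ### Spatiality -/

/-- Completely prime filters of a partially ordered set. -/
structure CompletelyPrimeFilter (L : Type u) [PartialOrder L] where
  toPFilter : Order.PFilter L
  proper : ∃ a, a ∉ toPFilter
  completelyPrime : ∀ (S : Set L) (a : L), IsLUB S a → a ∈ toPFilter → ∃ s ∈ S, s ∈ toPFilter

/-- The topology generated by the sets `B_a = {P | a ∈ P}`. -/
instance (L : Type u) [PartialOrder L] : TopologicalSpace (CompletelyPrimeFilter L) :=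
  TopologicalSpace.generateFrom (Set.range fun a : L => {P | a ∈ P.toPFilter})

/-- Isomorphic to the frame of open sets of the completely prime spectrum. -/
def IsSpatial (L : Type u) [PartialOrder L] : Prop :=
  Nonempty (L ≃o TopologicalSpace.Opens (CompletelyPrimeFilter L))

variable (C) in
/-- The objects of `MonCat_j`: stiff monoidal categories with universal joins of central
idempotents, whose central idempotents form a spatial frame. -/
structure InMonCatJ : Prop where
  stiff : IsStiff C
  joins : HasUniversalJoins C
  spatial : IsSpatial (ZI C)

/-- The embedding `C ⥤ D[C]`, sending `A` to `(ZI C, A)` and `f` to the family `f ⊗ u`. -/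
def embeddingFunctor [IsStiff C] : C ⥤ Completion C where
  obj A := ⟨⊤, A⟩
  map f := Completion.ofHom le_rfl f

namespace Completion

variable [IsStiff C]

theorem whiskerRight_ofHom {X Y : Completion C} (h : X.D ≤ Y.D) (f : X.A ⟶ Y.A)
    (Z : Completion C) : (ofHom h f : X ⟶ Y) ▷ Z =
      (ofHom (inf_le_inf_right Z.D h) (f ▷ Z.A) : tensor X Z ⟶ tensor Y Z) :=
  whiskerR_ofHom h f Z

theorem whiskerLeft_ofHom (X : Completion C) {Y Z : Completion C} (h : Y.D ≤ Z.D)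
    (f : Y.A ⟶ Z.A) : X ◁ (ofHom h f : Y ⟶ Z) =
      (ofHom (inf_le_inf_left X.D h) (X.A ◁ f) : tensor X Y ⟶ tensor X Z) :=
  whiskerL_ofHom X h f

theorem associator_hom (X Y Z : Completion C) : (α_ X Y Z).hom =
    (ofHom (inf_assoc X.D Y.D Z.D).le (α_ X.A Y.A Z.A).hom :
      tensor (tensor X Y) Z ⟶ tensor X (tensor Y Z)) := rfl

theorem leftUnitor_hom (X : Completion C) : (λ_ X).hom =
    (ofHom (top_inf_eq X.D).le (λ_ X.A).hom : tensor (unitObj C) X ⟶ X) := rfl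

theorem rightUnitor_hom (X : Completion C) : (ρ_ X).hom =
    (ofHom (inf_top_eq X.D).le (ρ_ X.A).hom : tensor X (unitObj C) ⟶ X) := rfl

/-- The (strict) monoidal structure of the embedding. -/
noncomputable instance : (embeddingFunctor (C := C)).LaxMonoidal where
  ε := 𝟙 (unitObj C)
  μ A B := (ofHom le_top (𝟙 (A ⊗ B)) : tensor ⟨⊤, A⟩ ⟨⊤, B⟩ ⟶ ⟨⊤, A ⊗ B⟩)
  μ_natural_left f B := by
    dsimp only [embeddingFunctor]
    rw [whiskerRight_ofHom]
    refine (ofHom_comp_ofHom _ _ _ _).trans (Eq.trans ?_ (ofHom_comp_ofHom _ _ _ _).symm)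
    exact congrArg _ ((Category.comp_id (f ▷ B)).trans (Category.id_comp (f ▷ B)).symm)
  μ_natural_right A f := by
    dsimp only [embeddingFunctor]
    rw [whiskerLeft_ofHom]
    refine (ofHom_comp_ofHom _ _ _ _).trans (Eq.trans ?_ (ofHom_comp_ofHom _ _ _ _).symm)
    exact congrArg _ ((Category.comp_id (A ◁ f)).trans (Category.id_comp (A ◁ f)).symm)
  associativity X Y Z := by
    dsimp only [embeddingFunctor]
    rw [whiskerRight_ofHom, whiskerLeft_ofHom, associator_hom]
    rw [ofHom_comp_ofHom_assoc]
    refine (ofHom_comp_ofHom _ _ _ _).trans (Eq.trans ?_ (congrArg _ (ofHom_comp_ofHom _ _ _ _)).symm)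
    refine Eq.trans ?_ (ofHom_comp_ofHom _ _ _ _).symm
    have h : (𝟙 (X ⊗ Y) ▷ Z ≫ 𝟙 ((X ⊗ Y) ⊗ Z)) ≫ (α_ X Y Z).hom =
        (α_ X Y Z).hom ≫ X ◁ 𝟙 (Y ⊗ Z) ≫ 𝟙 (X ⊗ Y ⊗ Z) := by simp
    exact congrArg _ h
  left_unitality X := by
    dsimp only [embeddingFunctor]
    rw [id_eq_ofHom, whiskerRight_ofHom, leftUnitor_hom]
    refine Eq.trans ?_ (congrArg _ (ofHom_comp_ofHom _ _ _ _)).symm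
    refine Eq.trans ?_ (ofHom_comp_ofHom _ _ _ _).symm
    have h : (λ_ X).hom = 𝟙 (𝟙_ C) ▷ X ≫ 𝟙 (𝟙_ C ⊗ X) ≫ (λ_ X).hom := by simp
    exact congrArg _ h
  right_unitality X := by
    dsimp only [embeddingFunctor]
    rw [id_eq_ofHom, whiskerLeft_ofHom, rightUnitor_hom]
    refine Eq.trans ?_ (congrArg _ (ofHom_comp_ofHom _ _ _ _)).symm
    refine Eq.trans ?_ (ofHom_comp_ofHom _ _ _ _).symm
    have h : (ρ_ X).hom = X ◁ 𝟙 (𝟙_ C) ≫ 𝟙 (X ⊗ 𝟙_ C) ≫ (ρ_ X).hom := by simp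
    exact congrArg _ h

end Completion

variable (C) in
/-- The embedding of `C` into `D[C]` as a monoidal functor. -/
noncomputable abbrev embedding [IsStiff C] : LaxMonoidalFunctor C (Completion C) :=
  .of embeddingFunctor

end Basic

section Functors

universe v₁ v₂ v₃ v₄ u₁ u₂ u₃ u₄

open Functor.LaxMonoidal

variable {C : Type u₁} [Category.{v₁} C] [MonoidalCategory C]
  {D : Type u₂} [Category.{v₂} D] [MonoidalCategory D]
  {E : Type u₃} [Category.{v₃} E] [MonoidalCategory E]

/-- The identity lax monoidal functor. -/
abbrev laxId (C : Type u₁) [Category.{v₁} C] [MonoidalCategory C] : LaxMonoidalFunctor C C :=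
  .of (𝟭 C)

/-- Composition of lax monoidal functors. -/
abbrev laxComp (F : LaxMonoidalFunctor C D) (G : LaxMonoidalFunctor D E) :
    LaxMonoidalFunctor C E := .of (F.toFunctor ⋙ G.toFunctor)

/-- Lax monoidal functors that preserve central idempotents: the coherence morphisms `I ⟶ F I` and
`F A ⊗ F U ⟶ F (A ⊗ U)` are invertible, and `F U` carries a half-braiding that is compatible with
that of `U` and makes `F U ⟶ F I ≅ I` into a central idempotent. This half-braiding is unique
(`halfBraiding_unique`), so that it necessarily is the canonical one on `F I`, and on `F (U ⊗ V)`
the one induced by those on `F U` and `F V`. -/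
structure PreservesCentralIdempotents (F : C ⥤ D) [F.LaxMonoidal] : Prop where
  isIso_ε : IsIso (ε F)
  isIso_μ : ∀ (A : C) (u : CentralIdempotent C), IsIso (μ F A u.obj)
  exists_halfBraiding : ∀ u : CentralIdempotent C, ∃ τ : HalfBraiding (F.obj u.obj),
    (∀ A : C, (τ.β (F.obj A)).hom ≫ μ F A u.obj = μ F u.obj A ≫ F.map (u.σ.β A).hom) ∧
    IsCentralIdempotent τ (F.map u.counit ≫ inv (ε F))

/-- The action of `F` on central idempotents. -/
noncomputable def PreservesCentralIdempotents.map {F : C ⥤ D} [F.LaxMonoidal]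
    (h : PreservesCentralIdempotents F) (u : CentralIdempotent C) : CentralIdempotent D where
  obj := F.obj u.obj
  σ := (h.exists_halfBraiding u).choose
  counit := F.map u.counit ≫ @inv _ _ _ _ (ε F) h.isIso_ε
  isCentral := (h.exists_halfBraiding u).choose_spec.2

/-- `F` preserves joins of central idempotents. -/
def PreservesCentralIdempotents.PreservesJoins {F : C ⥤ D} [F.LaxMonoidal]
    (h : PreservesCentralIdempotents F) : Prop :=
  ∀ (S : Set (CentralIdempotent C)) (j : CentralIdempotent C), IsLUB (toZI '' S) (toZI j) →
    IsLUB ((fun u => toZI (h.map u)) '' S) (toZI (h.map j))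

/-- Lax monoidal functors that preserve central idempotents and their joins. -/
def IsJoinMorphism (F : C ⥤ D) [F.LaxMonoidal] : Prop :=
  ∃ h : PreservesCentralIdempotents F, h.PreservesJoins

theorem PreservesCentralIdempotents.id : PreservesCentralIdempotents (𝟭 C) where
  isIso_ε := by simp only [Functor.LaxMonoidal.id_ε]; infer_instance
  isIso_μ A u := by simp only [Functor.LaxMonoidal.id_μ]; infer_instance
  exists_halfBraiding u := ⟨u.σ, by simp, by simpa using u.isCentral⟩

theorem PreservesCentralIdempotents.comp {F : C ⥤ D} [F.LaxMonoidal] {G : D ⥤ E} [G.LaxMonoidal]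
    (hF : PreservesCentralIdempotents F) (hG : PreservesCentralIdempotents G) :
    PreservesCentralIdempotents (F ⋙ G) := by
  have := hF.isIso_ε
  have := hG.isIso_ε
  have : IsIso (ε (F ⋙ G)) := by rw [comp_ε]; infer_instance
  refine ⟨this, fun A u => ?_, fun u => ?_⟩
  · have := hF.isIso_μ A u
    have : IsIso (μ G (F.obj A) (F.obj u.obj)) := hG.isIso_μ (F.obj A) (hF.map u)
    rw [comp_μ]
    infer_instance
  · obtain ⟨h1, h2⟩ := (hG.exists_halfBraiding (hF.map u)).choose_spec
    refine ⟨(hG.map (hF.map u)).σ, fun A => ?_, ?_⟩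
    · have h3 := (hF.exists_halfBraiding u).choose_spec.1 A
      have h4 := h1 (F.obj A)
      rw [comp_μ, comp_μ]
      refine (Category.assoc _ _ _).symm.trans ((congrArg (· ≫ _) h4).trans ?_)
      refine (Category.assoc _ _ _).trans (Eq.trans ?_ (Category.assoc _ _ _).symm)
      exact congrArg _ ((G.map_comp _ _).symm.trans ((congrArg G.map h3).trans (G.map_comp _ _)))
    · have h3 := (hG.map (hF.map u)).isCentral
      have h5 : G.map (F.map u.counit ≫ inv (ε F)) ≫ inv (ε G) =
          (F ⋙ G).map u.counit ≫ inv (ε (F ⋙ G)) := by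
        rw [IsIso.eq_comp_inv]
        simp
      change IsCentralIdempotent _ (G.map (F.map u.counit ≫ inv (ε F)) ≫ inv (ε G)) at h3
      rw [h5] at h3
      exact h3

theorem PreservesCentralIdempotents.toZI_map_eq {F : C ⥤ D} [F.LaxMonoidal]
    (h : PreservesCentralIdempotents F) (u : CentralIdempotent C) (v : CentralIdempotent D)
    (e : F.obj u.obj ≅ v.obj)
    (he : e.hom ≫ v.counit ≫ ε F = F.map u.counit) : toZI (h.map u) = toZI v := by
  have := h.isIso_ε
  rw [toZI_eq_iff]
  exact ⟨.mk' e.hom (by simp [PreservesCentralIdempotents.map, ← he]), e.isIso_hom⟩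

theorem IsJoinMorphism.id : IsJoinMorphism (𝟭 C) := by
  refine ⟨.id, fun S j hj => ?_⟩
  have h : ∀ u : CentralIdempotent C,
      toZI ((PreservesCentralIdempotents.id (C := C)).map u) = toZI u :=
    fun u => PreservesCentralIdempotents.toZI_map_eq _ u u (Iso.refl _) (by simp)
  simpa only [h] using hj

theorem IsJoinMorphism.comp {F : C ⥤ D} [F.LaxMonoidal] {G : D ⥤ E} [G.LaxMonoidal]
    (hF : IsJoinMorphism F) (hG : IsJoinMorphism G) : IsJoinMorphism (F ⋙ G) := by
  obtain ⟨hF, kF⟩ := hF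
  obtain ⟨hG, kG⟩ := hG
  refine ⟨hF.comp hG, fun S j hj => ?_⟩
  have := hF.isIso_ε
  have := hG.isIso_ε
  have h : ∀ u : CentralIdempotent C, toZI ((hF.comp hG).map u) = toZI (hG.map (hF.map u)) :=
    fun u => PreservesCentralIdempotents.toZI_map_eq _ u _ (Iso.refl _) (by
      simp [PreservesCentralIdempotents.map])
  have key := kG (hF.map '' S) (hF.map j) (by
    have := kF S j hj
    rwa [Set.image_image])
  rw [Set.image_image] at key
  simpa only [h] using key

/-- Composition of lax monoidal functors respects monoidal natural isomorphisms. -/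
def laxCompIso {F F' : LaxMonoidalFunctor C D} {G G' : LaxMonoidalFunctor D E} (a : F ≅ F')
    (b : G ≅ G') : laxComp F G ≅ laxComp F' G' where
  hom := ⟨a.hom.hom ◫ b.hom.hom, NatTrans.IsMonoidal.hcomp _ _⟩
  inv := ⟨a.inv.hom ◫ b.inv.hom, NatTrans.IsMonoidal.hcomp _ _⟩
  hom_inv_id := by
    have h1 : a.hom.hom ≫ a.inv.hom = 𝟙 _ := congrArg LaxMonoidalFunctor.Hom.hom a.hom_inv_id
    have h2 : b.hom.hom ≫ b.inv.hom = 𝟙 _ := congrArg LaxMonoidalFunctor.Hom.hom b.hom_inv_id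
    apply LaxMonoidalFunctor.hom_ext
    change (a.hom.hom ◫ b.hom.hom) ≫ (a.inv.hom ◫ b.inv.hom) = 𝟙 _
    rw [← NatTrans.exchange, h1, h2]
    exact Functor.id_hcomp (F := F.toFunctor) (𝟙 G.toFunctor) |>.trans
      (Functor.whiskerLeft_id' _)
  inv_hom_id := by
    have h1 : a.inv.hom ≫ a.hom.hom = 𝟙 _ := congrArg LaxMonoidalFunctor.Hom.hom a.inv_hom_id
    have h2 : b.inv.hom ≫ b.hom.hom = 𝟙 _ := congrArg LaxMonoidalFunctor.Hom.hom b.inv_hom_id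
    apply LaxMonoidalFunctor.hom_ext
    change (a.inv.hom ◫ b.inv.hom) ≫ (a.hom.hom ◫ b.hom.hom) = 𝟙 _
    rw [← NatTrans.exchange, h1, h2]
    exact Functor.id_hcomp (F := F'.toFunctor) (𝟙 G'.toFunctor) |>.trans
      (Functor.whiskerLeft_id' _)

/-- Left unit law. -/
def laxIdComp (F : LaxMonoidalFunctor C D) : laxComp (laxId C) F ≅ F :=
  @LaxMonoidalFunctor.isoMk _ _ _ _ _ _ _ _ F.toFunctor.leftUnitor
    (inferInstanceAs (NatTrans.IsMonoidal F.toFunctor.leftUnitor.hom))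

/-- Right unit law. -/
def laxCompId (F : LaxMonoidalFunctor C D) : laxComp F (laxId D) ≅ F :=
  @LaxMonoidalFunctor.isoMk _ _ _ _ _ _ _ _ F.toFunctor.rightUnitor
    (inferInstanceAs (NatTrans.IsMonoidal F.toFunctor.rightUnitor.hom))

/-- Associativity. -/
def laxAssoc {E' : Type u₄} [Category.{v₄} E'] [MonoidalCategory E'] (F : LaxMonoidalFunctor C D)
    (G : LaxMonoidalFunctor D E) (H : LaxMonoidalFunctor E E') :
    laxComp (laxComp F G) H ≅ laxComp F (laxComp G H) :=
  @LaxMonoidalFunctor.isoMk _ _ _ _ _ _ _ _ (Functor.associator F.toFunctor G.toFunctor H.toFunctor)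
    (inferInstanceAs (NatTrans.IsMonoidal (Functor.associator F.toFunctor G.toFunctor H.toFunctor).hom))

end Functors

/-! ### The categories `MonCat_s` and `MonCat_j` -/

/-- Small stiff monoidal categories. -/
structure MonCatS : Type (u + 1) where
  carrier : Type u
  [cat : SmallCategory carrier]
  [monoidal : MonoidalCategory carrier]
  [stiff : IsStiff carrier]

/-- Small stiff monoidal categories with universal joins of central idempotents, whose central
idempotents form a spatial frame. -/
structure MonCatJ : Type (u + 1) where
  carrier : Type u
  [cat : SmallCategory carrier]
  [monoidal : MonoidalCategory carrier]
  isJ : InMonCatJ carrier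

attribute [instance] MonCatS.cat MonCatS.monoidal MonCatS.stiff MonCatJ.cat MonCatJ.monoidal

/-- Lax monoidal functors preserving central idempotents. -/
def MonCatS.PreHom (C D : MonCatS.{u}) : Type u :=
  {F : LaxMonoidalFunctor C.carrier D.carrier // PreservesCentralIdempotents F.toFunctor}

/-- Two functors are identified when they are monoidally naturally isomorphic. -/
instance MonCatS.homSetoid (C D : MonCatS.{u}) : Setoid (MonCatS.PreHom C D) where
  r F G := Nonempty (F.1 ≅ G.1)
  iseqv := ⟨fun F => ⟨Iso.refl F.1⟩, fun ⟨e⟩ => ⟨e.symm⟩, fun ⟨e⟩ ⟨f⟩ => ⟨e ≪≫ f⟩⟩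

/-- Lax monoidal functors preserving central idempotents and their joins. -/
def MonCatJ.PreHom (C D : MonCatJ.{u}) : Type u :=
  {F : LaxMonoidalFunctor C.carrier D.carrier // IsJoinMorphism F.toFunctor}

/-- Two functors are identified when they are monoidally naturally isomorphic. -/
instance MonCatJ.homSetoid (C D : MonCatJ.{u}) : Setoid (MonCatJ.PreHom C D) where
  r F G := Nonempty (F.1 ≅ G.1)
  iseqv := ⟨fun F => ⟨Iso.refl F.1⟩, fun ⟨e⟩ => ⟨e.symm⟩, fun ⟨e⟩ ⟨f⟩ => ⟨e ≪≫ f⟩⟩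

/-- Morphisms of `MonCat_s`: lax monoidal functors preserving central idempotents, up to monoidal
natural isomorphism. -/
instance : Category MonCatS.{u} where
  Hom C D := Quotient (MonCatS.homSetoid C D)
  id C := Quotient.mk _ ⟨laxId C.carrier, .id⟩
  comp := Quotient.map₂ (fun F G => ⟨laxComp F.1 G.1, F.2.comp G.2⟩)
    fun _ _ ⟨a⟩ _ _ ⟨b⟩ => ⟨laxCompIso a b⟩
  id_comp := by
    rintro C D ⟨F⟩
    exact Quotient.sound ⟨laxIdComp F.1⟩
  comp_id := by
    rintro C D ⟨F⟩
    exact Quotient.sound ⟨laxCompId F.1⟩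
  assoc := by
    rintro A B C D ⟨F⟩ ⟨G⟩ ⟨H⟩
    exact Quotient.sound ⟨laxAssoc F.1 G.1 H.1⟩

/-- Morphisms of `MonCat_j`: lax monoidal functors preserving central idempotents and their joins,
up to monoidal natural isomorphism. -/
instance : Category MonCatJ.{u} where
  Hom C D := Quotient (MonCatJ.homSetoid C D)
  id C := Quotient.mk _ ⟨laxId C.carrier, .id⟩
  comp := Quotient.map₂ (fun F G => ⟨laxComp F.1 G.1, F.2.comp G.2⟩)
    fun _ _ ⟨a⟩ _ _ ⟨b⟩ => ⟨laxCompIso a b⟩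
  id_comp := by
    rintro C D ⟨F⟩
    exact Quotient.sound ⟨laxIdComp F.1⟩
  comp_id := by
    rintro C D ⟨F⟩
    exact Quotient.sound ⟨laxCompId F.1⟩
  assoc := by
    rintro A B C D ⟨F⟩ ⟨G⟩ ⟨H⟩
    exact Quotient.sound ⟨laxAssoc F.1 G.1 H.1⟩

/-- The class of a lax monoidal functor preserving central idempotents. -/
def MonCatS.homMk {C D : MonCatS.{u}} (F : LaxMonoidalFunctor C.carrier D.carrier)
    (h : PreservesCentralIdempotents F.toFunctor) : C ⟶ D :=
  Quotient.mk (MonCatS.homSetoid C D) ⟨F, h⟩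

/-- The underlying object of `MonCat_s`. -/
abbrev MonCatJ.toS (C : MonCatJ.{u}) : MonCatS.{u} :=
  { carrier := C.carrier, stiff := C.isJ.stiff }

/-- The forgetful functor `MonCat_j ⥤ MonCat_s`. -/
def forgetJS : MonCatJ.{u} ⥤ MonCatS.{u} where
  obj C := C.toS
  map {C D} := Quotient.map' (s₁ := MonCatJ.homSetoid C D) (s₂ := MonCatS.homSetoid C.toS D.toS)
    (fun F => ⟨F.1, F.2.choose⟩) fun _ _ h => h
  map_id _ := rfl
  map_comp := by
    rintro A B C ⟨F⟩ ⟨G⟩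
    rfl

end CentralIdem

namespace CentralIdem

/-! ### Central idempotents: cancellation, half-braidings, meets and restriction -/

section General

variable {C : Type u} [Category.{v} C] [MonoidalCategory C]

/-! The central idempotents of `D[C]` are, up to equivalence, the inclusions `idem L : ⟨L, I⟩ ⟶ ⟨ZI,
I⟩` of down-closed sets (`exists_toZI_idem`, `lowerSetIso`). Given a central idempotent `u` of
`D[C]`, its meet with a principal `idem (↓a)` lies in the image of the full and faithful embedding.
So the component of `u` at `a` is a central idempotent of `C` (`exists_central_app`), and `u` is the
union of these. Tensoring with `idem L` cuts `⟨D, A⟩` down to `⟨D ∩ L, A⟩`, and a morphism restricts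
to `idem L` exactly when each component restricts to some element of `L`. Stiffness of `D[C]` is
thus inherited from `C`. Joins are unions, and they are universal because a morphism out of `⟨L, A⟩`
is a compatible family over `L`, which can be glued (`exists_glue`). A lattice of down-closed sets
is spatial, its elements `p` giving enough completely prime filters.

The extension of `F` has the value `F A ⊗ J` at `⟨L, A⟩`, where `J` is the join in `D` of the `F u`,
`u ∈ L`. A morphism of `D[C]` gives compatible maps on the pieces `F A ⊗ F U`. Universality of the
join glues them, and since restriction to a central idempotent is local
(`HasUniversalJoins.restrictsTo`), the result lands in the right subobject. The projection `F A ⊗ J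
⟶ F A` is monic, so every coherence law can be checked after projecting, where it becomes a law for
`F`. Distributivity of meets over joins supplies the tensorator. On `⟨ZI, A⟩` the result is
isomorphic to `F A`, and replacing these values along the isomorphism makes the restriction along
the embedding equal to `F`.

For uniqueness, `⟨L, A⟩` is `⟨ZI, A⟩ ⊗ idem L`, and `idem L` is the join of the images of the `u ∈
L`. A functor preserving central idempotents therefore sends `⟨L, A⟩ ⟶ ⟨ZI, A⟩` to a monomorphism,
so a transformation is determined on the embedding (`natTrans_ext`). If joins are preserved as well,
the images of the pieces `A ⊗ U` are jointly epic, which gives naturality of the extended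
transformation (`exists_natTrans`). The adjunction then follows from the bijection of hom-sets.

A recurring device: two maps `Z ⟶ A ⊗ U` agree once they agree over `A`, provided that `Z ⊗ U ⟶ Z`
is epic. It makes the half-braiding axioms automatic. -/

theorem isIso_tensor_whiskerLeft_counit {P : C} (p : P ⟶ 𝟙_ C) (h : IsIso (P ◁ p ≫ (ρ_ P).hom))
    {A : C} (β : P ⊗ A ≅ A ⊗ P) : IsIso ((P ⊗ A) ◁ p ≫ (ρ_ (P ⊗ A)).hom) := by
  have e : (P ⊗ A) ◁ p ≫ (ρ_ (P ⊗ A)).hom = β.hom ▷ P ≫ (α_ A P P).hom ≫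
      A ◁ (P ◁ p ≫ (ρ_ P).hom) ≫ β.inv := by
    rw [← cancel_mono β.hom, Category.assoc, ← rightUnitor_naturality, whisker_exchange_assoc]
    simp
  rw [e]
  infer_instance

/-- By `hc`, precomposing `k : Z ⟶ A ⊗ P` with the epimorphism `Z ⊗ P ⟶ Z` gives `(k ≫ A ◁ p ≫ ρ) ▷
P`, which depends only on the composite of `k` with the projection. This is `cancel_proj` for a bare
`p`, usable before any half-braiding is known. -/
theorem cancel_whiskerLeft_counit {P : C} (p : P ⟶ 𝟙_ C)
    (hc : p ▷ P ≫ (λ_ P).hom = P ◁ p ≫ (ρ_ P).hom) {Z A : C}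
    (hZ : Epi (Z ◁ p ≫ (ρ_ Z).hom)) {f g : Z ⟶ A ⊗ P}
    (h : f ≫ A ◁ p ≫ (ρ_ A).hom = g ≫ A ◁ p ≫ (ρ_ A).hom) : f = g := by
  have nat : ∀ k : Z ⟶ A ⊗ P, (Z ◁ p ≫ (ρ_ Z).hom) ≫ k =
      (k ≫ A ◁ p ≫ (ρ_ A).hom) ▷ P := fun k => by
    have e : (A ◁ p ≫ (ρ_ A).hom) ▷ P = (A ⊗ P) ◁ p ≫ (ρ_ (A ⊗ P)).hom := by
      have : (A ⊗ P) ◁ p ≫ (ρ_ (A ⊗ P)).hom = (α_ A P P).hom ≫ A ◁ (P ◁ p ≫ (ρ_ P).hom) := by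
        simp
      rw [this, ← hc]
      simp
    rw [comp_whiskerRight, e, ← whisker_exchange_assoc, Category.assoc, rightUnitor_naturality]
  rw [← cancel_epi (Z ◁ p ≫ (ρ_ Z).hom), nat, nat, h]

/-- Isomorphisms `P ⊗ A ≅ A ⊗ P` over `A` automatically form a half-braiding. -/
def CentralIdempotent.ofBraid {P : C} (p : P ⟶ 𝟙_ C)
    (hc : p ▷ P ≫ (λ_ P).hom = P ◁ p ≫ (ρ_ P).hom) (h : IsIso (P ◁ p ≫ (ρ_ P).hom))
    (β : ∀ A : C, P ⊗ A ≅ A ⊗ P)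
    (hβ : ∀ A : C, (β A).hom ≫ A ◁ p ≫ (ρ_ A).hom = p ▷ A ≫ (λ_ A).hom) :
    CentralIdempotent C where
  obj := P
  σ :=
    { β := β
      monoidal := fun A B => by
        -- The domain `P ⊗ (A ⊗ B)` absorbs `P`, so the hexagon may be compared over `A ⊗ B`, where
        -- `hβ` computes both sides; naturality is treated alike.
        have := isIso_tensor_whiskerLeft_counit p h (β (A ⊗ B))
        apply cancel_whiskerLeft_counit p hc inferInstance
        rw [hβ]
        have e : (α_ A B P).inv ≫ (A ⊗ B) ◁ p ≫ (ρ_ (A ⊗ B)).hom =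
            A ◁ (B ◁ p ≫ (ρ_ B).hom) := by simp
        have e' : (α_ A P B).hom ≫ A ◁ (p ▷ B ≫ (λ_ B).hom) = (A ◁ p ≫ (ρ_ A).hom) ▷ B := by
          simp
        simp only [Category.assoc]
        rw [e, ← MonoidalCategory.whiskerLeft_comp, hβ, e', ← comp_whiskerRight, hβ]
        simp
      naturality := fun {A B} f => by
        have := isIso_tensor_whiskerLeft_counit p h (β A)
        apply cancel_whiskerLeft_counit p hc inferInstance
        rw [Category.assoc, hβ, Category.assoc, ← whisker_exchange_assoc, rightUnitor_naturality,
          reassoc_of% (hβ A), ← leftUnitor_naturality, whisker_exchange_assoc] }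
  counit := p
  isCentral := ⟨by rw [hc]; exact h, hc, hβ⟩

namespace CentralIdempotent

/-- Transport of a central idempotent along an isomorphism. -/
def ofIso {P : C} (u : CentralIdempotent C) (e : P ≅ u.obj) : CentralIdempotent C :=
  have h1 : (e.hom ≫ u.counit) ▷ P ≫ (λ_ P).hom =
      (e.hom ⊗ₘ e.hom) ≫ (u.counit ▷ u.obj ≫ (λ_ u.obj).hom) ≫ e.inv := by
    rw [← Category.assoc, Iso.eq_comp_inv, MonoidalCategory.tensorHom_def]
    simp only [Category.assoc, comp_whiskerRight, ← leftUnitor_naturality]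
    rw [whisker_exchange_assoc]
  have h2 : P ◁ (e.hom ≫ u.counit) ≫ (ρ_ P).hom =
      (e.hom ⊗ₘ e.hom) ≫ (u.obj ◁ u.counit ≫ (ρ_ u.obj).hom) ≫ e.inv := by
    rw [← Category.assoc, Iso.eq_comp_inv, tensorHom_def']
    simp only [Category.assoc, MonoidalCategory.whiskerLeft_comp, ← rightUnitor_naturality]
    rw [whisker_exchange_assoc]
  have h3 := u.isCentral.isIso
  ofBraid (e.hom ≫ u.counit)
    (by rw [h1, h2, u.isCentral.central])
    (by rw [h2, ← u.isCentral.central]; infer_instance)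
    (fun A => whiskerRightIso e A ≪≫ u.σ.β A ≪≫ whiskerLeftIso A e.symm)
    (fun A => by
      simp only [Iso.trans_hom, whiskerRightIso_hom, whiskerLeftIso_hom, Iso.symm_hom,
        Category.assoc, comp_whiskerRight, ← u.isCentral.braid A]
      rw [← MonoidalCategory.whiskerLeft_comp_assoc, Iso.inv_hom_id_assoc])

theorem ofIso_counit {P : C} (u : CentralIdempotent C) (e : P ≅ u.obj) :
    (u.ofIso e).counit = e.hom ≫ u.counit := rfl

variable (C) in
/-- The tensor unit as a central idempotent. -/
def unit : CentralIdempotent C :=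
  ofBraid (𝟙 (𝟙_ C)) (by simp [unitors_equal]) (by infer_instance) (fun A => λ_ A ≪≫ (ρ_ A).symm)
    (fun A => by simp)

theorem le_unit (u : CentralIdempotent C) : u ≤ unit C :=
  ⟨.mk' u.counit (Category.comp_id _)⟩

theorem inf_counit (u v : CentralIdempotent C) :
    (u.inf v).counit = proj u.obj v ≫ u.counit := by
  simp only [proj, inf, tensorHom_def', unitors_equal]; simp

theorem le_inf {u v w : CentralIdempotent C} (h1 : w ≤ u) (h2 : w ≤ v) : w ≤ u.inf v := by
  obtain ⟨m⟩ := h1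
  obtain ⟨n⟩ := h2
  have h3 := w.isCentral.isIso
  -- Duplicate `W ≅ W ⊗ W` and send one copy to each factor.
  refine ⟨.mk' (inv (w.counit ▷ w.obj ≫ (λ_ w.obj).hom) ≫ (m.f ⊗ₘ n.f)) ?_⟩
  change (inv (w.counit ▷ w.obj ≫ (λ_ w.obj).hom) ≫ (m.f ⊗ₘ n.f)) ≫
    (u.counit ⊗ₘ v.counit) ≫ (λ_ (𝟙_ C)).hom = _
  rw [Category.assoc, IsIso.inv_comp_eq]
  rw [tensorHom_comp_tensorHom_assoc, m.w, n.w, MonoidalCategory.tensorHom_def]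
  simp

theorem isGLB_inf (u v : CentralIdempotent C) : IsGLB {toZI u, toZI v} (toZI (u.inf v)) := by
  refine ⟨?_, fun a ha => ?_⟩
  · rintro _ (rfl | rfl)
    · exact toZI_le_toZI.2 (inf_le_left u v)
    · exact toZI_le_toZI.2 (inf_le_right u v)
  · induction a using Quotient.inductionOn with
    | h w => exact toZI_le_toZI.2 (le_inf (toZI_le_toZI.1 (ha (Or.inl rfl)))
        (toZI_le_toZI.1 (ha (Or.inr rfl))))

end CentralIdempotent

theorem exists_toZI_eq (a : ZI C) : ∃ u : CentralIdempotent C, toZI u = a :=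
  Quotient.exists_rep a

theorem isIso_proj_tensor_right (A Z : C) (v : CentralIdempotent C) [IsIso (proj Z v)] :
    IsIso (proj (Z ⊗ A) v) := by
  rw [← swap_proj]; infer_instance

theorem isIso_hom_of_ge {u v : CentralIdempotent C} (m : u.Hom v) (h : v ≤ u) : IsIso m.f := by
  obtain ⟨n⟩ := h
  exact ⟨n.f, congrArg CentralIdempotent.Hom.f (Subsingleton.elim (m.comp n) (.id u)),
    congrArg CentralIdempotent.Hom.f (Subsingleton.elim (n.comp m) (.id v))⟩

/-- The inverse for `u` followed by `Z ⊗ U ⟶ Z ⊗ V` is a section of a monomorphism. -/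
theorem isIso_proj_of_le {Z : C} {u v : CentralIdempotent C} [IsIso (proj Z u)] (h : u ≤ v) 
    [Mono (proj Z v)] : IsIso (proj Z v) := by
  obtain ⟨m⟩ := h
  have : IsSplitEpi (proj Z v) := ⟨⟨inv (proj Z u) ≫ Z ◁ m.f, by simp [whiskerLeft_hom_proj]⟩⟩
  exact isIso_of_mono_of_isSplitEpi _

theorem restrictsTo_proj (A : C) (u : CentralIdempotent C) : RestrictsTo (proj A u) u :=
  restrictsTo_self u _

theorem restrictsTo_of_isIso_proj {Z B : C} (f : Z ⟶ B) (u : CentralIdempotent C)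
    [IsIso (proj Z u)] : RestrictsTo f u := by
  have : f = inv (proj Z u) ≫ proj Z u ≫ f := by simp
  rw [this]
  exact ((restrictsTo_proj Z u).postcomp f).precomp _

/-- The order is a special case of restriction, so results on restricting morphisms yield
inequalities between central idempotents. -/
theorem restrictsTo_counit {u v : CentralIdempotent C} : RestrictsTo u.counit v ↔ u ≤ v := by
  constructor
  · rintro ⟨g, hg⟩
    refine ⟨.mk' (g ≫ (λ_ _).hom) ?_⟩
    rw [← hg]
    simp [proj, ← unitors_equal]
  · rintro ⟨m⟩
    refine ⟨m.f ≫ (λ_ _).inv, ?_⟩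
    rw [← m.w]
    simp [proj, ← unitors_equal]

theorem tensor_proj_inf (A : C) (u v : CentralIdempotent C) :
    (α_ A u.obj v.obj).hom ≫ proj A (u.inf v) = proj (A ⊗ u.obj) v ≫ proj A u := by
  simp only [proj, CentralIdempotent.inf, MonoidalCategory.tensorHom_def', unitors_equal]
  simp

theorem inv_tensor_proj_inf (A : C) (u v : CentralIdempotent C) :
    (α_ A u.obj v.obj).inv ≫ proj (A ⊗ u.obj) v ≫ proj A u = proj A (u.inf v) := by
  rw [← tensor_proj_inf]
  exact Iso.inv_hom_id_assoc _ _

/-- Stiffness says that the projections are monic and that restrictions can be intersected. -/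
theorem isStiff_of_mono (hm : ∀ (A : C) (u : CentralIdempotent C), Mono (proj A u))
    (hr : ∀ {Z A : C} (f : Z ⟶ A) (u v : CentralIdempotent C), RestrictsTo f u → RestrictsTo f v →
      RestrictsTo f (u.inf v)) : IsStiff C where
  isPullback A u v := by
    have hw : proj A u ▷ v.obj ≫ proj A v = proj (A ⊗ u.obj) v ≫ proj A u :=
      proj_naturality _ _
    refine ⟨⟨hw⟩, ⟨Limits.PullbackCone.IsLimit.mk _
      (fun s => (hr (s.snd ≫ proj A u) u v ⟨_, rfl⟩ ⟨_, s.condition⟩).choose ≫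
        (α_ A u.obj v.obj).inv) (fun s => ?_) (fun s => ?_) (fun s m h1 h2 => ?_)⟩⟩
    all_goals
      obtain ⟨k, hk⟩ : { k // k = (hr (s.snd ≫ proj A u) u v ⟨_, rfl⟩ ⟨_, s.condition⟩).choose } :=
        ⟨_, rfl⟩
      have h := (hr (s.snd ≫ proj A u) u v ⟨_, rfl⟩ ⟨_, s.condition⟩).choose_spec
      rw [← hk] at h ⊢
      have h' : (k ≫ (α_ A u.obj v.obj).inv) ≫ proj (A ⊗ u.obj) v ≫ proj A u =
          s.snd ≫ proj A u :=
        (Category.assoc _ _ _).trans ((congrArg (k ≫ ·) (inv_tensor_proj_inf A u v)).trans h)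
    · rw [← cancel_mono (proj A v), Category.assoc, hw, h', s.condition]
    · rw [← cancel_mono (proj A u), Category.assoc, h']
    · rw [← cancel_mono (proj (A ⊗ u.obj) v), ← cancel_mono (proj A u), h2]
      simpa using h'.symm

theorem mono_proj_of_toZI_eq (A : C) {u v : CentralIdempotent C} (h : toZI u = toZI v)
    [Mono (proj A v)] : Mono (proj A u) := by
  obtain ⟨m, hm⟩ := toZI_eq_iff.1 h
  rw [← whiskerLeft_hom_proj A m]
  infer_instance

section Stiff

variable [IsStiff C]

theorem RestrictsTo.inf {Z A : C} {f : Z ⟶ A} {u v : CentralIdempotent C} (h : RestrictsTo f u)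
    (h' : RestrictsTo f v) : RestrictsTo f (u.inf v) := by
  obtain ⟨w, h1, h2, h3⟩ := h.exists_inf h'
  exact h3.mono (CentralIdempotent.le_inf h1 h2)

end Stiff

end General
-- Consequences of universal joins
section UniversalJoins

variable {C : Type u} [Category.{v} C] [MonoidalCategory C]

/-- Sets of central idempotents that are closed under binary meets. -/
def InfClosed (S : Set (CentralIdempotent C)) : Prop :=
  ∀ u ∈ S, ∀ v ∈ S, ∃ w ∈ S, IsGLB {toZI u, toZI v} (toZI w)

theorem joinCocone_ι_app (A : C) {S : Set (CentralIdempotent C)} {j : CentralIdempotent C}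
    (h : ∀ u ∈ S, u ≤ j) {u : CentralIdempotent C} (hu : u ∈ S) (m : u.Hom j) :
    (joinCocone A S j h).ι.app ⟨u, hu⟩ = A ◁ m.f := by
  rw [Subsingleton.elim m (leHom (h u hu))]
  rfl

theorem joinDiagram_map (A : C) {S : Set (CentralIdempotent C)} {u v : S} (f : u ⟶ v)
    (m : u.1.Hom v.1) : (joinDiagram A S).map f = A ◁ m.f := by
  rw [Subsingleton.elim m (leHom (leOfHom f))]
  rfl

theorem isColimit_joinCocone (A : C) {S : Set (CentralIdempotent C)} {j : CentralIdempotent C}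
    (h : ∀ u ∈ S, u ≤ j)
    (H : ∀ (Y : C) (k : ∀ u ∈ S, A ⊗ u.obj ⟶ Y), (∀ (u v : CentralIdempotent C) (hu : u ∈ S)
      (hv : v ∈ S) (m : u.Hom v), k u hu = A ◁ m.f ≫ k v hv) →
      ∃! f : A ⊗ j.obj ⟶ Y, ∀ (u : CentralIdempotent C) (hu : u ∈ S) (m : u.Hom j),
        A ◁ m.f ≫ f = k u hu) : Nonempty (Limits.IsColimit (joinCocone A S j h)) := by
  refine ⟨Limits.IsColimit.ofExistsUnique fun s => ?_⟩
  obtain ⟨f, hf, hf'⟩ := H s.pt (fun u hu => s.ι.app ⟨u, hu⟩) fun u v hu hv m => by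
    have e := s.w (homOfLE ⟨m⟩ : (⟨u, hu⟩ : S) ⟶ ⟨v, hv⟩)
    rw [joinDiagram_map A _ m] at e
    exact e.symm
  refine ⟨f, fun u => ?_, fun d hd => hf' d fun u hu m => ?_⟩
  · obtain ⟨m⟩ := h u.1 u.2
    rw [joinCocone_ι_app A h u.2 m]
    exact hf u.1 u.2 m
  · rw [← joinCocone_ι_app A h hu m]
    exact hd ⟨u, hu⟩

namespace HasUniversalJoins

variable (h : HasUniversalJoins C) {S : Set (CentralIdempotent C)} (hS : InfClosed S)
  {j : CentralIdempotent C} (hj : IsLUB (toZI '' S) (toZI j))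

include h hS hj

theorem hom_ext {A Y : C} {f g : A ⊗ j.obj ⟶ Y}
    (hfg : ∀ u ∈ S, ∀ m : u.Hom j, A ◁ m.f ≫ f = A ◁ m.f ≫ g) : f = g := by
  obtain ⟨hc⟩ := h.isColimit S hS j hj A
  refine hc.hom_ext fun u => ?_
  obtain ⟨m⟩ := le_of_isLUB hj u.1 u.2
  rw [joinCocone_ι_app A _ u.2 m]
  exact hfg u.1 u.2 m

theorem exists_desc {A Y : C} (k : ∀ u ∈ S, A ⊗ u.obj ⟶ Y)
    (hk : ∀ (u v : CentralIdempotent C) (hu : u ∈ S) (hv : v ∈ S) (m : u.Hom v),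
      k u hu = A ◁ m.f ≫ k v hv) :
    ∃ f : A ⊗ j.obj ⟶ Y, ∀ (u : CentralIdempotent C) (hu : u ∈ S) (m : u.Hom j),
      A ◁ m.f ≫ f = k u hu := by
  obtain ⟨hc⟩ := h.isColimit S hS j hj A
  refine ⟨hc.desc ⟨Y, ⟨fun u => k u.1 u.2, fun u v f => ?_⟩⟩, fun u hu m => ?_⟩
  · obtain ⟨m⟩ := leOfHom f
    rw [joinDiagram_map A f m]
    exact (hk _ _ u.2 v.2 m).symm.trans (Category.comp_id _).symm
  · rw [← joinCocone_ι_app A (le_of_isLUB hj) hu m]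
    exact hc.fac _ ⟨u, hu⟩

/-- The projections `Z ⊗ U ⟶ Z` are jointly epic if `Z ⊗ J ⟶ Z` is invertible. -/
theorem proj_ext {Z Y : C} [IsIso (proj Z j)] {f g : Z ⟶ Y}
    (hfg : ∀ u ∈ S, proj Z u ≫ f = proj Z u ≫ g) : f = g := by
  rw [← cancel_epi (proj Z j)]
  refine h.hom_ext hS hj fun u hu m => ?_
  rw [whiskerLeft_hom_proj_assoc, whiskerLeft_hom_proj_assoc]
  exact hfg u hu

/-- Restriction is local: the factorisations on the pieces `Z ⊗ U` are compatible because `proj B t`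
is monic, so they glue to `Z ⊗ J`, which is `Z` by assumption. -/
theorem restrictsTo [IsStiff C] {Z B : C} [IsIso (proj Z j)] {f : Z ⟶ B} {t : CentralIdempotent C}
    (hf : ∀ u ∈ S, RestrictsTo (proj Z u ≫ f) t) : RestrictsTo f t := by
  choose k hk using hf
  obtain ⟨g, hg⟩ := h.exists_desc hS hj k (fun u v hu hv m => by
    rw [← cancel_mono (proj B t), Category.assoc, hk, hk, whiskerLeft_hom_proj_assoc])
  refine ⟨inv (proj Z j) ≫ g, ?_⟩
  rw [Category.assoc, IsIso.inv_comp_eq]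
  refine h.hom_ext hS hj fun u hu m => ?_
  rw [reassoc_of% (hg u hu m), hk, whiskerLeft_hom_proj_assoc]

end HasUniversalJoins

/-- Meets distribute over joins. -/
theorem HasUniversalJoins.inf_le [IsStiff C] (h : HasUniversalJoins C)
    {S T : Set (CentralIdempotent C)} (hS : InfClosed S) (hT : InfClosed T)
    {j k t : CentralIdempotent C} (hj : IsLUB (toZI '' S) (toZI j))
    (hk : IsLUB (toZI '' T) (toZI k)) (ht : ∀ u ∈ S, ∀ v ∈ T, u.inf v ≤ t) : j.inf k ≤ t := by
  -- As an object, `J ⊗ K` absorbs both `j` and `k`, so restriction of its counit to `t` can be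
  -- tested first on the `u ∈ S` and then on the `v ∈ T`. On such a piece the morphism restricts to
  -- `u` and to `v`, hence to `u ∧ v ≤ t`.
  rw [← restrictsTo_counit]
  have h1 : IsIso (proj (j.inf k).obj j) := isIso_proj_obj_tensor k.obj j
  have h2 : IsIso (proj (j.inf k).obj k) := inferInstanceAs (IsIso (proj (j.obj ⊗ k.obj) k))
  refine h.restrictsTo hS hj fun u hu => ?_
  have h3 := isIso_proj_tensor_right u.obj (j.inf k).obj k
  refine h.restrictsTo hT hk fun v hv => ?_
  refine RestrictsTo.mono (RestrictsTo.inf ?_ ?_) (ht u hu v hv)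
  · exact ((restrictsTo_proj _ u).postcomp _).precomp _
  · exact (restrictsTo_proj _ v).postcomp _

end UniversalJoins
-- The central idempotents of `D[C]` given by down-closed sets
namespace Completion

variable {C : Type u} [Category.{v} C] [MonoidalCategory C] [IsStiff C]

theorem app_congr {X Y : Completion C} {η ζ : X ⟶ Y} (h : η = ζ) (u : CentralIdempotent C)
    (hu : toZI u ∈ X.D) : Hom.app η u hu = Hom.app ζ u hu := by rw [h]

theorem ofHom_comp_eq {X Y Z : Completion C} {h : X.D ≤ Y.D} {f : X.A ⟶ Y.A} {h' : Y.D ≤ Z.D}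
    {g : Y.A ⟶ Z.A} {e : X.A ⟶ Z.A} (k : X.D ≤ Z.D) (he : f ≫ g = e) :
    (ofHom h f : X ⟶ Y) ≫ (ofHom h' g : Y ⟶ Z) = ofHom k e := by
  rw [ofHom_comp_ofHom, he]

theorem ofHom_comp_eq_comp {X Y Y' Z : Completion C} {f : X.A ⟶ Y.A} {g : Y.A ⟶ Z.A}
    {f' : X.A ⟶ Y'.A} {g' : Y'.A ⟶ Z.A} (h : X.D ≤ Y.D) (h' : Y.D ≤ Z.D) (k : X.D ≤ Y'.D)
    (k' : Y'.D ≤ Z.D) (he : f ≫ g = f' ≫ g') :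
    (ofHom h f : X ⟶ Y) ≫ (ofHom h' g : Y ⟶ Z) = (ofHom k f' : X ⟶ Y') ≫ (ofHom k' g' : Y' ⟶ Z) := by
  rw [ofHom_comp_ofHom, ofHom_comp_ofHom, he]

instance mono_ofHom_id {L M : LowerSet (ZI C)} (h : L ≤ M) (A : C) :
    Mono (ofHom h (𝟙 A) : (⟨L, A⟩ : Completion C) ⟶ ⟨M, A⟩) := ⟨fun f g hfg => by
  ext u hu
  have := app_congr hfg u hu
  rw [comp_ofHom_app, comp_ofHom_app] at this
  simpa using this⟩

/-- A morphism factors through `⟨L, A⟩ ⟶ ⟨M, A⟩` as soon as its components restrict to `L`. -/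
theorem exists_factor {Z : Completion C} {L M : LowerSet (ZI C)} (h : L ≤ M) {A : C}
    (f : Z ⟶ ⟨M, A⟩) (hf : ∀ (u : CentralIdempotent C) (hu : toZI u ∈ Z.D),
      ∃ v : CentralIdempotent C, toZI v ∈ L ∧ RestrictsTo (Hom.app f u hu) v) :
    ∃ g : Z ⟶ ⟨L, A⟩, g ≫ ofHom h (𝟙 A) = f := by
  refine ⟨({ app := fun u hu => Hom.app f u hu, restricts := hf,
             compat := Hom.compat f } : Hom Z ⟨L, A⟩), ?_⟩
  ext u hu
  rw [comp_ofHom_app]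
  exact Category.comp_id _

/-- The central idempotent `⟨L, I⟩ ⟶ ⟨ZI, I⟩` of a down-closed set `L`. -/
noncomputable def idem (L : LowerSet (ZI C)) : CentralIdempotent (Completion C) :=
  .ofBraid (P := ⟨L, 𝟙_ C⟩) (ofHom le_top (𝟙 (𝟙_ C)))
    (by
      rw [whiskerLeft_ofHom, whiskerRight_ofHom, leftUnitor_hom, rightUnitor_hom]
      have h : (𝟙 (𝟙_ C)) ▷ 𝟙_ C ≫ (λ_ (𝟙_ C)).hom = 𝟙_ C ◁ 𝟙 (𝟙_ C) ≫ (ρ_ (𝟙_ C)).hom := by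
        simp [unitors_equal]
      exact ofHom_comp_eq_comp _ _ _ _ h)
    (by
      rw [whiskerLeft_ofHom, rightUnitor_hom]
      have : ofHom (inf_le_inf_left L le_top) (𝟙_ C ◁ 𝟙 (𝟙_ C)) ≫
          (ofHom (inf_top_eq L).le (ρ_ (𝟙_ C)).hom : tensor ⟨L, 𝟙_ C⟩ (unitObj C) ⟶ ⟨L, 𝟙_ C⟩) =
          (ofIso (X := tensor ⟨L, 𝟙_ C⟩ ⟨L, 𝟙_ C⟩) (Y := ⟨L, 𝟙_ C⟩) (inf_idem L)
            (ρ_ (𝟙_ C))).hom := by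
        have h : 𝟙_ C ◁ 𝟙 (𝟙_ C) ≫ (ρ_ (𝟙_ C)).hom = (ρ_ (𝟙_ C)).hom := by simp
        exact ofHom_comp_eq inf_le_left h
      exact this ▸ Iso.isIso_hom _)
    (fun X => ofIso (X := tensor ⟨L, 𝟙_ C⟩ X) (Y := tensor X ⟨L, 𝟙_ C⟩) (inf_comm L X.D)
      (λ_ X.A ≪≫ (ρ_ X.A).symm))
    (fun X => by
      rw [whiskerLeft_ofHom, whiskerRight_ofHom, leftUnitor_hom, rightUnitor_hom]
      dsimp only [ofIso]
      have h : (λ_ X.A ≪≫ (ρ_ X.A).symm).hom ≫ X.A ◁ 𝟙 (𝟙_ C) ≫ (ρ_ X.A).hom =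
          𝟙 (𝟙_ C) ▷ X.A ≫ (λ_ X.A).hom := by simp
      exact (congrArg _ (ofHom_comp_ofHom _ _ _ _)).trans
        (ofHom_comp_eq_comp _ _ _ _ h))

theorem idem_counit (L : LowerSet (ZI C)) :
    (idem L).counit = (ofHom le_top (𝟙 (𝟙_ C)) : (⟨L, 𝟙_ C⟩ : Completion C) ⟶ unitObj C) := rfl

/-- The isomorphism between `⟨D, A⟩ ⊗ ⟨L, I⟩` and `⟨D ∩ L, A⟩`. -/
def tensorIdemIso (X : Completion C) (L : LowerSet (ZI C)) :
    X ⊗ (idem L).obj ≅ ⟨X.D ⊓ L, X.A⟩ :=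
  ofIso (X := tensor X ⟨L, 𝟙_ C⟩) (Y := ⟨X.D ⊓ L, X.A⟩) rfl (ρ_ X.A)

/-- Tensoring with `idem L` only shrinks the down-closed set; the right unitor takes care of the
other component. -/
theorem proj_idem (X : Completion C) (L : LowerSet (ZI C)) :
    proj X (idem L) = (tensorIdemIso X L).hom ≫ (ofHom inf_le_left (𝟙 X.A) :
      (⟨X.D ⊓ L, X.A⟩ : Completion C) ⟶ X) := by
  have h : X.A ◁ 𝟙 (𝟙_ C) ≫ (ρ_ X.A).hom = (ρ_ X.A).hom ≫ 𝟙 X.A := by simp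
  have e := whiskerLeft_ofHom X (Y := ⟨L, 𝟙_ C⟩) (Z := unitObj C) le_top (𝟙 (𝟙_ C))
  exact (congrArg (· ≫ (ρ_ X).hom) e).trans
    (ofHom_comp_eq_comp (X := tensor X ⟨L, 𝟙_ C⟩) (Y := tensor X (unitObj C))
      (Y' := ⟨X.D ⊓ L, X.A⟩) (Z := X)
      (inf_le_inf_left X.D le_top) (inf_top_eq X.D).le le_rfl inf_le_left h)

/-- Factoring through `proj X (idem L)` means factoring through `⟨X.D ∩ L, X.A⟩`. Each component of
`f` already restricts to an element of `X.D`; stiffness of `C` combines this with a restriction to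
`L` into one to the intersection. -/
theorem restrictsTo_idem {Z X : Completion C} (f : Z ⟶ X) (L : LowerSet (ZI C)) :
    RestrictsTo f (idem L) ↔ ∀ (u : CentralIdempotent C) (hu : toZI u ∈ Z.D),
      ∃ v : CentralIdempotent C, toZI v ∈ L ∧ RestrictsTo (Hom.app f u hu) v := by
  constructor
  · rintro ⟨g, rfl⟩ u hu
    obtain ⟨v, hv, h⟩ := Hom.restricts (g ≫ (tensorIdemIso X L).hom) u hu
    refine ⟨v, mem_right hv, ?_⟩
    rw [proj_idem, ← Category.assoc, comp_ofHom_app]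
    exact h.postcomp _
  · intro h
    obtain ⟨g, hg⟩ := exists_factor (inf_le_left : X.D ⊓ L ≤ X.D) (A := X.A) f fun u hu => by
      obtain ⟨v, hv, h1⟩ := h u hu
      obtain ⟨v', hv', h2⟩ := Hom.restricts f u hu
      obtain ⟨w, h3, h4, h5⟩ := h1.exists_inf h2
      exact ⟨w, ⟨X.D.lower (toZI_le_toZI.2 h4) hv', L.lower (toZI_le_toZI.2 h3) hv⟩, h5⟩
    refine ⟨g ≫ (tensorIdemIso X L).inv, ?_⟩
    rw [proj_idem, Category.assoc, Iso.inv_hom_id_assoc]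
    exact hg

/-- Up to a unitor, the component of the counit at `u` is the counit of `u`; that it restricts to
some `v ∈ M` says `u ≤ v`, hence `u ∈ M`. -/
theorem idem_le_idem {L M : LowerSet (ZI C)} : idem L ≤ idem M ↔ L ≤ M := by
  rw [← restrictsTo_counit, restrictsTo_idem]
  constructor
  · intro h a ha
    obtain ⟨u, rfl⟩ := exists_toZI_eq a
    obtain ⟨v, hv, g, hg⟩ := h u ha
    refine M.lower (toZI_le_toZI.2 ?_) hv
    rw [← restrictsTo_counit]
    have hg' : (g : 𝟙_ C ⊗ u.obj ⟶ 𝟙_ C ⊗ v.obj) ≫ proj (𝟙_ C) v = proj (𝟙_ C) u ≫ 𝟙 _ := hg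
    refine ⟨(λ_ u.obj).inv ≫ g, (Category.assoc _ _ _).trans ((congrArg _ hg').trans ?_)⟩
    simp [proj, ← unitors_equal]
  · intro h u hu
    exact ⟨u, h hu, restrictsTo_self _ _⟩

end Completion
-- Lax monoidal functors and central idempotents
section LaxFunctors

universe v₁ v₂ u₁ u₂

open Functor.LaxMonoidal

variable {C : Type u₁} [Category.{v₁} C] [MonoidalCategory C]
  {D : Type u₂} [Category.{v₂} D] [MonoidalCategory D] (F : C ⥤ D) [F.LaxMonoidal]

theorem μ_map_whiskerLeft_rightUnitor [IsIso (ε F)] (A : C) {P : C} (p : P ⟶ 𝟙_ C) :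
    μ F A P ≫ F.map (A ◁ p ≫ (ρ_ A).hom) =
      F.obj A ◁ (F.map p ≫ inv (ε F)) ≫ (ρ_ (F.obj A)).hom := by
  rw [F.map_comp, ← μ_natural_right_assoc, MonoidalCategory.whiskerLeft_comp, Category.assoc]
  congr 1
  rw [right_unitality, ← MonoidalCategory.whiskerLeft_comp_assoc]
  simp

theorem μ_map_whiskerRight_leftUnitor [IsIso (ε F)] (A : C) {P : C} (p : P ⟶ 𝟙_ C) :
    μ F P A ≫ F.map (p ▷ A ≫ (λ_ A).hom) =
      (F.map p ≫ inv (ε F)) ▷ F.obj A ≫ (λ_ (F.obj A)).hom := by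
  rw [F.map_comp, ← μ_natural_left_assoc, comp_whiskerRight, Category.assoc]
  congr 1
  rw [left_unitality, ← comp_whiskerRight_assoc]
  simp

/-- Compatibility of the half-braidings is automatic. -/
theorem preservesCentralIdempotents_of_iso (h1 : IsIso (ε F))
    (h2 : ∀ (A : C) (u : CentralIdempotent C), IsIso (μ F A u.obj))
    (h3 : ∀ u : CentralIdempotent C, ∃ (w : CentralIdempotent D) (e : F.obj u.obj ≅ w.obj),
      e.hom ≫ w.counit = F.map u.counit ≫ inv (ε F)) : PreservesCentralIdempotents F where
  isIso_ε := h1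
  isIso_μ := h2
  exists_halfBraiding u := by
    obtain ⟨w, e, he⟩ := h3 u
    have hc := (w.ofIso e).isCentral
    rw [CentralIdempotent.ofIso_counit, he] at hc
    refine ⟨_, fun A => ?_, hc⟩
    have := h2 A u
    let w' : CentralIdempotent D := ⟨F.obj u.obj, _, _, hc⟩
    have hw' : IsIso (proj (F.obj u.obj ⊗ F.obj A) w') := isIso_proj_obj_tensor (F.obj A) w'
    rw [← cancel_mono (inv (μ F A u.obj)), Category.assoc, IsIso.hom_inv_id, Category.comp_id]
    -- The domain `F U ⊗ F A` absorbs `w'`, so it suffices to compare over `F A`. There the braiding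
    -- law of `w'` meets the image under `F` of that of `u`.
    apply cancel_proj w'
    refine (hc.braid (F.obj A)).trans ?_
    have h4 : proj (F.obj A) w' = μ F A u.obj ≫ F.map (proj A u) :=
      (μ_map_whiskerLeft_rightUnitor F A u.counit).symm
    rw [h4, Category.assoc, IsIso.inv_hom_id_assoc, Category.assoc, ← F.map_comp]
    refine (μ_map_whiskerRight_leftUnitor F A u.counit).symm.trans ?_
    rw [← u.isCentral.braid A]
    rfl

variable {F}

theorem PreservesCentralIdempotents.μ_map_proj (h : PreservesCentralIdempotents F) (A : C)
    (u : CentralIdempotent C) : μ F A u.obj ≫ F.map (proj A u) = proj (F.obj A) (h.map u) := by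
  have := h.isIso_ε
  exact μ_map_whiskerLeft_rightUnitor F A u.counit

/-- The coherence isomorphism `F A ⊗ F U ≅ F (A ⊗ U)`. -/
noncomputable def PreservesCentralIdempotents.μIso (h : PreservesCentralIdempotents F) (A : C)
    (u : CentralIdempotent C) : F.obj A ⊗ (h.map u).obj ≅ F.obj (A ⊗ u.obj) :=
  @asIso D _ (F.obj A ⊗ F.obj u.obj) _ (μ F A u.obj) (h.isIso_μ A u)

theorem PreservesCentralIdempotents.μIso_map_proj (h : PreservesCentralIdempotents F) (A : C)
    (u : CentralIdempotent C) : (h.μIso A u).hom ≫ F.map (proj A u) = proj (F.obj A) (h.map u) :=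
  h.μ_map_proj A u

theorem PreservesCentralIdempotents.mono (h : PreservesCentralIdempotents F)
    {u v : CentralIdempotent C} (huv : u ≤ v) : h.map u ≤ h.map v := by
  obtain ⟨m⟩ := huv
  have := h.isIso_ε
  exact ⟨.mk' (F.map m.f) (by simp [PreservesCentralIdempotents.map, ← F.map_comp_assoc, m.w])⟩

theorem PreservesCentralIdempotents.toZI_congr (h : PreservesCentralIdempotents F)
    {u v : CentralIdempotent C} (huv : toZI u = toZI v) : toZI (h.map u) = toZI (h.map v) :=
  le_antisymm (toZI_le_toZI.2 (h.mono (toZI_le_toZI.1 huv.le)))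
    (toZI_le_toZI.2 (h.mono (toZI_le_toZI.1 huv.ge)))

theorem PreservesCentralIdempotents.toZI_map_inf (h : PreservesCentralIdempotents F)
    (u v : CentralIdempotent C) : toZI (h.map (u.inf v)) = toZI ((h.map u).inf (h.map v)) := by
  have := h.isIso_μ u.obj v
  have := h.isIso_ε
  refine toZI_map_eq h _ _ (asIso (μ F u.obj v.obj)).symm ?_
  change inv (μ F u.obj v.obj) ≫ ((h.map u).inf (h.map v)).counit ≫ ε F = _
  have e : ((h.map u).inf (h.map v)).counit ≫ ε F =
      μ F u.obj v.obj ≫ F.map (u.inf v).counit := by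
    rw [CentralIdempotent.inf_counit, CentralIdempotent.inf_counit]
    refine (Category.assoc _ _ _).trans ?_
    refine (congrArg (_ ≫ ·) (show (h.map u).counit ≫ ε F = F.map u.counit by
      simp [PreservesCentralIdempotents.map])).trans ?_
    refine (congrArg (· ≫ F.map u.counit) (h.μ_map_proj u.obj v).symm).trans ?_
    exact (Category.assoc _ _ _).trans (congrArg _ (F.map_comp _ _).symm)
  exact (congrArg (inv (μ F u.obj v.obj) ≫ ·) e).trans
    (IsIso.inv_hom_id_assoc (μ F u.obj v.obj) _)

theorem PreservesCentralIdempotents.infClosed_image (h : PreservesCentralIdempotents F)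
    {S : Set (CentralIdempotent C)} (hS : ∀ u ∈ S, ∀ v ∈ S, u.inf v ∈ S) :
    InfClosed (h.map '' S) := by
  rintro _ ⟨u, hu, rfl⟩ _ ⟨v, hv, rfl⟩
  refine ⟨_, ⟨_, hS u hu v hv, rfl⟩, ?_⟩
  rw [h.toZI_map_inf]
  exact CentralIdempotent.isGLB_inf _ _

/-- A full and faithful monoidal functor reflects central idempotents. -/
theorem exists_centralIdempotent_of_map [F.Full] [F.Faithful] [IsIso (ε F)]
    [∀ A B, IsIso (μ F A B)] {P : C} (p : P ⟶ 𝟙_ C) (w : CentralIdempotent D)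
    (e : F.obj P ≅ w.obj) (he : e.hom ≫ w.counit = F.map p ≫ inv (ε F)) :
    ∃ u : CentralIdempotent C, ∃ e' : P ≅ u.obj, e'.hom ≫ u.counit = p := by
  obtain ⟨τ, hc⟩ : ∃ τ : HalfBraiding (F.obj P), IsCentralIdempotent τ (F.map p ≫ inv (ε F)) :=
    ⟨(w.ofIso e).σ, he ▸ (w.ofIso e).isCentral⟩
  have h1 := hc.central
  rw [← μ_map_whiskerLeft_rightUnitor, ← μ_map_whiskerRight_leftUnitor, cancel_epi] at h1
  have h1' := F.map_injective h1
  have h2 := hc.isIso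
  rw [← μ_map_whiskerRight_leftUnitor, h1', isIso_comp_left_iff] at h2
  have h2' : IsIso (P ◁ p ≫ (ρ_ P).hom) := isIso_of_fully_faithful F _
  -- The half-braiding on `F P` is needed only at objects `F A`; conjugated by `μ` it lifts along
  -- `F`. Naturality and the hexagon come for free from `ofBraid`.
  refine ⟨.ofBraid p h1' h2' (fun A => F.preimageIso ((asIso (μ F P A)).symm ≪≫
    τ.β (F.obj A) ≪≫ asIso (μ F A P))) (fun A => F.map_injective ?_), Iso.refl _,
    Category.id_comp _⟩
  have h3 := hc.braid (F.obj A)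
  rw [← μ_map_whiskerLeft_rightUnitor, ← μ_map_whiskerRight_leftUnitor] at h3
  rw [F.map_comp]
  simpa using h3

end LaxFunctors
-- Gluing in `D[C]`, the embedding, and components of central idempotents
namespace Completion

variable {C : Type u} [Category.{v} C] [MonoidalCategory C] [IsStiff C]

instance mono_ofHom {X Y : Completion C} (h : X.D ≤ Y.D) (f : X.A ⟶ Y.A) [Mono f] :
    Mono (ofHom h f : X ⟶ Y) := ⟨fun p q hpq => by
  ext u hu
  have := app_congr hpq u hu
  rw [comp_ofHom_app, comp_ofHom_app, cancel_mono] at this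
  exact this⟩

/-- The image of a morphism of `C` under the embedding. -/
abbrev topHom {A B : C} (f : A ⟶ B) : (⟨⊤, A⟩ : Completion C) ⟶ ⟨⊤, B⟩ :=
  ofHom (le_refl (⊤ : LowerSet (ZI C))) f

/-- The monomorphism `⟨D, A⟩ ⟶ ⟨ZI, A⟩`. -/
abbrev toTop (X : Completion C) : X ⟶ ⟨⊤, X.A⟩ := ofHom le_top (𝟙 X.A)

/-! #### Gluing -/

section Glue

variable {ι : Type*} {M : ι → LowerSet (ZI C)} {L : LowerSet (ZI C)} (hM : ∀ i, M i ≤ L)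
  (hL : ∀ a ∈ L, ∃ i, a ∈ M i) {A : C} {Y : Completion C}

include hL in
theorem glue_ext {f g : (⟨L, A⟩ : Completion C) ⟶ Y}
    (h : ∀ i, (ofHom (hM i) (𝟙 A) : (⟨M i, A⟩ : Completion C) ⟶ _) ≫ f = ofHom (hM i) (𝟙 A) ≫ g) :
    f = g := by
  ext u hu
  obtain ⟨i, hi⟩ := hL _ hu
  have := app_congr (h i) u hi
  rw [ofHom_comp_app, ofHom_comp_app] at this
  simpa using this

include hL in
-- A morphism out of `⟨L, A⟩` is a family indexed by `L`, so it can be defined piecewise over a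
-- cover of `L`. Compatibility is asked in a form suited to families closed under binary meets: the
-- intersection of two pieces is again a piece, and its morphism is the restriction of both.
theorem exists_glue (f : ∀ i, (⟨M i, A⟩ : Completion C) ⟶ Y)
    (hf : ∀ i k, ∃ l, M i ⊓ M k ≤ M l ∧ ∃ (h : M l ≤ M i) (h' : M l ≤ M k),
      f l = ofHom h (𝟙 A) ≫ f i ∧ f l = ofHom h' (𝟙 A) ≫ f k) :
    ∃ g : (⟨L, A⟩ : Completion C) ⟶ Y, ∀ i,
      (ofHom (hM i) (𝟙 A) : (⟨M i, A⟩ : Completion C) ⟶ _) ≫ g = f i := by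
  have key : ∀ i k (u : CentralIdempotent C) (hi : toZI u ∈ M i) (hk : toZI u ∈ M k),
      Hom.app (f i) u hi = Hom.app (f k) u hk := fun i k u hi hk => by
    obtain ⟨l, h1, h2, h3, h4, h5⟩ := hf i k
    have e1 := app_congr h4 u (h1 ⟨hi, hk⟩)
    have e2 := app_congr h5 u (h1 ⟨hi, hk⟩)
    rw [ofHom_comp_app] at e1 e2
    simpa using e1.symm.trans e2
  choose idx hidx using hL
  refine ⟨({ app := fun u hu => Hom.app (f (idx _ hu)) u (hidx _ hu)
             restricts := fun u hu => Hom.restricts (f (idx _ hu)) u (hidx _ hu)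
             compat := fun u u' m hu hu' => ?_ } : Hom ⟨L, A⟩ Y), fun i => ?_⟩
  -- The piece containing `u'` is down-closed and so contains `u`; compatibility then takes place
  -- inside a single piece.
  · have h := (M (idx _ hu')).lower (toZI_le_toZI.2 ⟨m⟩) (hidx _ hu')
    rw [key _ (idx _ hu') u _ h]
    exact Hom.compat _ _ _ m _ _
  · ext u hu
    rw [ofHom_comp_app]
    refine Eq.trans ?_ (key _ _ u (hidx _ (hM i hu)) hu)
    simp

end Glue

/-! #### The embedding -/

instance : IsIso (Functor.LaxMonoidal.ε (embeddingFunctor (C := C))) :=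
  inferInstanceAs (IsIso (𝟙 (unitObj C)))

theorem comp_inv_ε {X : Completion C} (f : X ⟶ (embeddingFunctor (C := C)).obj (𝟙_ C)) :
    f ≫ inv (Functor.LaxMonoidal.ε (embeddingFunctor (C := C))) = f :=
  ((Category.comp_id _).symm.trans (Category.assoc _ _ _)).trans
    ((congrArg (f ≫ ·) (IsIso.inv_hom_id
      (Functor.LaxMonoidal.ε (embeddingFunctor (C := C))))).trans (Category.comp_id f))

instance (A B : C) : IsIso (Functor.LaxMonoidal.μ (embeddingFunctor (C := C)) A B) :=
  (ofIso (X := tensor ⟨⊤, A⟩ ⟨⊤, B⟩) (Y := ⟨⊤, A ⊗ B⟩) (inf_top_eq _) (Iso.refl _)).isIso_hom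

/-- The unit is the largest central idempotent, so the component there determines all others. This
is why the embedding is full. -/
theorem topHom_app_unit {A B : C} (f : (⟨⊤, A⟩ : Completion C) ⟶ ⟨⊤, B⟩) :
    topHom ((ρ_ A).inv ≫ Hom.app f (.unit C) trivial) = f := by
  ext u hu
  obtain ⟨m⟩ := u.le_unit
  rw [Hom.compat f u _ m hu trivial, ofHom_app]
  have : m.f = u.counit := m.w ▸ (Category.comp_id _).symm
  rw [this, proj, Category.assoc]
  exact congrArg _ (Iso.hom_inv_id_assoc _ _)

theorem topHom_injective {A B : C} {f g : A ⟶ B} (h : topHom f = topHom g) : f = g := by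
  have : proj A (.unit C) ≫ f = proj A (.unit C) ≫ g := app_congr h (.unit C) trivial
  have e : IsIso (proj A (.unit C)) := inferInstanceAs (IsIso (A ◁ 𝟙 _ ≫ (ρ_ A).hom))
  exact (cancel_epi _).1 this

instance : (embeddingFunctor (C := C)).Full where
  map_surjective f := ⟨_, topHom_app_unit f⟩

instance : (embeddingFunctor (C := C)).Faithful where
  map_injective h := topHom_injective h

/-- `⟨↓a, A⟩` is isomorphic to the image of `A ⊗ a`. -/
theorem exists_principalIso (A : C) (a : CentralIdempotent C) {L : LowerSet (ZI C)}
    (ha : toZI a ∈ L) (hL : ∀ w, toZI w ∈ L → w ≤ a) :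
    ∃ e : (⟨⊤, A ⊗ a.obj⟩ : Completion C) ≅ ⟨L, A⟩,
      e.hom ≫ toTop ⟨L, A⟩ =
        topHom (proj A a) := by
  obtain ⟨f, hf⟩ := exists_factor (le_top : L ≤ ⊤) (A := A)
    (topHom (proj A a)) fun u hu =>
      ⟨a, ha, (restrictsTo_proj A a).precomp _⟩
  obtain ⟨g, hg⟩ : ∃ g : (⟨L, A⟩ : Completion C) ⟶ ⟨⊤, A ⊗ a.obj⟩,
      g ≫ topHom (proj A a) =
        toTop ⟨L, A⟩ := by
    refine ⟨({ app := fun w hw => A ◁ (leHom (hL w hw)).f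
               restricts := fun w hw => ⟨w, trivial, restrictsTo_self _ _⟩
               compat := fun w w' m hw hw' => by
                rw [Subsingleton.elim (leHom (hL w hw)) (m.comp (leHom (hL w' hw')))]
                simp [CentralIdempotent.Hom.comp] } : Hom ⟨L, A⟩ ⟨⊤, A ⊗ a.obj⟩), ?_⟩
    ext w hw
    rw [comp_ofHom_app, ofHom_app]
    exact (whiskerLeft_hom_proj A (leHom (hL w hw))).trans (Category.comp_id _).symm
  refine ⟨⟨f, g, ?_, ?_⟩, hf⟩
  · rw [← cancel_mono (topHom (proj A a)),
      Category.assoc, hg, hf, Category.id_comp]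
  · rw [← cancel_mono (toTop ⟨L, A⟩), Category.assoc, hf,
      hg, Category.id_comp]

/-- A morphism into the image of the embedding is given on `⟨↓a, A⟩` by its component at `a`. -/
theorem comp_eq_ofHom_app {X : Completion C} {B : C} (k : X ⟶ ⟨⊤, B⟩) (a : CentralIdempotent C)
    (ha : toZI a ∈ X.D) (f : (⟨⊤, X.A ⊗ a.obj⟩ : Completion C) ⟶ X)
    (hf : f ≫ toTop X = topHom (proj X.A a)) :
    f ≫ k = topHom (Hom.app k a ha) := by
  ext w hw
  rw [ofHom_app]
  refine Hom.comp_app f k hw ha _ ?_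
  have := app_congr hf w hw
  rw [comp_ofHom_app, ofHom_app] at this
  exact this.symm.trans (Category.comp_id _)

/-! #### Central idempotents of the completion -/

omit [IsStiff C] in
theorem mem_Iic_self (a : CentralIdempotent C) : toZI a ∈ LowerSet.Iic (toZI a) := le_refl (toZI a)

theorem exists_principal_proj (X : Completion C) (a : CentralIdempotent C) (ha : toZI a ∈ X.D) :
    ∃ e : (⟨⊤, X.A ⊗ a.obj⟩ : Completion C) ≅ X ⊗ (idem (LowerSet.Iic (toZI a))).obj,
      (e.hom ≫ proj X (idem (LowerSet.Iic (toZI a)))) ≫ toTop X =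
        topHom (proj X.A a) := by
  obtain ⟨e, he⟩ := exists_principalIso X.A a (L := X.D ⊓ LowerSet.Iic (toZI a))
    ⟨ha, mem_Iic_self a⟩ fun w hw => toZI_le_toZI.1 (mem_right hw)
  refine ⟨e ≪≫ (tensorIdemIso X (LowerSet.Iic (toZI a))).symm, ?_⟩
  rw [proj_idem, ← he]
  simp

/-- The meet of `u` with `idem (↓a)` is central, and its object is the image of `u.obj.A ⊗ a` under
the embedding. A full and faithful functor with invertible coherence maps reflects central
idempotents, so the component of the counit at `a` is one in `C`. The morphism `f` will witness that
its image lies below `u`. -/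
theorem exists_central_app (u : CentralIdempotent (Completion C)) (a : CentralIdempotent C)
    (ha : toZI a ∈ u.obj.D) : ∃ (v : CentralIdempotent C) (e : u.obj.A ⊗ a.obj ≅ v.obj),
      e.hom ≫ v.counit = Hom.app u.counit a ha ∧
      ∃ f : (⟨⊤, v.obj⟩ : Completion C) ⟶ u.obj,
        f ≫ u.counit = topHom v.counit := by
  obtain ⟨e, he⟩ := exists_principal_proj u.obj a ha
  have h := comp_eq_ofHom_app u.counit a ha _ he
  rw [Category.assoc] at h
  have hw := CentralIdempotent.inf_counit u (idem (LowerSet.Iic (toZI a)))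
  obtain ⟨v, e', he'⟩ := exists_centralIdempotent_of_map (F := embeddingFunctor (C := C))
    (Hom.app u.counit a ha) (u.inf (idem (LowerSet.Iic (toZI a))))
    e
    (by
      rw [hw]
      exact h.trans (comp_inv_ε _).symm)
  refine ⟨v, e', he', topHom e'.inv ≫ e.hom ≫
      proj u.obj (idem (LowerSet.Iic (toZI a))), ?_⟩
  rw [Category.assoc, Category.assoc, h]
  refine ofHom_comp_eq _ ?_
  rw [← he', Iso.inv_hom_id_assoc]

end Completion
-- Lattices of down-closed sets are spatial
section Spatial

/-- A partially ordered set of down-closed sets is spatial. -/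
theorem isSpatial_of_orderIso {L P : Type u} [PartialOrder L] [Preorder P]
    (e : L ≃o LowerSet P) : IsSpatial L := by
  let B : L → TopologicalSpace.Opens (CompletelyPrimeFilter L) := fun a =>
    ⟨{Q | a ∈ Q.toPFilter}, TopologicalSpace.isOpen_generateFrom_of_mem ⟨a, rfl⟩⟩
  have hle : ∀ a b, B a ≤ B b ↔ a ≤ b := fun a b => by
    constructor
    · intro h
      rw [← e.le_iff_le]
      intro p hp
      -- The point of the spectrum attached to `p` is the filter of all down-closed sets containing
      -- `p`. It is completely prime because joins are unions, and it separates `a` from `b` when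
      -- `p` lies in the first only.
      let Q : CompletelyPrimeFilter L :=
        { toPFilter := Order.IsPFilter.toPFilter (F := {c | p ∈ e c}) (by
            refine Order.IsPFilter.of_def ⟨a, hp⟩ ?_ ?_
            · intro x hx y hy
              refine ⟨e.symm (e x ⊓ e y), ?_, ?_, ?_⟩
              · change p ∈ e (e.symm (e x ⊓ e y))
                rw [e.apply_symm_apply]
                exact ⟨hx, hy⟩
              · exact e.symm_apply_le.2 inf_le_left
              · exact e.symm_apply_le.2 inf_le_right
            · intro x y hxy hx
              exact e.monotone hxy hx)
          proper := ⟨e.symm ⊥, fun h => by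
            have : p ∈ e (e.symm ⊥) := h
            rw [e.apply_symm_apply] at this
            exact this⟩
          completelyPrime := fun S c hc hp => by
            have h1 : IsLUB (e '' S) (e c) := e.isLUB_image'.2 hc
            have h2 : e c = sSup (e '' S) := h1.unique (isLUB_sSup _)
            have h3 : p ∈ sSup (e '' S) := h2 ▸ hp
            rw [LowerSet.mem_sSup_iff] at h3
            obtain ⟨_, ⟨s, hs, rfl⟩, h4⟩ := h3
            exact ⟨s, hs, h4⟩ }
      exact h (show Q ∈ B a from hp)
    · intro h Q hQ
      exact Q.toPFilter.mem_of_le h hQ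
  have hsurj : Function.Surjective B := by
    -- The basic open sets already form a topology: filters give finite intersections, and complete
    -- primality gives arbitrary unions.
    have key : ∀ U : Set (CompletelyPrimeFilter L), IsOpen U →
        ∃ a, U = {Q | a ∈ Q.toPFilter} := fun U hU => by
      induction hU with
      | basic s hs => obtain ⟨a, rfl⟩ := hs; exact ⟨a, rfl⟩
      | univ =>
        refine ⟨e.symm ⊤, (Set.eq_univ_of_forall fun Q => ?_).symm⟩
        obtain ⟨x, hx⟩ := Q.toPFilter.nonempty
        exact Q.toPFilter.mem_of_le (e.le_symm_apply.2 le_top) hx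
      | inter s t _ _ hs ht =>
        obtain ⟨a, rfl⟩ := hs
        obtain ⟨b, rfl⟩ := ht
        refine ⟨e.symm (e a ⊓ e b), Set.ext fun Q => ⟨fun h => ?_, fun h => ⟨?_, ?_⟩⟩⟩
        · obtain ⟨c, hc, hca, hcb⟩ := Q.toPFilter.directed _ h.1 _ h.2
          exact Q.toPFilter.mem_of_le
            (e.le_symm_apply.2 (le_inf (e.monotone hca) (e.monotone hcb))) hc
        · exact Q.toPFilter.mem_of_le (e.symm_apply_le.2 inf_le_left) h
        · exact Q.toPFilter.mem_of_le (e.symm_apply_le.2 inf_le_right) h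
      | sUnion T _ hT =>
        choose f hf using hT
        have hlub : IsLUB {a | ∃ s hs, f s hs = a} (e.symm (sSup (e '' {a | ∃ s hs, f s hs = a}))) := by
          rw [← e.isLUB_image', e.apply_symm_apply]
          exact isLUB_sSup _
        refine ⟨e.symm (sSup (e '' {a | ∃ s hs, f s hs = a})), Set.ext fun Q => Iff.intro (fun h => ?_) (fun h => ?_)⟩
        · obtain ⟨s, hs, hQ⟩ := h
          rw [hf s hs] at hQ
          exact Q.toPFilter.mem_of_le (hlub.1 ⟨s, hs, rfl⟩) hQ
        · obtain ⟨_, ⟨s, hs, rfl⟩, h'⟩ := Q.completelyPrime _ _ hlub h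
          exact ⟨s, hs, by rw [hf s hs]; exact h'⟩
    intro U
    obtain ⟨a, ha⟩ := key U U.isOpen
    exact ⟨a, TopologicalSpace.Opens.ext ha.symm⟩
  exact ⟨RelIso.ofSurjective (OrderEmbedding.ofMapLEIff B hle) hsurj⟩

end Spatial

/-! ### Classification of the central idempotents of `D[C]`; stiffness -/

namespace Completion

variable {C : Type u} [Category.{v} C] [MonoidalCategory C] [IsStiff C]

theorem preservesCentralIdempotents_embedding :
    PreservesCentralIdempotents (embeddingFunctor (C := C)) :=
  preservesCentralIdempotents_of_iso _ inferInstance (fun _ _ => inferInstance) fun u => by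
    refine ⟨.ofBraid (P := ⟨⊤, u.obj⟩) (topHom u.counit) ?_ ?_
      (fun X => ofIso (X := tensor ⟨⊤, u.obj⟩ X) (Y := tensor X ⟨⊤, u.obj⟩) (inf_comm _ _)
        (u.σ.β X.A)) (fun X => ?_), Iso.refl _, (Category.id_comp _).trans (comp_inv_ε _).symm⟩
    · rw [whiskerLeft_ofHom, whiskerRight_ofHom, leftUnitor_hom, rightUnitor_hom]
      exact ofHom_comp_eq_comp _ _ _ _ u.isCentral.central
    · rw [whiskerLeft_ofHom, rightUnitor_hom]
      have := u.isCentral.isIso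
      rw [u.isCentral.central] at this
      have e : ofHom (inf_le_inf_left ⊤ (le_refl ⊤)) (u.obj ◁ u.counit) ≫
          (ofHom (inf_top_eq ⊤).le (ρ_ u.obj).hom : tensor ⟨⊤, u.obj⟩ (unitObj C) ⟶ ⟨⊤, u.obj⟩) =
          (ofIso (X := tensor ⟨⊤, u.obj⟩ ⟨⊤, u.obj⟩) (Y := ⟨⊤, u.obj⟩) (inf_idem _)
            (asIso (u.obj ◁ u.counit ≫ (ρ_ u.obj).hom))).hom :=
        ofHom_comp_ofHom _ _ _ _
      exact e ▸ Iso.isIso_hom _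
    · rw [whiskerLeft_ofHom, whiskerRight_ofHom, leftUnitor_hom, rightUnitor_hom]
      exact (congrArg _ (ofHom_comp_ofHom _ _ _ _)).trans
        (ofHom_comp_eq_comp (X := tensor ⟨⊤, u.obj⟩ X) (Y := tensor X ⟨⊤, u.obj⟩)
          (Y' := tensor (unitObj C) X) (Z := X) (inf_comm _ _).le inf_le_left
          (inf_le_inf_right _ le_top) inf_le_right
          (u.isCentral.braid X.A))

theorem map_embedding_counit (u : CentralIdempotent C) :
    (preservesCentralIdempotents_embedding.map u).counit = topHom u.counit := comp_inv_ε _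

/-- The image of `u` is the principal down-closed set below `u`. -/
theorem toZI_map_embedding (u : CentralIdempotent C) :
    toZI (preservesCentralIdempotents_embedding.map u) = toZI (idem (LowerSet.Iic (toZI u))) := by
  refine le_antisymm (toZI_le_toZI.2 ?_) (toZI_le_toZI.2 ?_)
  · rw [← restrictsTo_counit, map_embedding_counit]
    exact (restrictsTo_idem (topHom u.counit) _).2 fun w hw => ⟨u, mem_Iic_self u,
      (restrictsTo_counit.2 le_rfl).precomp (proj u.obj w)⟩
  · obtain ⟨e, he⟩ := exists_principalIso (𝟙_ C) u (L := LowerSet.Iic (toZI u)) (mem_Iic_self u)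
      fun w hw => toZI_le_toZI.1 hw
    refine ⟨.mk' (e.inv ≫ topHom (λ_ u.obj).hom) ?_⟩
    rw [map_embedding_counit, idem_counit]
    refine (Category.assoc _ _ _).trans ((Iso.inv_comp_eq _).2 (Eq.trans ?_ he.symm))
    have h : (λ_ u.obj).hom ≫ u.counit = proj (𝟙_ C) u := by simp [proj, ← unitors_equal]
    exact ofHom_comp_eq _ h

theorem ofHom_idem_counit {M N : LowerSet (ZI C)} (h : M ≤ N) :
    (ofHom h (𝟙 (𝟙_ C)) : (⟨M, 𝟙_ C⟩ : Completion C) ⟶ ⟨N, 𝟙_ C⟩) ≫ (idem N).counit =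
      (idem M).counit := by
  rw [idem_counit, idem_counit]
  exact ofHom_comp_eq (Z := unitObj C) le_top (Category.comp_id _)

/-- Morphisms between central idempotents are unique, so the morphisms `idem M ⟶ u` agree on
overlaps and glue over the union. -/
theorem idem_sSup_le (u : CentralIdempotent (Completion C)) (T : Set (LowerSet (ZI C)))
    (hT : ∀ M ∈ T, idem M ≤ u) : idem (sSup T) ≤ u := by
  -- The gluing runs over all `M` with `idem M ≤ u` instead of over `T`, because this family
  -- contains all binary intersections.
  let ι := {M : LowerSet (ZI C) // idem M ≤ u}
  have hM : ∀ i : ι, i.1 ≤ sSup {M | idem M ≤ u} := fun i => le_sSup i.2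
  have hL : ∀ a ∈ sSup {M : LowerSet (ZI C) | idem M ≤ u}, ∃ i : ι, a ∈ i.1 := fun a ha => by
    obtain ⟨M, hM, h⟩ := LowerSet.mem_sSup_iff.1 ha
    exact ⟨⟨M, hM⟩, h⟩
  have hu : ∀ (M N : LowerSet (ZI C)) (h : M ≤ N) (m : (idem M).Hom u) (n : (idem N).Hom u),
      m.f = (ofHom h (𝟙 (𝟙_ C)) : (⟨M, 𝟙_ C⟩ : Completion C) ⟶ ⟨N, 𝟙_ C⟩) ≫ n.f := by
    intro M N h m n
    refine congrArg CentralIdempotent.Hom.f (Subsingleton.elim m (.mk' _ ?_))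
    exact (Category.assoc _ _ _).trans ((congrArg _ n.w).trans (ofHom_idem_counit h))
  obtain ⟨g, hg⟩ := exists_glue (M := fun i : ι => i.1) hM hL (A := 𝟙_ C)
    (fun i => (leHom i.2).f) fun i k => by
      refine ⟨⟨i.1 ⊓ k.1, (idem_le_idem.2 inf_le_left).trans i.2⟩, le_rfl, inf_le_left, inf_le_right,
        hu _ _ _ _ _, hu _ _ _ _ _⟩
  have h : idem (sSup {M : LowerSet (ZI C) | idem M ≤ u}) ≤ u := by
    refine ⟨.mk' g ?_⟩
    refine glue_ext hM hL fun i => ?_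
    refine (Category.assoc _ _ _).symm.trans ((congrArg (· ≫ u.counit) (hg i)).trans ?_)
    exact (leHom i.2).w.trans (ofHom_idem_counit (hM i)).symm
  exact (idem_le_idem.2 (sSup_le_sSup hT)).trans h

/-- Every central idempotent of the completion comes from a down-closed set. -/
theorem exists_toZI_idem (u : CentralIdempotent (Completion C)) :
    ∃ L : LowerSet (ZI C), toZI (idem L) = toZI u := by
  refine ⟨sSup {M | idem M ≤ u}, le_antisymm (toZI_le_toZI.2 (idem_sSup_le u _ fun M hM => hM))
    (toZI_le_toZI.2 ?_)⟩
  rw [← restrictsTo_counit, restrictsTo_idem]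
  intro a ha
  -- The component at `a` is, up to isomorphism, a central idempotent `v` of `C` whose image lies
  -- below `u`. So `↓v` is one of the sets in the union, and the component restricts to `v`.
  obtain ⟨v, e, he, f, hf⟩ := exists_central_app u a ha
  refine ⟨v, LowerSet.mem_sSup_iff.2 ⟨LowerSet.Iic (toZI v), ?_, mem_Iic_self v⟩, ?_⟩
  · refine (toZI_le_toZI.1 (toZI_map_embedding v).ge).trans ⟨.mk' f ?_⟩
    exact hf.trans (map_embedding_counit v).symm
  · rw [← he]
    exact (restrictsTo_counit.2 le_rfl).precomp _

variable (C) in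
/-- The central idempotents of the completion are the down-closed sets. -/
noncomputable def lowerSetIso : LowerSet (ZI C) ≃o ZI (Completion C) :=
  RelIso.ofSurjective (OrderEmbedding.ofMapLEIff (fun L => toZI (idem L))
    fun _ _ => toZI_le_toZI.trans idem_le_idem) fun a => by
      obtain ⟨u, rfl⟩ := exists_toZI_eq a
      exact exists_toZI_idem u

instance mono_proj_idem (X : Completion C) (L : LowerSet (ZI C)) : Mono (proj X (idem L)) := by
  rw [proj_idem]
  exact mono_comp _ _

variable (C) in
-- After replacing `u` and `v` by `idem L` and `idem M`, restriction is a condition on components,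
-- and two restrictions of a component have a common refinement in `L ∩ M` because `C` is stiff.
theorem isStiff_completion : IsStiff (Completion C) := by
  refine isStiff_of_mono (fun X u => ?_) fun {Z X} f u v hu hv => ?_
  · obtain ⟨L, hL⟩ := exists_toZI_idem u
    exact mono_proj_of_toZI_eq X hL.symm
  · obtain ⟨L, hL⟩ := exists_toZI_idem u
    obtain ⟨M, hM⟩ := exists_toZI_idem v
    have h1 := (restrictsTo_idem f L).1 (hu.mono (toZI_le_toZI.1 hL.ge))
    have h2 := (restrictsTo_idem f M).1 (hv.mono (toZI_le_toZI.1 hM.ge))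
    refine ((restrictsTo_idem f (L ⊓ M)).2 fun w hw => ?_).mono (CentralIdempotent.le_inf
      ((idem_le_idem.2 inf_le_left).trans (toZI_le_toZI.1 hL.le))
      ((idem_le_idem.2 inf_le_right).trans (toZI_le_toZI.1 hM.le)))
    obtain ⟨a, ha, ha'⟩ := h1 w hw
    obtain ⟨b, hb, hb'⟩ := h2 w hw
    obtain ⟨c, hca, hcb, hc⟩ := ha'.exists_inf hb'
    exact ⟨c, ⟨L.lower (toZI_le_toZI.2 hca) ha, M.lower (toZI_le_toZI.2 hcb) hb⟩, hc⟩

end Completion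
-- Universal joins in `D[C]`
namespace Completion

variable {C : Type u} [Category.{v} C] [MonoidalCategory C] [IsStiff C]

/-- The inclusion `⟨D, A⟩ ⟶ ⟨E, A⟩` for `D ⊆ E`. -/
abbrev incl {L M : LowerSet (ZI C)} (h : L ≤ M) (A : C) :
    (⟨L, A⟩ : Completion C) ⟶ ⟨M, A⟩ := ofHom h (𝟙 A)

theorem incl_comp_incl {L M N : LowerSet (ZI C)} (h : L ≤ M) (h' : M ≤ N) (A : C) :
    incl h A ≫ incl h' A = incl (h.trans h') A := ofHom_comp_eq _ (Category.comp_id _)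

theorem exists_tensorIso (X : Completion C) (u : CentralIdempotent (Completion C))
    {L : LowerSet (ZI C)} (hL : toZI (idem L) = toZI u) :
    ∃ e : X ⊗ u.obj ≅ ⟨X.D ⊓ L, X.A⟩, e.hom ≫ incl inf_le_left X.A = proj X u := by
  obtain ⟨m, hm⟩ := toZI_eq_iff.1 hL.symm
  refine ⟨whiskerLeftIso X (asIso m.f) ≪≫ tensorIdemIso X L, ?_⟩
  rw [← whiskerLeft_hom_proj X m, proj_idem, Iso.trans_hom, Category.assoc]
  rfl

theorem le_of_toZI_idem_le {L M : LowerSet (ZI C)} (h : toZI (idem L) ≤ toZI (idem M)) : L ≤ M :=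
  idem_le_idem.1 (toZI_le_toZI.1 h)

/-- A join corresponds to the union of the down-closed sets, so it contains no further elements. -/
theorem exists_mem_of_isLUB {S : Set (CentralIdempotent (Completion C))}
    {j : CentralIdempotent (Completion C)} (hj : IsLUB (toZI '' S) (toZI j))
    {Lo : CentralIdempotent (Completion C) → LowerSet (ZI C)}
    (hLo : ∀ u, toZI (idem (Lo u)) = toZI u) (a : ZI C) (ha : a ∈ Lo j) : ∃ u ∈ S, a ∈ Lo u := by
  have h : j ≤ idem (sSup (Lo '' S)) := by
    refine toZI_le_toZI.1 (hj.2 ?_)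
    rintro _ ⟨u, hu, rfl⟩
    rw [← hLo u]
    exact toZI_le_toZI.2 (idem_le_idem.2 (le_sSup ⟨u, hu, rfl⟩))
  have h' : Lo j ≤ sSup (Lo '' S) :=
    idem_le_idem.1 ((toZI_le_toZI.1 (hLo j).le).trans h)
  obtain ⟨_, ⟨u, hu, rfl⟩, hau⟩ := LowerSet.mem_sSup_iff.1 (h' ha)
  exact ⟨u, hu, hau⟩

variable (C) in
-- The isomorphisms `φ` turn the diagram of the `X ⊗ u` into the inclusions among the `⟨X.D ∩ Lo u,
-- X.A⟩`. These cover `⟨X.D ∩ Lo j, X.A⟩`, and the colimit property becomes the gluing of morphisms.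
theorem hasUniversalJoins_completion : HasUniversalJoins (Completion C) where
  exists_isLUB S := by
    refine ⟨lowerSetIso C (sSup (lowerSetIso C ⁻¹' S)), ?_⟩
    have h := (lowerSetIso C).isLUB_image'.2 (isLUB_sSup (lowerSetIso C ⁻¹' S))
    rwa [Set.image_preimage_eq _ (lowerSetIso C).surjective] at h
  isColimit S hS j hj X := by
    have hst := isStiff_completion C
    choose Lo hLo using fun u : CentralIdempotent (Completion C) => exists_toZI_idem u
    choose φ hφ using fun u => exists_tensorIso X u (hLo u)
    have mono : ∀ u v, u ≤ v → Lo u ≤ Lo v := fun u v h => le_of_toZI_idem_le (by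
      rw [hLo, hLo]; exact toZI_le_toZI.2 h)
    have hφ' : ∀ u v (m : u.Hom v), (φ u).inv ≫ X ◁ m.f =
        incl (inf_le_inf_left X.D (mono u v ⟨m⟩)) X.A ≫ (φ v).inv := fun u v m => by
      rw [← cancel_mono (proj X v), Category.assoc, whiskerLeft_hom_proj, ← hφ u, ← hφ v,
        Iso.inv_hom_id_assoc, Category.assoc, Iso.inv_hom_id_assoc, incl_comp_incl]
    have hM : ∀ i : S, X.D ⊓ Lo i.1 ≤ X.D ⊓ Lo j := fun i =>
      inf_le_inf_left _ (mono _ _ (le_of_isLUB hj i.1 i.2))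
    have hL : ∀ a ∈ X.D ⊓ Lo j, ∃ i : S, a ∈ X.D ⊓ Lo i.1 := fun a ha => by
      obtain ⟨u, hu, h⟩ := exists_mem_of_isLUB hj hLo a (mem_right ha)
      exact ⟨⟨u, hu⟩, mem_left ha, h⟩
    refine isColimit_joinCocone X _ fun Y f hf => ?_
    obtain ⟨g, hg⟩ := exists_glue (M := fun i : S => X.D ⊓ Lo i.1) hM hL (A := X.A)
      (fun i => (φ i.1).inv ≫ f i.1 i.2) fun i k => by
        obtain ⟨w, hw, hglb⟩ := hS i.1 i.2 k.1 k.2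
        have h1 : w ≤ i.1 := toZI_le_toZI.1 (hglb.1 (Or.inl rfl))
        have h2 : w ≤ k.1 := toZI_le_toZI.1 (hglb.1 (Or.inr rfl))
        have h3 : ∀ (v : S) (h : w ≤ v.1), (φ w).inv ≫ f w hw =
            incl (inf_le_inf_left X.D (mono w v.1 h)) X.A ≫ (φ v.1).inv ≫ f v.1 v.2 := fun v h => by
          rw [hf w v.1 hw v.2 (leHom h), reassoc_of% (hφ' w v.1 (leHom h))]
        refine ⟨⟨w, hw⟩, ?_, inf_le_inf_left X.D (mono _ _ h1), inf_le_inf_left X.D (mono _ _ h2),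
          h3 i h1, h3 k h2⟩
        -- The greatest lower bound `w` dominates `idem` of the intersection, so the overlap of two
        -- pieces lies in the piece of `w`, as gluing requires.
        have h4 : Lo i.1 ⊓ Lo k.1 ≤ Lo w := by
          refine le_of_toZI_idem_le ?_
          rw [hLo w]
          refine hglb.2 ?_
          rintro _ (rfl | rfl)
          · rw [← hLo i.1]
            exact toZI_le_toZI.2 (idem_le_idem.2 inf_le_left)
          · rw [← hLo k.1]
            exact toZI_le_toZI.2 (idem_le_idem.2 inf_le_right)
        exact fun a ha => ⟨mem_left (mem_left ha), h4 ⟨mem_right (mem_left ha), mem_right (mem_right ha)⟩⟩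
    refine ⟨(φ j).hom ≫ g, fun u hu m => ?_, fun d hd => ?_⟩
    · rw [← cancel_epi (φ u).inv, reassoc_of% (hφ' u j m), Iso.inv_hom_id_assoc]
      exact hg ⟨u, hu⟩
    · rw [← Iso.inv_comp_eq]
      refine glue_ext hM hL fun i => ?_
      rw [hg i, ← hd i.1 i.2 (leHom (le_of_isLUB hj i.1 i.2)), reassoc_of% (hφ' i.1 j _)]

end Completion

theorem inMonCatJ_completion (C : Type u) [SmallCategory C] [MonoidalCategory C] [IsStiff C] :
    InMonCatJ (Completion C) :=
  ⟨Completion.isStiff_completion C, Completion.hasUniversalJoins_completion C,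
    isSpatial_of_orderIso (Completion.lowerSetIso C).symm⟩

/-! ### Joins in `D` of images of down-closed sets -/

section Extension

universe v₁ v₂ u₁ u₂

open Functor.LaxMonoidal

variable {C : Type u₁} [Category.{v₁} C] [MonoidalCategory C]
  {D : Type u₂} [Category.{v₂} D] [MonoidalCategory D] {F : C ⥤ D} [F.LaxMonoidal]

namespace PreservesCentralIdempotents

/-- The images of the elements of a down-closed set. -/
def image (hF : PreservesCentralIdempotents F) (L : LowerSet (ZI C)) :
    Set (CentralIdempotent D) := hF.map '' {u | toZI u ∈ L}

theorem infClosed_image_lowerSet (hF : PreservesCentralIdempotents F) (L : LowerSet (ZI C)) :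
    InfClosed (hF.image L) :=
  hF.infClosed_image fun u hu v _ => L.lower (toZI_le_toZI.2 (u.inf_le_left v)) hu

theorem map_hom_f (hF : PreservesCentralIdempotents F) {u v : CentralIdempotent C} (m : u.Hom v)
    (n : (hF.map u).Hom (hF.map v)) : n.f = F.map m.f := by
  have := hF.isIso_ε
  exact congrArg CentralIdempotent.Hom.f (Subsingleton.elim n (.mk' (F.map m.f)
    (by simp [PreservesCentralIdempotents.map, ← F.map_comp_assoc, m.w])))

theorem μ_map_hom (hF : PreservesCentralIdempotents F) (A : C) {u v : CentralIdempotent C}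
    (m : u.Hom v) (n : (hF.map u).Hom (hF.map v)) :
    F.obj A ◁ n.f ≫ (hF.μIso A v).hom = (hF.μIso A u).hom ≫ F.map (A ◁ m.f) := by
  rw [hF.map_hom_f m n]
  exact μ_natural_right F A m.f

section Join

variable (hF : PreservesCentralIdempotents F) (hD : HasUniversalJoins D)

theorem exists_join (L : LowerSet (ZI C)) (hD : HasUniversalJoins D) :
    ∃ j : CentralIdempotent D, IsLUB (toZI '' hF.image L) (toZI j) := by
  obtain ⟨a, ha⟩ := hD.exists_isLUB (toZI '' hF.image L)
  obtain ⟨j, rfl⟩ := exists_toZI_eq a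
  exact ⟨j, ha⟩

/-- The join of the images of the elements of a down-closed set. -/
noncomputable def join (L : LowerSet (ZI C)) : CentralIdempotent D := (hF.exists_join L hD).choose

theorem isLUB_join (L : LowerSet (ZI C)) : IsLUB (toZI '' hF.image L) (toZI (hF.join hD L)) :=
  (hF.exists_join L hD).choose_spec

theorem map_le_join {L : LowerSet (ZI C)} {u : CentralIdempotent C} (hu : toZI u ∈ L) :
    hF.map u ≤ hF.join hD L :=
  le_of_isLUB (hF.isLUB_join hD L) _ ⟨u, hu, rfl⟩

theorem join_le {L : LowerSet (ZI C)} {t : CentralIdempotent D}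
    (ht : ∀ u : CentralIdempotent C, toZI u ∈ L → hF.map u ≤ t) : hF.join hD L ≤ t := by
  refine toZI_le_toZI.1 ((hF.isLUB_join hD L).2 ?_)
  rintro _ ⟨_, ⟨u, hu, rfl⟩, rfl⟩
  exact toZI_le_toZI.2 (ht u hu)

theorem join_mono {L M : LowerSet (ZI C)} (h : L ≤ M) : hF.join hD L ≤ hF.join hD M :=
  hF.join_le hD fun _ hu => hF.map_le_join hD (h hu)

/-- By distributivity in `D` it suffices to bound the meets `F u ∧ F v`. Such a meet is `F (u ∧ v)`,
and `u ∧ v` lies in `L ∩ M`. -/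
theorem join_inf [IsStiff D] (L M : LowerSet (ZI C)) :
    (hF.join hD L).inf (hF.join hD M) ≤ hF.join hD (L ⊓ M) := by
  refine hD.inf_le (hF.infClosed_image_lowerSet L) (hF.infClosed_image_lowerSet M)
    (hF.isLUB_join hD L) (hF.isLUB_join hD M) ?_
  rintro _ ⟨u, hu, rfl⟩ _ ⟨v, hv, rfl⟩
  refine (toZI_le_toZI.1 (hF.toZI_map_inf u v).ge).trans (hF.map_le_join hD ⟨?_, ?_⟩)
  · exact L.lower (toZI_le_toZI.2 (u.inf_le_left v)) hu
  · exact M.lower (toZI_le_toZI.2 (u.inf_le_right v)) hv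

theorem isIso_proj_map_unit (A : C) : IsIso (proj (F.obj A) (hF.map (.unit C))) := by
  have h1 := hF.isIso_μ A (.unit C)
  have h2 : IsIso (proj A (.unit C)) := inferInstanceAs (IsIso (A ◁ 𝟙 _ ≫ (ρ_ A).hom))
  rw [← hF.μ_map_proj]
  exact IsIso.comp_isIso' h1 inferInstance

/-- The tensor unit belongs to `⊤`, and its image is already absorbed by `F A`. Hence the extension
at `⟨⊤, A⟩` is `F A` up to isomorphism. -/
instance isIso_proj_join_top [IsStiff D] (A : C) :
    IsIso (proj (F.obj A) (hF.join hD ⊤)) := by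
  have := hF.isIso_proj_map_unit A
  exact isIso_proj_of_le (hF.map_le_join hD (u := .unit C) trivial)

theorem join_hom_ext {L : LowerSet (ZI C)} {A Y : D} {f g : A ⊗ (hF.join hD L).obj ⟶ Y}
    (h : ∀ u : CentralIdempotent C, toZI u ∈ L → ∀ m : (hF.map u).Hom (hF.join hD L),
      A ◁ m.f ≫ f = A ◁ m.f ≫ g) : f = g := by
  refine hD.hom_ext (hF.infClosed_image_lowerSet L) (hF.isLUB_join hD L) ?_
  rintro _ ⟨u, hu, rfl⟩ m
  exact h u hu m

theorem join_proj_ext {L : LowerSet (ZI C)} {Z Y : D} [IsIso (proj Z (hF.join hD L))]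
    {f g : Z ⟶ Y} (h : ∀ u : CentralIdempotent C, toZI u ∈ L →
      proj Z (hF.map u) ≫ f = proj Z (hF.map u) ≫ g) : f = g := by
  refine hD.proj_ext (hF.infClosed_image_lowerSet L) (hF.isLUB_join hD L) ?_
  rintro _ ⟨u, hu, rfl⟩
  exact h u hu

/-- Compatibility is demanded only along inequalities of `C`, although `F u ≤ F v` may hold in `D`
without `u ≤ v`. In that case `F (u ∧ v) ⟶ F u` is invertible, and compatibility along `u ∧ v ≤ u`
and `u ∧ v ≤ v` suffices. -/
theorem exists_join_desc {L : LowerSet (ZI C)} {A Y : D}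
    (k : ∀ u : CentralIdempotent C, toZI u ∈ L → (A ⊗ (hF.map u).obj ⟶ Y))
    (hk : ∀ (u v : CentralIdempotent C) (hu : toZI u ∈ L) (hv : toZI v ∈ L), u ≤ v →
      ∀ (m : (hF.map u).Hom (hF.map v)), k u hu = A ◁ m.f ≫ k v hv) :
    ∃ f : A ⊗ (hF.join hD L).obj ⟶ Y, ∀ (u : CentralIdempotent C) (hu : toZI u ∈ L)
      (m : (hF.map u).Hom (hF.join hD L)), A ◁ m.f ≫ f = k u hu := by
  have hk' : ∀ (u v : CentralIdempotent C) (hu : toZI u ∈ L) (hv : toZI v ∈ L)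
      (m : (hF.map u).Hom (hF.map v)), k u hu = A ◁ m.f ≫ k v hv := fun u v hu hv m => by
    have hw : toZI (u.inf v) ∈ L := L.lower (toZI_le_toZI.2 (u.inf_le_left v)) hu
    obtain ⟨n⟩ := hF.mono (u.inf_le_left v)
    have : IsIso n.f := isIso_hom_of_ge n ((CentralIdempotent.le_inf le_rfl ⟨m⟩).trans
      (toZI_le_toZI.1 (hF.toZI_map_inf u v).ge))
    rw [← cancel_epi (A ◁ n.f), ← hk _ _ hw hu (u.inf_le_left v) n,
      hk _ _ hw hv (u.inf_le_right v) (n.comp m)]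
    simp [CentralIdempotent.Hom.comp]
  have hle : ∀ u' (hu' : u' ∈ hF.image L), u' ≤ hF.map hu'.choose :=
    fun u' hu' => le_of_eq hu'.choose_spec.2.symm
  -- The universal join is indexed by elements of the image, so a preimage is chosen for each; `hk'`
  -- makes the choice immaterial.
  obtain ⟨f, hf⟩ := hD.exists_desc (hF.infClosed_image_lowerSet L) (hF.isLUB_join hD L)
    (A := A) (Y := Y) (fun u' hu' => A ◁ (leHom (hle u' hu')).f ≫
      k hu'.choose hu'.choose_spec.1) fun u' v' hu' hv' m => by
    have hn : hF.map hu'.choose ≤ hF.map hv'.choose :=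
      (le_of_eq hu'.choose_spec.2).trans (le_trans ⟨m⟩ (hle v' hv'))
    obtain ⟨n⟩ := hn
    rw [hk' _ _ hu'.choose_spec.1 hv'.choose_spec.1 n, ← MonoidalCategory.whiskerLeft_comp_assoc,
      ← MonoidalCategory.whiskerLeft_comp_assoc]
    exact congrArg (fun t => A ◁ t ≫ _) (congrArg CentralIdempotent.Hom.f
      (Subsingleton.elim ((leHom (hle u' hu')).comp n) (m.comp (leHom (hle v' hv')))))
  refine ⟨f, fun u hu m => ?_⟩
  have hu' : hF.map u ∈ hF.image L := ⟨u, hu, rfl⟩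
  rw [hf _ hu' m]
  exact (hk' _ _ hu hu'.choose_spec.1 _).symm

end Join
end PreservesCentralIdempotents
end Extension
-- The extension of `F` as a functor
section Extension

universe v₁ v₂ u₁ u₂

open Functor.LaxMonoidal

variable {C : Type u₁} [Category.{v₁} C] [MonoidalCategory C] [IsStiff C]
  {D : Type u₂} [Category.{v₂} D] [MonoidalCategory D] [IsStiff D] {F : C ⥤ D} [F.LaxMonoidal]

namespace PreservesCentralIdempotents

variable (hF : PreservesCentralIdempotents F) (hD : HasUniversalJoins D)

/-- The value of the extension of `F` at `⟨L, A⟩`: the join of the `F A ⊗ F U`, `u ∈ L`. -/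
noncomputable abbrev extObj (X : Completion C) : D := F.obj X.A ⊗ (hF.join hD X.D).obj

/-- The monomorphism from the extension of `F` at `⟨L, A⟩` to `F A`. -/
noncomputable abbrev extProj (X : Completion C) : hF.extObj hD X ⟶ F.obj X.A :=
  proj (F.obj X.A) (hF.join hD X.D)

omit [IsStiff C] in
theorem proj_extObj (X : Completion C) (u : CentralIdempotent C)
    (m : (hF.map u).Hom (hF.join hD X.D)) :
    proj (hF.extObj hD X) (hF.map u) =
      hF.extProj hD X ▷ (hF.map u).obj ≫ F.obj X.A ◁ m.f := by
  rw [← cancel_mono (hF.extProj hD X), Category.assoc, whiskerLeft_hom_proj, proj_naturality]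

/-- The images of the components glue to a morphism into `F Y.A`. On the piece of `u` it restricts
to some `F v` with `v ∈ Y.D`, hence to the join over `Y.D`; locality of restriction then lifts the
whole morphism. -/
theorem exists_extMap {X Y : Completion C} (η : X ⟶ Y) :
    ∃ f : hF.extObj hD X ⟶ hF.extObj hD Y, ∀ (u : CentralIdempotent C) (hu : toZI u ∈ X.D)
      (m : (hF.map u).Hom (hF.join hD X.D)),
      F.obj X.A ◁ m.f ≫ f ≫ hF.extProj hD Y = (hF.μIso X.A u).hom ≫ F.map (Completion.Hom.app η u hu) := by
  obtain ⟨f, hf⟩ := hF.exists_join_desc hD (L := X.D) (A := F.obj X.A) (Y := F.obj Y.A)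
    (fun u hu => (hF.μIso X.A u).hom ≫ F.map (Completion.Hom.app η u hu)) fun u v hu hv huv m => by
      obtain ⟨n⟩ := huv
      rw [reassoc_of% (hF.μ_map_hom X.A n m), ← F.map_comp, Completion.Hom.compat η u v n hu hv]
  have h : RestrictsTo f (hF.join hD Y.D) := by
    refine hD.restrictsTo (hF.infClosed_image_lowerSet X.D) (hF.isLUB_join hD X.D) ?_
    rintro _ ⟨u, hu, rfl⟩
    obtain ⟨m⟩ := hF.map_le_join hD hu
    rw [hF.proj_extObj hD X u m, Category.assoc, hf u hu m]
    obtain ⟨v, hv, g, hg⟩ := Completion.Hom.restricts η u hu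
    refine ((RestrictsTo.mono ?_ (hF.map_le_join hD hv)).precomp _).precomp _
    refine ⟨F.map g ≫ (hF.μIso Y.A v).inv, ?_⟩
    rw [← hF.μIso_map_proj, Category.assoc, Iso.inv_hom_id_assoc, ← F.map_comp, hg]
  obtain ⟨g, hg⟩ := h
  exact ⟨g, fun u hu m => by rw [hg, hf u hu m]⟩

/-- The extension of `F` on morphisms. -/
noncomputable def extMap {X Y : Completion C} (η : X ⟶ Y) : hF.extObj hD X ⟶ hF.extObj hD Y :=
  (hF.exists_extMap hD η).choose

theorem extMap_spec {X Y : Completion C} (η : X ⟶ Y) (u : CentralIdempotent C)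
    (hu : toZI u ∈ X.D) (m : (hF.map u).Hom (hF.join hD X.D)) :
    F.obj X.A ◁ m.f ≫ hF.extMap hD η ≫ hF.extProj hD Y =
      (hF.μIso X.A u).hom ≫ F.map (Completion.Hom.app η u hu) :=
  (hF.exists_extMap hD η).choose_spec u hu m

theorem extMap_unique {X Y : Completion C} (η : X ⟶ Y) {f : hF.extObj hD X ⟶ hF.extObj hD Y}
    (hf : ∀ (u : CentralIdempotent C) (hu : toZI u ∈ X.D)
      (m : (hF.map u).Hom (hF.join hD X.D)),
      F.obj X.A ◁ m.f ≫ f ≫ hF.extProj hD Y = (hF.μIso X.A u).hom ≫ F.map (Completion.Hom.app η u hu)) :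
    hF.extMap hD η = f := by
  rw [← cancel_mono (hF.extProj hD Y)]
  refine hF.join_hom_ext hD fun u hu m => ?_
  rw [hf u hu m, hF.extMap_spec hD η u hu m]

theorem extMap_ofHom {X Y : Completion C} (h : X.D ≤ Y.D) (f : X.A ⟶ Y.A) :
    hF.extMap hD (Completion.ofHom h f : X ⟶ Y) ≫ hF.extProj hD Y =
      hF.extProj hD X ≫ F.map f := by
  refine hF.join_hom_ext hD fun u hu m => ?_
  rw [hF.extMap_spec hD _ u hu m, whiskerLeft_hom_proj_assoc, Completion.ofHom_app, F.map_comp,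
    reassoc_of% (hF.μIso_map_proj X.A u)]

/-- This describes the extended morphism on a piece before projection, through any factorisation of
`η_u`. Composition in `D[C]` is defined by such factorisations, so functoriality rests on it. -/
theorem extMap_comp_lift {X Y : Completion C} (η : X ⟶ Y) (u : CentralIdempotent C)
    (hu : toZI u ∈ X.D) (m : (hF.map u).Hom (hF.join hD X.D)) (v : CentralIdempotent C)
    (g : X.A ⊗ u.obj ⟶ Y.A ⊗ v.obj) (hg : g ≫ proj Y.A v = Completion.Hom.app η u hu)
    (n : (hF.map v).Hom (hF.join hD Y.D)) :
    F.obj X.A ◁ m.f ≫ hF.extMap hD η =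
      (hF.μIso X.A u).hom ≫ F.map g ≫ (hF.μIso Y.A v).inv ≫ F.obj Y.A ◁ n.f := by
  rw [← cancel_mono (hF.extProj hD Y), Category.assoc, hF.extMap_spec hD η u hu m]
  simp only [Category.assoc]
  rw [whiskerLeft_hom_proj, ← hF.μIso_map_proj, Iso.inv_hom_id_assoc, ← F.map_comp, hg]

/-- The extension of `F` to the completion. -/
noncomputable def extension : Completion C ⥤ D where
  obj := hF.extObj hD
  map η := hF.extMap hD η
  map_id X := hF.extMap_unique hD _ fun u hu m => by
    rw [Category.id_comp, whiskerLeft_hom_proj, Completion.id_eq_ofHom, Completion.ofHom_app,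
      Category.comp_id, hF.μIso_map_proj]
  map_comp {X Y Z} η ζ := hF.extMap_unique hD _ fun u hu m => by
    have hv := Completion.Hom.idx_mem η u hu
    obtain ⟨n⟩ := hF.map_le_join hD hv
    have h1 := hF.extMap_comp_lift hD η u hu m _ _ (Completion.Hom.fac_proj η u hu) n
    rw [Category.assoc, reassoc_of% h1, hF.extMap_spec hD ζ _ hv n, Iso.inv_hom_id_assoc,
      ← F.map_comp]
    exact congrArg _ (congrArg F.map (Completion.Hom.comp_app η ζ hu hv _ (Completion.Hom.fac_proj η u hu)).symm)

end PreservesCentralIdempotents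
end Extension
-- The lax monoidal structure of the extension
section Extension

universe v₁ v₂ u₁ u₂

open Functor.LaxMonoidal

variable {C : Type u₁} [Category.{v₁} C] [MonoidalCategory C] [IsStiff C]
  {D : Type u₂} [Category.{v₂} D] [MonoidalCategory D] [IsStiff D] {F : C ⥤ D} [F.LaxMonoidal]

namespace PreservesCentralIdempotents

variable (hF : PreservesCentralIdempotents F) (hD : HasUniversalJoins D)

include hF in
omit [IsStiff C] in
theorem mono_map_proj (A : C) (u : CentralIdempotent C) : Mono (F.map (proj A u)) := by
  have h : F.map (proj A u) = (hF.μIso A u).inv ≫ proj (F.obj A) (hF.map u) := by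
    rw [← hF.μIso_map_proj, Iso.inv_hom_id_assoc]
  rw [h]
  infer_instance

omit [IsStiff C] in
-- Both sides are compared after the monomorphism `F (proj A u ▷ B)`, which removes the
-- half-braidings and leaves naturality of `μ`. Right whiskering in `D[C]` involves `swap`, hence
-- the need for this identity.
theorem μ_map_swap (A B : C) (u : CentralIdempotent C) :
    μ F A B ▷ (hF.map u).obj ≫ (hF.μIso (A ⊗ B) u).hom ≫ F.map (swap A B u).hom =
      (swap (F.obj A) (F.obj B) (hF.map u)).hom ≫ (hF.μIso A u).hom ▷ F.obj B ≫
        μ F (A ⊗ u.obj) B := by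
  have h : F.map (proj A u ▷ B) = F.map (swap A B u).inv ≫ F.map (proj (A ⊗ B) u) := by
    rw [← F.map_comp, swap_inv_proj]
  have : Mono (F.map (proj A u ▷ B)) := by
    have := hF.mono_map_proj (A ⊗ B) u
    rw [h]
    infer_instance
  rw [← cancel_mono (F.map (proj A u ▷ B))]
  simp only [Category.assoc]
  rw [← F.map_comp, swap_proj, hF.μIso_map_proj, proj_naturality, ← μ_natural_left,
    ← comp_whiskerRight_assoc, hF.μIso_map_proj, swap_proj_assoc]

/-- The unit of the extension of `F`. -/
noncomputable def extε : 𝟙_ D ⟶ hF.extObj hD (Completion.unitObj C) :=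
  ε F ≫ inv (hF.extProj hD (Completion.unitObj C))

omit [IsStiff C] in
theorem extε_proj : hF.extε hD ≫ hF.extProj hD (Completion.unitObj C) = ε F := by
  simp [extε]

omit [IsStiff C] in
-- The tensor product of the two projections restricts to the join over `X.D` and to the join over
-- `Y.D`. It therefore restricts to their meet, which lies below the join over the intersection by
-- `join_inf`.
theorem exists_extμ (X Y : Completion C) :
    ∃ f : hF.extObj hD X ⊗ hF.extObj hD Y ⟶ hF.extObj hD (X.tensor Y),
      f ≫ hF.extProj hD (X.tensor Y) = (hF.extProj hD X ⊗ₘ hF.extProj hD Y) ≫ μ F X.A Y.A := by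
  refine RestrictsTo.postcomp (RestrictsTo.mono (RestrictsTo.inf ?_ ?_)
    (hF.join_inf hD X.D Y.D)) _
  · rw [MonoidalCategory.tensorHom_def]
    exact ((restrictsTo_proj _ _).whiskerRight _).postcomp _
  · rw [MonoidalCategory.tensorHom_def']
    exact ((restrictsTo_proj _ _).whiskerLeft _).postcomp _

/-- The tensorator of the extension of `F`. -/
noncomputable def extμ (X Y : Completion C) :
    hF.extObj hD X ⊗ hF.extObj hD Y ⟶ hF.extObj hD (X.tensor Y) := (hF.exists_extμ hD X Y).choose

omit [IsStiff C] in
theorem extμ_proj (X Y : Completion C) :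
    hF.extμ hD X Y ≫ hF.extProj hD (X.tensor Y) =
      (hF.extProj hD X ⊗ₘ hF.extProj hD Y) ≫ μ F X.A Y.A := (hF.exists_extμ hD X Y).choose_spec

theorem proj_extMap {X Y : Completion C} (η : X ⟶ Y) (u : CentralIdempotent C)
    (hu : toZI u ∈ X.D) : proj (hF.extObj hD X) (hF.map u) ≫ hF.extMap hD η ≫ hF.extProj hD Y =
      hF.extProj hD X ▷ (hF.map u).obj ≫ (hF.μIso X.A u).hom ≫
        F.map (Completion.Hom.app η u hu) := by
  obtain ⟨m⟩ := hF.map_le_join hD hu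
  rw [hF.proj_extObj hD X u m, Category.assoc, hF.extMap_spec hD η u hu m]

/-- Since the domain of the tensorator absorbs the join over `X.D ∩ Y.D`, equations out of it may be
tested on the pieces `F w` with `w` in the intersection. -/
instance isIso_proj_tensor_join (X Y : Completion C) :
    IsIso (proj (hF.extObj hD X ⊗ hF.extObj hD Y) (hF.join hD (X.D ⊓ Y.D))) := by
  have h1 := isIso_proj_tensor_right (hF.extObj hD Y) (hF.extObj hD X) (hF.join hD X.D)
  have h2 := isIso_proj_tensor_left (hF.extObj hD X) (hF.extObj hD Y) (hF.join hD Y.D)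
  have h3 := isIso_proj_tensor_right (hF.join hD X.D).obj (hF.extObj hD X ⊗ hF.extObj hD Y)
    (hF.join hD Y.D)
  have h4 : IsIso (proj (hF.extObj hD X ⊗ hF.extObj hD Y)
      ((hF.join hD X.D).inf (hF.join hD Y.D))) := by
    rw [← inv_tensor_proj_inf]
    exact IsIso.comp_isIso' (Iso.isIso_inv _) (IsIso.comp_isIso' h3 inferInstance)
  exact isIso_proj_of_le (hF.join_inf hD X.D Y.D)

theorem proj_extμ_extMap {X Y Z : Completion C} (η : X.tensor Y ⟶ Z) (w : CentralIdempotent C)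
    (hw : toZI w ∈ X.D ⊓ Y.D) :
    proj (hF.extObj hD X ⊗ hF.extObj hD Y) (hF.map w) ≫ hF.extμ hD X Y ≫ hF.extMap hD η ≫
      hF.extProj hD Z = (hF.extProj hD X ⊗ₘ hF.extProj hD Y) ▷ (hF.map w).obj ≫
        μ F X.A Y.A ▷ (hF.map w).obj ≫ (hF.μIso (X.A ⊗ Y.A) w).hom ≫
          F.map (Completion.Hom.app η w hw) := by
  rw [← proj_naturality_assoc, hF.proj_extMap hD η w hw, ← comp_whiskerRight_assoc, hF.extμ_proj,
    comp_whiskerRight_assoc]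

theorem extμ_natural_left {X Y : Completion C} (η : X ⟶ Y) (Z : Completion C) :
    hF.extMap hD η ▷ hF.extObj hD Z ≫ hF.extμ hD Y Z =
      hF.extμ hD X Z ≫ hF.extMap hD (Completion.whiskerR η Z) := by
  rw [← cancel_mono (hF.extProj hD (Y.tensor Z))]
  refine hF.join_proj_ext hD (L := X.D ⊓ Z.D) fun w hw => ?_
  simp only [Category.assoc]
  rw [hF.proj_extμ_extMap hD _ w hw, hF.extμ_proj, Completion.whiskerR_app, F.map_comp,
    reassoc_of% (hF.μ_map_swap X.A Z.A w), ← μ_natural_left, ← swap_proj_assoc,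
    MonoidalCategory.tensorHom_def, MonoidalCategory.tensorHom_def]
  simp only [Category.assoc]
  rw [← comp_whiskerRight_assoc, ← comp_whiskerRight_assoc, Category.assoc,
    hF.proj_extMap hD η w (Completion.mem_left hw)]
  simp only [comp_whiskerRight, Category.assoc]
  rw [swap_naturality_right_assoc, reassoc_of% (swap_naturality_left (hF.extProj hD X))]
  simp only [← whisker_exchange_assoc]

theorem extμ_natural_right (Z : Completion C) {X Y : Completion C} (η : X ⟶ Y) :
    hF.extObj hD Z ◁ hF.extMap hD η ≫ hF.extμ hD Z Y =
      hF.extμ hD Z X ≫ hF.extMap hD (Completion.whiskerL Z η) := by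
  rw [← cancel_mono (hF.extProj hD (Z.tensor Y))]
  refine hF.join_proj_ext hD (L := Z.D ⊓ X.D) fun w hw => ?_
  simp only [Category.assoc]
  have h : μ F Z.A X.A ▷ (hF.map w).obj ≫ (hF.μIso (Z.A ⊗ X.A) w).hom ≫
      F.map (α_ Z.A X.A w.obj).hom = (α_ (F.obj Z.A) (F.obj X.A) (hF.map w).obj).hom ≫
        F.obj Z.A ◁ (hF.μIso X.A w).hom ≫ μ F Z.A (X.A ⊗ w.obj) := associativity F _ _ _
  rw [hF.proj_extμ_extMap hD _ w hw, hF.extμ_proj, Completion.whiskerL_app, F.map_comp,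
    reassoc_of% h, ← μ_natural_right, proj_tensor,
    MonoidalCategory.tensorHom_def', MonoidalCategory.tensorHom_def']
  simp only [Category.assoc]
  rw [← MonoidalCategory.whiskerLeft_comp_assoc, ← MonoidalCategory.whiskerLeft_comp_assoc,
    Category.assoc, hF.proj_extMap hD η w (Completion.mem_right hw)]
  simp only [MonoidalCategory.whiskerLeft_comp, comp_whiskerRight, Category.assoc]
  rw [associator_naturality_left_assoc, whisker_assoc]
  simp only [Category.assoc, Iso.inv_hom_id_assoc, whisker_exchange_assoc]

omit [IsStiff C] in
theorem extμ_whiskerRight_proj (X Y Z : Completion C) :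
    hF.extμ hD X Y ▷ hF.extObj hD Z ≫ hF.extμ hD (X.tensor Y) Z ≫
      hF.extProj hD ((X.tensor Y).tensor Z) =
    ((hF.extProj hD X ⊗ₘ hF.extProj hD Y) ⊗ₘ hF.extProj hD Z) ≫ μ F X.A Y.A ▷ F.obj Z.A ≫
      μ F (X.A ⊗ Y.A) Z.A := by
  rw [hF.extμ_proj]
  have h : hF.extμ hD X Y ▷ hF.extObj hD Z ≫ (hF.extProj hD (X.tensor Y) ⊗ₘ hF.extProj hD Z) =
      ((hF.extProj hD X ⊗ₘ hF.extProj hD Y) ⊗ₘ hF.extProj hD Z) ≫ μ F X.A Y.A ▷ F.obj Z.A := by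
    rw [← tensorHom_id, ← tensorHom_id, tensorHom_comp_tensorHom, tensorHom_comp_tensorHom,
      hF.extμ_proj, Category.id_comp, Category.comp_id]
  exact (reassoc_of% h) _

omit [IsStiff C] in
theorem extμ_whiskerLeft_proj (X Y Z : Completion C) :
    hF.extObj hD X ◁ hF.extμ hD Y Z ≫ hF.extμ hD X (Y.tensor Z) ≫
      hF.extProj hD (X.tensor (Y.tensor Z)) =
    (hF.extProj hD X ⊗ₘ hF.extProj hD Y ⊗ₘ hF.extProj hD Z) ≫ F.obj X.A ◁ μ F Y.A Z.A ≫
      μ F X.A (Y.A ⊗ Z.A) := by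
  rw [hF.extμ_proj]
  have h : hF.extObj hD X ◁ hF.extμ hD Y Z ≫ (hF.extProj hD X ⊗ₘ hF.extProj hD (Y.tensor Z)) =
      (hF.extProj hD X ⊗ₘ hF.extProj hD Y ⊗ₘ hF.extProj hD Z) ≫ F.obj X.A ◁ μ F Y.A Z.A := by
    rw [← id_tensorHom, ← id_tensorHom, tensorHom_comp_tensorHom, tensorHom_comp_tensorHom,
      hF.extμ_proj, Category.id_comp, Category.comp_id]
  exact (reassoc_of% h) _

theorem extμ_associativity (X Y Z : Completion C) :
    hF.extμ hD X Y ▷ hF.extObj hD Z ≫ hF.extμ hD (X.tensor Y) Z ≫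
      hF.extMap hD (α_ X Y Z).hom =
    (α_ (hF.extObj hD X) (hF.extObj hD Y) (hF.extObj hD Z)).hom ≫
      hF.extObj hD X ◁ hF.extμ hD Y Z ≫ hF.extμ hD X (Y.tensor Z) := by
  rw [← cancel_mono (hF.extProj hD (X.tensor (Y.tensor Z)))]
  have h := hF.extμ_whiskerRight_proj hD X Y Z
  have h' := hF.extμ_whiskerLeft_proj hD X Y Z
  have h2 : hF.extMap hD (α_ X Y Z).hom ≫ hF.extProj hD (X.tensor (Y.tensor Z)) =
      hF.extProj hD ((X.tensor Y).tensor Z) ≫ F.map (α_ X.A Y.A Z.A).hom := by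
    rw [Completion.associator_hom]
    exact hF.extMap_ofHom hD _ _
  simp only [Category.assoc]
  rw [h2, h', reassoc_of% h, associativity F]
  exact associator_naturality_assoc _ _ _ _

theorem extμ_left_unitality (X : Completion C) :
    (λ_ (hF.extObj hD X)).hom = hF.extε hD ▷ hF.extObj hD X ≫
      hF.extμ hD (Completion.unitObj C) X ≫ hF.extMap hD (λ_ X).hom := by
  rw [← cancel_mono (hF.extProj hD X)]
  have h2 : hF.extMap hD (λ_ X).hom ≫ hF.extProj hD X =
      hF.extProj hD ((Completion.unitObj C).tensor X) ≫ F.map (λ_ X.A).hom := by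
    rw [Completion.leftUnitor_hom]
    exact hF.extMap_ofHom hD _ _
  simp only [Category.assoc]
  rw [h2, reassoc_of% (hF.extμ_proj hD (Completion.unitObj C) X), ← tensorHom_id,
    tensorHom_comp_tensorHom_assoc, hF.extε_proj, Category.id_comp, ← leftUnitor_naturality,
    left_unitality F, MonoidalCategory.tensorHom_def', Category.assoc]

theorem extμ_right_unitality (X : Completion C) :
    (ρ_ (hF.extObj hD X)).hom = hF.extObj hD X ◁ hF.extε hD ≫
      hF.extμ hD X (Completion.unitObj C) ≫ hF.extMap hD (ρ_ X).hom := by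
  rw [← cancel_mono (hF.extProj hD X)]
  have h2 : hF.extMap hD (ρ_ X).hom ≫ hF.extProj hD X =
      hF.extProj hD (X.tensor (Completion.unitObj C)) ≫ F.map (ρ_ X.A).hom := by
    rw [Completion.rightUnitor_hom]
    exact hF.extMap_ofHom hD _ _
  simp only [Category.assoc]
  rw [h2, reassoc_of% (hF.extμ_proj hD X (Completion.unitObj C)), ← id_tensorHom,
    tensorHom_comp_tensorHom_assoc, hF.extε_proj, Category.id_comp, ← rightUnitor_naturality,
    right_unitality F, MonoidalCategory.tensorHom_def, Category.assoc]

noncomputable instance extensionLaxMonoidal : (hF.extension hD).LaxMonoidal where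
  ε := hF.extε hD
  μ := hF.extμ hD
  μ_natural_left η Z := hF.extμ_natural_left hD η Z
  μ_natural_right Z η := hF.extμ_natural_right hD Z η
  associativity X Y Z := hF.extμ_associativity hD X Y Z
  left_unitality X := hF.extμ_left_unitality hD X
  right_unitality X := hF.extμ_right_unitality hD X

end PreservesCentralIdempotents
end Extension
-- The extension preserves central idempotents and joins
section Extension

universe v₁ v₂ u₁ u₂

open Functor.LaxMonoidal

theorem mono_whiskerRight_proj {D : Type u₂} [Category.{v₂} D] [MonoidalCategory D] [IsStiff D]
    (A B : D) (u : CentralIdempotent D) : Mono (proj A u ▷ B) := by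
  rw [← swap_inv_proj]
  exact mono_comp _ _

theorem mono_whiskerLeft_proj {D : Type u₂} [Category.{v₂} D] [MonoidalCategory D] [IsStiff D]
    (A B : D) (u : CentralIdempotent D) : Mono (A ◁ proj B u) := by
  have h : A ◁ proj B u = (α_ _ _ _).inv ≫ proj (A ⊗ B) u := by simp [proj_tensor]
  rw [h]
  exact mono_comp _ _

variable {C : Type u₁} [Category.{v₁} C] [MonoidalCategory C] [IsStiff C]
  {D : Type u₂} [Category.{v₂} D] [MonoidalCategory D] [IsStiff D] {F : C ⥤ D} [F.LaxMonoidal]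

namespace PreservesCentralIdempotents

variable (hF : PreservesCentralIdempotents F) (hD : HasUniversalJoins D)

omit [IsStiff C] in
theorem isIso_extμ_idem (X : Completion C) (L : LowerSet (ZI C)) :
    IsIso (hF.extμ hD X ⟨L, 𝟙_ C⟩) := by
  have h1 : IsIso (μ F X.A (𝟙_ C)) := hF.isIso_μ X.A (.unit C)
  have h2 := hF.extμ_proj hD X ⟨L, 𝟙_ C⟩
  have h3 := mono_whiskerRight_proj (F.obj X.A) (hF.extObj hD ⟨L, 𝟙_ C⟩) (hF.join hD X.D)
  have h4 := mono_whiskerLeft_proj (F.obj X.A) (F.obj (𝟙_ C)) (hF.join hD L)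
  have h5 : Mono (hF.extμ hD X ⟨L, 𝟙_ C⟩) := by
    have h6 : Mono (hF.extμ hD X ⟨L, 𝟙_ C⟩ ≫ hF.extProj hD (X.tensor ⟨L, 𝟙_ C⟩)) := by
      rw [h2, MonoidalCategory.tensorHom_def]
      exact mono_comp' (mono_comp' h3 h4) inferInstance
    exact mono_of_mono _ (hF.extProj hD (X.tensor ⟨L, 𝟙_ C⟩))
  have h7 : IsIso (proj (hF.extObj hD (X.tensor ⟨L, 𝟙_ C⟩)) (hF.join hD X.D)) :=
    isIso_proj_of_le (hF.join_mono hD (inf_le_left : X.D ⊓ L ≤ X.D))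
  have h8 : IsIso (proj (hF.extObj hD (X.tensor ⟨L, 𝟙_ C⟩)) (hF.join hD L)) :=
    isIso_proj_of_le (hF.join_mono hD (inf_le_right : X.D ⊓ L ≤ L))
  -- A section of the monic tensorator: the target absorbs the joins over `L` and over `X.D`, so its
  -- projection to `F X.A ⊗ F I` lifts through one and then the other, and `swap` moves the second
  -- into place.
  obtain ⟨g, hg⟩ : RestrictsTo (hF.extProj hD (X.tensor ⟨L, 𝟙_ C⟩) ≫ inv (μ F X.A (𝟙_ C)))
    (hF.join hD L) := restrictsTo_of_isIso_proj _ _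
  obtain ⟨k, hk⟩ : RestrictsTo (g ≫ (α_ _ _ _).hom) (hF.join hD X.D) :=
    restrictsTo_of_isIso_proj _ _
  have h9 : (k ≫ (swap _ _ _).hom) ≫ hF.extμ hD X ⟨L, 𝟙_ C⟩ = 𝟙 _ := by
    rw [← cancel_mono (hF.extProj hD (X.tensor ⟨L, 𝟙_ C⟩)), Category.assoc, h2,
      MonoidalCategory.tensorHom_def]
    simp only [Category.assoc]
    rw [swap_proj_assoc, reassoc_of% hk, ← reassoc_of% (proj_tensor (F.obj X.A) (F.obj (𝟙_ C))),
      reassoc_of% hg]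
    simp
  have : IsSplitEpi (hF.extμ hD X ⟨L, 𝟙_ C⟩) := ⟨⟨⟨_, h9⟩⟩⟩
  exact isIso_of_mono_of_isSplitEpi _

omit [IsStiff C] in
theorem isIso_extε : IsIso (hF.extε hD) := by
  have := hF.isIso_ε
  unfold extε
  infer_instance

theorem exists_extension_idem_iso (L : LowerSet (ZI C)) :
    ∃ e : (hF.extension hD).obj (Completion.idem L).obj ≅ (hF.join hD L).obj,
      e.hom ≫ (hF.join hD L).counit ≫ ε (hF.extension hD) =
        (hF.extension hD).map (Completion.idem L).counit := by
  have := hF.isIso_ε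
  refine ⟨(whiskerRightIso (asIso (ε F)).symm _ ≪≫ λ_ _ :
    hF.extObj hD ⟨L, 𝟙_ C⟩ ≅ (hF.join hD L).obj), ?_⟩
  have h : hF.extMap hD (Completion.ofHom le_top (𝟙 (𝟙_ C)) :
      (⟨L, 𝟙_ C⟩ : Completion C) ⟶ Completion.unitObj C) ≫ hF.extProj hD (Completion.unitObj C) =
      hF.extProj hD ⟨L, 𝟙_ C⟩ :=
    (hF.extMap_ofHom hD _ _).trans ((congrArg _ (F.map_id (𝟙_ C))).trans (Category.comp_id _))
  have h' : (inv (ε F) ▷ (hF.join hD L).obj ≫ (λ_ _).hom) ≫ (hF.join hD L).counit ≫ hF.extε hD =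
      hF.extMap hD (Completion.ofHom le_top (𝟙 (𝟙_ C)) :
        (⟨L, 𝟙_ C⟩ : Completion C) ⟶ Completion.unitObj C) := by
    rw [← cancel_mono (hF.extProj hD (Completion.unitObj C)), h]
    simp only [Category.assoc, hF.extε_proj]
    rw [← leftUnitor_naturality_assoc, ← whisker_exchange_assoc, unitors_equal,
      rightUnitor_naturality_assoc, IsIso.inv_hom_id, Category.comp_id]
    rfl
  exact h'

theorem preservesCentralIdempotents_extension :
    PreservesCentralIdempotents (hF.extension hD) := by
  have hε : IsIso (ε (hF.extension hD)) := hF.isIso_extε hD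
  refine preservesCentralIdempotents_of_iso _ hε (fun X u => ?_) fun u => ?_
  · obtain ⟨L, hL⟩ := Completion.exists_toZI_idem u
    obtain ⟨m, hm⟩ := toZI_eq_iff.1 hL
    have h1 : IsIso (μ (hF.extension hD) X (Completion.idem L).obj) := hF.isIso_extμ_idem hD X L
    have h2 := μ_natural_right (hF.extension hD) X m.f
    have h3 : IsIso ((hF.extension hD).obj X ◁ (hF.extension hD).map m.f ≫
        μ (hF.extension hD) X u.obj) := by
      rw [h2]
      infer_instance
    exact (isIso_comp_left_iff _ _).1 h3
  · obtain ⟨L, hL⟩ := Completion.exists_toZI_idem u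
    obtain ⟨m, hm⟩ := toZI_eq_iff.1 hL
    obtain ⟨e, he⟩ := hF.exists_extension_idem_iso hD L
    refine ⟨hF.join hD L, ((hF.extension hD).mapIso (asIso m.f)).symm ≪≫ e, ?_⟩
    rw [IsIso.eq_comp_inv, Iso.trans_hom, Category.assoc, Category.assoc, he]
    simp [← m.w]

theorem toZI_map_extension {u : CentralIdempotent (Completion C)} {L : LowerSet (ZI C)}
    (h : toZI (Completion.idem L) = toZI u) :
    toZI ((hF.preservesCentralIdempotents_extension hD).map u) = toZI (hF.join hD L) := by
  obtain ⟨e, he⟩ := hF.exists_extension_idem_iso hD L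
  exact ((hF.preservesCentralIdempotents_extension hD).toZI_congr h).symm.trans
    (toZI_map_eq _ _ _ e he)

/-- Joins in `D[C]` are unions of down-closed sets, and the join of the `F c` over a union is the
join of the joins over its members. -/
theorem isJoinMorphism_extension : IsJoinMorphism (hF.extension hD) := by
  refine ⟨hF.preservesCentralIdempotents_extension hD, fun S j hj => ?_⟩
  choose Λ hΛ using Completion.exists_toZI_idem (C := C)
  have h1 : (fun u => toZI ((hF.preservesCentralIdempotents_extension hD).map u)) =
      fun u => toZI (hF.join hD (Λ u)) := funext fun u => hF.toZI_map_extension hD (hΛ u)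
  rw [h1, hF.toZI_map_extension hD (hΛ j)]
  refine ⟨?_, fun z hz => ?_⟩
  · rintro _ ⟨u, hu, rfl⟩
    refine toZI_le_toZI.2 (hF.join_mono hD (Completion.idem_le_idem.1 (toZI_le_toZI.1 ?_)))
    rw [hΛ, hΛ]
    exact hj.1 ⟨u, hu, rfl⟩
  · obtain ⟨w, rfl⟩ := exists_toZI_eq z
    have h2 : Λ j ≤ sSup (Λ '' S) := by
      refine Completion.idem_le_idem.1 (toZI_le_toZI.1 ?_)
      rw [hΛ]
      refine hj.2 ?_
      rintro _ ⟨u, hu, rfl⟩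
      rw [← hΛ u]
      exact toZI_le_toZI.2 (Completion.idem_le_idem.2 (le_sSup ⟨u, hu, rfl⟩))
    refine toZI_le_toZI.2 (hF.join_le hD fun c hc => ?_)
    obtain ⟨_, ⟨u, hu, rfl⟩, hcu⟩ := LowerSet.mem_sSup_iff.1 (h2 hc)
    exact (hF.map_le_join hD hcu).trans (toZI_le_toZI.1 (hz ⟨u, hu, rfl⟩))

/-- The extension restricts to `F`. -/
noncomputable def embeddingExtensionIso :
    embeddingFunctor ⋙ hF.extension hD ≅ F :=
  NatIso.ofComponents (fun A => @asIso _ _ _ _ (hF.extProj hD ⟨⊤, A⟩)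
    (hF.isIso_proj_join_top hD A)) fun {A B} f =>
    hF.extMap_ofHom hD (X := ⟨⊤, A⟩) (Y := ⟨⊤, B⟩) le_rfl f

instance : NatTrans.IsMonoidal (hF.embeddingExtensionIso hD).hom where
  unit := by
    rw [comp_ε]
    have h : hF.extMap hD (𝟙 (Completion.unitObj C)) = 𝟙 _ := (hF.extension hD).map_id _
    have h' : (hF.extε hD ≫ hF.extMap hD (𝟙 (Completion.unitObj C))) ≫
        hF.extProj hD ⟨⊤, 𝟙_ C⟩ = ε F := by
      rw [h, Category.comp_id]
      exact hF.extε_proj hD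
    exact h'
  tensor A B := by
    rw [comp_μ]
    have h : hF.extMap hD (Completion.ofHom le_top (𝟙 (A ⊗ B)) :
        Completion.tensor ⟨⊤, A⟩ ⟨⊤, B⟩ ⟶ ⟨⊤, A ⊗ B⟩) ≫ hF.extProj hD ⟨⊤, A ⊗ B⟩ =
        hF.extProj hD (Completion.tensor ⟨⊤, A⟩ ⟨⊤, B⟩) :=
      (hF.extMap_ofHom hD _ _).trans ((congrArg _ (F.map_id (A ⊗ B))).trans (Category.comp_id _))
    exact (Category.assoc _ _ _).trans ((congrArg (hF.extμ hD ⟨⊤, A⟩ ⟨⊤, B⟩ ≫ ·) h).trans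
      (hF.extμ_proj hD ⟨⊤, A⟩ ⟨⊤, B⟩))

end PreservesCentralIdempotents
end Extension
-- Transport of lax monoidal structures and equality of lax monoidal functors
section Transport

universe v₁ v₂ u₁ u₂

open Functor.LaxMonoidal

variable {C : Type u₁} [Category.{v₁} C] [MonoidalCategory C]
  {D : Type u₂} [Category.{v₂} D] [MonoidalCategory D] {F G : C ⥤ D} [F.LaxMonoidal]

theorem tensorHom_transport_μ (e : F ≅ G) (X Y : C) : (e.hom.app X ⊗ₘ e.hom.app Y) ≫
    (e.inv.app X ⊗ₘ e.inv.app Y) ≫ μ F X Y ≫ e.hom.app (X ⊗ Y) =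
      μ F X Y ≫ e.hom.app (X ⊗ Y) := by
  rw [tensorHom_comp_tensorHom_assoc]
  simp

/-- Transport of a lax monoidal structure along a natural isomorphism. -/
abbrev laxTransport (e : F ≅ G) : G.LaxMonoidal where
  ε := ε F ≫ e.hom.app _
  μ X Y := (e.inv.app X ⊗ₘ e.inv.app Y) ≫ μ F X Y ≫ e.hom.app (X ⊗ Y)
  μ_natural_left {X Y} f Z := by
    rw [← tensorHom_id, tensorHom_comp_tensorHom_assoc, Category.id_comp, Category.assoc,
      Category.assoc, ← e.hom.naturality, ← μ_natural_left_assoc, ← tensorHom_id,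
      tensorHom_comp_tensorHom_assoc, Category.comp_id, e.inv.naturality]
  μ_natural_right {X Y} Z f := by
    rw [← id_tensorHom, tensorHom_comp_tensorHom_assoc, Category.id_comp, Category.assoc,
      Category.assoc, ← e.hom.naturality, ← μ_natural_right_assoc, ← id_tensorHom,
      tensorHom_comp_tensorHom_assoc, Category.comp_id, e.inv.naturality]
  associativity X Y Z := by
    rw [← cancel_epi ((e.hom.app X ⊗ₘ e.hom.app Y) ⊗ₘ e.hom.app Z)]
    rw [← tensorHom_id, ← id_tensorHom, tensorHom_comp_tensorHom_assoc, Category.comp_id,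
      tensorHom_transport_μ, associator_naturality_assoc, tensorHom_comp_tensorHom_assoc,
      Category.comp_id, tensorHom_transport_μ]
    have h1 : (μ F X Y ≫ e.hom.app (X ⊗ Y) ⊗ₘ e.hom.app Z) =
        μ F X Y ▷ F.obj Z ≫ (e.hom.app (X ⊗ Y) ⊗ₘ e.hom.app Z) := by
      rw [← tensorHom_id, tensorHom_comp_tensorHom, Category.id_comp]
    have h2 : (e.hom.app X ⊗ₘ μ F Y Z ≫ e.hom.app (Y ⊗ Z)) =
        F.obj X ◁ μ F Y Z ≫ (e.hom.app X ⊗ₘ e.hom.app (Y ⊗ Z)) := by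
      rw [← id_tensorHom, tensorHom_comp_tensorHom, Category.id_comp]
    rw [h1, h2]
    simp only [Category.assoc]
    rw [tensorHom_transport_μ, reassoc_of% (tensorHom_transport_μ e (X ⊗ Y) Z),
      ← e.hom.naturality, associativity_assoc]
  left_unitality X := by
    rw [← cancel_epi (𝟙_ D ◁ e.hom.app X), leftUnitor_naturality, left_unitality F X, ← id_tensorHom,
      ← tensorHom_id (_ ≫ _), tensorHom_comp_tensorHom_assoc, Category.comp_id, Category.id_comp]
    have h : (ε F ≫ e.hom.app (𝟙_ C) ⊗ₘ e.hom.app X) =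
        ε F ▷ F.obj X ≫ (e.hom.app (𝟙_ C) ⊗ₘ e.hom.app X) := by
      rw [← tensorHom_id, tensorHom_comp_tensorHom, Category.id_comp]
    rw [h]
    simp only [Category.assoc]
    rw [reassoc_of% (tensorHom_transport_μ e (𝟙_ C) X), ← e.hom.naturality]
  right_unitality X := by
    rw [← cancel_epi (e.hom.app X ▷ 𝟙_ D), rightUnitor_naturality, right_unitality F X,
      ← id_tensorHom _ (_ ≫ _), ← tensorHom_id, tensorHom_comp_tensorHom_assoc, Category.comp_id,
      Category.id_comp]
    have h : (e.hom.app X ⊗ₘ ε F ≫ e.hom.app (𝟙_ C)) =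
        F.obj X ◁ ε F ≫ (e.hom.app X ⊗ₘ e.hom.app (𝟙_ C)) := by
      rw [← id_tensorHom, tensorHom_comp_tensorHom, Category.id_comp]
    rw [h]
    simp only [Category.assoc]
    rw [reassoc_of% (tensorHom_transport_μ e X (𝟙_ C)), ← e.hom.naturality]

theorem isMonoidal_laxTransport (e : F ≅ G) :
    letI := laxTransport e
    NatTrans.IsMonoidal e.hom := by
  let _ := laxTransport e
  exact ⟨rfl, fun X Y => (tensorHom_transport_μ e X Y).symm⟩

section Invariance

variable [G.LaxMonoidal]

theorem PreservesCentralIdempotents.of_natIso (e : F ≅ G) [NatTrans.IsMonoidal e.hom]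
    (h : PreservesCentralIdempotents F) : PreservesCentralIdempotents G := by
  have := h.isIso_ε
  have hε := NatTrans.IsMonoidal.unit (τ := e.hom)
  have h1 : IsIso (ε G) := by
    rw [← hε]
    infer_instance
  refine preservesCentralIdempotents_of_iso G h1 (fun A u => ?_) fun u => ⟨h.map u,
    (e.app u.obj).symm, ?_⟩
  · have := h.isIso_μ A u
    have h2 : IsIso ((e.hom.app A ⊗ₘ e.hom.app u.obj) ≫ μ G A u.obj) := by
      rw [← NatTrans.IsMonoidal.tensor (τ := e.hom)]
      infer_instance
    exact (isIso_comp_left_iff _ _).1 h2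
  · have h3 : e.inv.app u.obj ≫ F.map u.counit ≫ inv (ε F) = G.map u.counit ≫ inv (ε G) := by
      rw [IsIso.eq_comp_inv, ← hε]
      simp only [Category.assoc, IsIso.inv_hom_id_assoc, e.hom.naturality,
        Iso.inv_hom_id_app_assoc]
    exact h3

theorem PreservesCentralIdempotents.toZI_map_natIso (e : F ≅ G) [NatTrans.IsMonoidal e.hom]
    (h : PreservesCentralIdempotents F) (h' : PreservesCentralIdempotents G)
    (u : CentralIdempotent C) : toZI (h.map u) = toZI (h'.map u) := by
  have := h'.isIso_ε
  refine h.toZI_map_eq u (h'.map u) (e.app u.obj) ?_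
  have hε := NatTrans.IsMonoidal.unit (τ := e.hom)
  rw [← cancel_mono (e.hom.app (𝟙_ C)), Category.assoc, Category.assoc, hε]
  have h3 : (h'.map u).counit ≫ ε G = G.map u.counit := by
    simp [PreservesCentralIdempotents.map]
  refine (congrArg (e.hom.app u.obj ≫ ·) h3).trans ?_
  simp

theorem IsJoinMorphism.of_natIso (e : F ≅ G) [NatTrans.IsMonoidal e.hom]
    (h : IsJoinMorphism F) : IsJoinMorphism G := by
  obtain ⟨h, k⟩ := h
  refine ⟨h.of_natIso e, fun S j hj => ?_⟩
  simpa only [h.toZI_map_natIso e (h.of_natIso e)] using k S j hj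

end Invariance

/-- The natural isomorphism underlying an isomorphism of lax monoidal functors. -/
def laxIsoNatIso {F G : LaxMonoidalFunctor C D} (e : F ≅ G) : F.toFunctor ≅ G.toFunctor where
  hom := e.hom.hom
  inv := e.inv.hom
  hom_inv_id := congrArg LaxMonoidalFunctor.Hom.hom e.hom_inv_id
  inv_hom_id := congrArg LaxMonoidalFunctor.Hom.hom e.inv_hom_id

instance {F G : LaxMonoidalFunctor C D} (e : F ≅ G) :
    NatTrans.IsMonoidal (laxIsoNatIso e).hom := e.hom.isMonoidal

/-- Once the underlying functors are identified, `e` has identity components, and the two axioms of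
a monoidal transformation say that `ε` and `μ` coincide. -/
theorem laxMonoidalFunctor_ext {F G : LaxMonoidalFunctor C D} (e : F ≅ G)
    (hobj : ∀ X, F.obj X = G.obj X) (h : ∀ X, e.hom.hom.app X = eqToHom (hobj X)) : F = G := by
  have hFG : F.toFunctor = G.toFunctor := Functor.ext_of_iso (laxIsoNatIso e) hobj h
  have hm := e.hom.isMonoidal
  revert h hm
  generalize e.hom.hom = t
  clear e
  obtain ⟨F, lF⟩ := F
  obtain ⟨G, lG⟩ := G
  obtain rfl : F = G := hFG
  intro h hm
  have ht : ∀ X, t.app X = 𝟙 _ := h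
  congr 1
  ext X Y
  · have := hm.unit
    rw [ht] at this
    exact (Category.comp_id _).symm.trans this
  · have := hm.tensor X Y
    rw [ht, ht, ht, id_tensorHom_id] at this
    exact (Category.comp_id _).symm.trans (this.trans (Category.id_comp _))

/-- Replacing the values of a lax monoidal functor by isomorphic objects. -/
noncomputable def laxCopy (H : LaxMonoidalFunctor C D) (P : ∀ X, Σ Y : D, H.obj X ≅ Y) :
    LaxMonoidalFunctor C D :=
  @LaxMonoidalFunctor.of _ _ _ _ _ _ (H.toFunctor.copyObj (fun X => (P X).1) fun X => (P X).2)
    (laxTransport (H.toFunctor.isoCopyObj (fun X => (P X).1) fun X => (P X).2))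

/-- The comparison with the original functor. -/
noncomputable def isoLaxCopy (H : LaxMonoidalFunctor C D) (P : ∀ X, Σ Y : D, H.obj X ≅ Y) :
    H ≅ laxCopy H P :=
  @LaxMonoidalFunctor.isoMk _ _ _ _ _ _ H (laxCopy H P)
    (H.toFunctor.isoCopyObj (fun X => (P X).1) fun X => (P X).2) (isMonoidal_laxTransport _)

end Transport
-- The extension made strict along the embedding
section Extension

universe v₁ v₂ u₁ u₂

variable {C : Type u₁} [Category.{v₁} C] [MonoidalCategory C] [IsStiff C]
  {D : Type u₂} [Category.{v₂} D] [MonoidalCategory D] [IsStiff D]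

namespace PreservesCentralIdempotents

variable {F : C ⥤ D} [F.LaxMonoidal] (hF : PreservesCentralIdempotents F)
  (hD : HasUniversalJoins D)

open scoped Classical in
/-- The value of the strict extension of `F`, which is `F A` on `⟨⊤, A⟩`, and its comparison with
the value of the extension. -/
noncomputable def strictObj (X : Completion C) : Σ Y : D, hF.extObj hD X ≅ Y :=
  if h : X.D = ⊤ then ⟨F.obj X.A, @asIso _ _ _ _ (hF.extProj hD X) (by
    obtain ⟨L, A⟩ := X
    obtain rfl : L = ⊤ := h
    exact hF.isIso_proj_join_top hD A)⟩ else ⟨_, Iso.refl _⟩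

omit [IsStiff C] in
theorem strictObj_top (A : C) : hF.strictObj hD ⟨⊤, A⟩ =
    ⟨F.obj A, @asIso _ _ _ _ (hF.extProj hD ⟨⊤, A⟩) (hF.isIso_proj_join_top hD A)⟩ := dif_pos rfl

omit [IsStiff C] in
theorem strictObj_inv_proj (A : C) (h : (hF.strictObj hD ⟨⊤, A⟩).1 = F.obj A) :
    (hF.strictObj hD ⟨⊤, A⟩).2.inv ≫ hF.extProj hD ⟨⊤, A⟩ = eqToHom h := by
  have h' := hF.strictObj_top hD A
  revert h
  generalize hF.strictObj hD ⟨⊤, A⟩ = p at h'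
  subst h'
  intro h
  exact @IsIso.inv_hom_id _ _ _ _ _ (hF.isIso_proj_join_top hD A)

end PreservesCentralIdempotents

/-- Existence of the extension along the embedding. -/
theorem exists_extension (hD : HasUniversalJoins D) (F : LaxMonoidalFunctor C D)
    (hF : PreservesCentralIdempotents F.toFunctor) :
    ∃ Fhat : LaxMonoidalFunctor (Completion C) D,
      IsJoinMorphism Fhat.toFunctor ∧ laxComp (embedding C) Fhat = F := by
  let e := isoLaxCopy (.of (hF.extension hD)) (hF.strictObj hD)
  let a : laxComp (embedding C) (.of (hF.extension hD)) ≅ F :=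
    @LaxMonoidalFunctor.isoMk _ _ _ _ _ _ (laxComp (embedding C) (.of (hF.extension hD))) F
      (hF.embeddingExtensionIso hD)
      (inferInstanceAs (NatTrans.IsMonoidal (hF.embeddingExtensionIso hD).hom))
  refine ⟨laxCopy (.of (hF.extension hD)) (hF.strictObj hD),
    IsJoinMorphism.of_natIso (F := (LaxMonoidalFunctor.of (hF.extension hD)).toFunctor)
      (laxIsoNatIso e) (hF.isJoinMorphism_extension hD),
    -- At `⟨⊤, A⟩` the replacement isomorphism is the projection to `F A` itself, so it cancels
    -- against `a`, and the comparison with `F` has `eqToHom` components.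
    laxMonoidalFunctor_ext (laxCompIso (Iso.refl _) e.symm ≪≫ a)
      (fun A => congrArg Sigma.fst (hF.strictObj_top hD A)) fun A => ?_⟩
  refine Eq.trans ?_ (hF.strictObj_inv_proj hD A _)
  exact congrArg (· ≫ hF.extProj hD ⟨⊤, A⟩) ((congrArg ((hF.strictObj hD ⟨⊤, A⟩).2.inv ≫ ·)
    ((hF.extension hD).map_id ⟨⊤, A⟩)).trans (Category.comp_id _))

end Extension
-- Extending monoidal transformations along the embedding
section Uniqueness

universe v₁ v₂ v₃ u₁ u₂ u₃

open Functor.LaxMonoidal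

theorem PreservesCentralIdempotents.toZI_map_comp {C : Type u₁} [Category.{v₁} C]
    [MonoidalCategory C] {D : Type u₂} [Category.{v₂} D] [MonoidalCategory D]
    {E : Type u₃} [Category.{v₃} E] [MonoidalCategory E] {F : C ⥤ D} [F.LaxMonoidal]
    {G : D ⥤ E} [G.LaxMonoidal] (hF : PreservesCentralIdempotents F)
    (hG : PreservesCentralIdempotents G) (u : CentralIdempotent C) :
    toZI ((hF.comp hG).map u) = toZI (hG.map (hF.map u)) := by
  have := hF.isIso_ε
  have := hG.isIso_ε
  exact PreservesCentralIdempotents.toZI_map_eq _ u _ (Iso.refl _)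
    (by simp [PreservesCentralIdempotents.map])

theorem PreservesCentralIdempotents.infClosed_map {C : Type u₁} [Category.{v₁} C]
    [MonoidalCategory C] {D : Type u₂} [Category.{v₂} D] [MonoidalCategory D] {F : C ⥤ D}
    [F.LaxMonoidal] (hF : PreservesCentralIdempotents F) {S : Set (CentralIdempotent C)}
    (hS : InfClosed S) : InfClosed (hF.map '' S) := by
  rintro _ ⟨u, hu, rfl⟩ _ ⟨v, hv, rfl⟩
  obtain ⟨w, hw, h⟩ := hS u hu v hv
  refine ⟨_, ⟨w, hw, rfl⟩, ?_⟩
  rw [hF.toZI_congr (h.unique (CentralIdempotent.isGLB_inf u v)), hF.toZI_map_inf]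
  exact CentralIdempotent.isGLB_inf _ _

variable {C : Type u₁} [Category.{v₁} C] [MonoidalCategory C] [IsStiff C]
  {D : Type u₂} [Category.{v₂} D] [MonoidalCategory D] [IsStiff D]

namespace Completion

/-- Every object is a restriction of an object in the image of the embedding; a functor preserving
central idempotents therefore carries `toTop X` to a projection of `D`, up to isomorphism. -/
theorem exists_toTop_eq (X : Completion C) :
    ∃ e : X ≅ (⟨⊤, X.A⟩ : Completion C) ⊗ (idem X.D).obj,
      e.hom ≫ proj (⟨⊤, X.A⟩ : Completion C) (idem X.D) = toTop X := by
  refine ⟨ofIso (X := X) (Y := ⟨⊤ ⊓ X.D, X.A⟩) (top_inf_eq _).symm (Iso.refl _) ≪≫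
    (tensorIdemIso ⟨⊤, X.A⟩ X.D).symm, ?_⟩
  rw [proj_idem, Iso.trans_hom, Iso.symm_hom, Category.assoc, Iso.inv_hom_id_assoc]
  exact (ofHom_comp_ofHom (X := X) (Y := ⟨⊤ ⊓ X.D, X.A⟩) (Z := ⟨⊤, X.A⟩) (top_inf_eq _).ge (𝟙 X.A)
    inf_le_left (𝟙 X.A)).trans (congrArg (ofHom (X := X) (Y := ⟨⊤, X.A⟩) le_top)
      (Category.comp_id (𝟙 X.A)))

/-- Every `idem L` is the join of the central idempotents of `C` in `L`. -/
theorem isLUB_idem (L : LowerSet (ZI C)) :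
    IsLUB (toZI '' (preservesCentralIdempotents_embedding (C := C)).image L) (toZI (idem L)) := by
  refine ⟨?_, fun z hz => ?_⟩
  · rintro _ ⟨_, ⟨a, ha, rfl⟩, rfl⟩
    rw [toZI_map_embedding]
    exact toZI_le_toZI.2 (idem_le_idem.2 (LowerSet.Iic_le.2 ha))
  · obtain ⟨w, rfl⟩ := exists_toZI_eq z
    obtain ⟨M, hM⟩ := exists_toZI_idem w
    rw [← hM]
    refine toZI_le_toZI.2 (idem_le_idem.2 fun a ha => ?_)
    obtain ⟨a, rfl⟩ := exists_toZI_eq a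
    have h := hz ⟨_, ⟨a, ha, rfl⟩, rfl⟩
    rw [toZI_map_embedding, ← hM] at h
    exact idem_le_idem.1 (toZI_le_toZI.1 h) (mem_Iic_self a)

section One

variable {G : Completion C ⥤ D} [G.LaxMonoidal] (h : PreservesCentralIdempotents G)

include h

theorem mono_map_toTop (X : Completion C) : Mono (G.map (toTop X)) := by
  obtain ⟨e, he⟩ := exists_toTop_eq X
  have := h.mono_map_proj ⟨⊤, X.A⟩ (idem X.D)
  rw [← he, G.map_comp]
  infer_instance

omit [IsStiff D] in
theorem isIso_proj_map (X : Completion C) : IsIso (proj (G.obj X) (h.map (idem X.D))) := by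
  obtain ⟨e, -⟩ := exists_toTop_eq X
  have := isIso_proj_of_iso e (idem X.D)
  rw [← h.μIso_map_proj]
  infer_instance

omit [IsStiff D] in
theorem exists_factor_map_toTop {X : Completion C} {Z : D} (f : Z ⟶ G.obj ⟨⊤, X.A⟩)
    (hf : RestrictsTo f (h.map (idem X.D))) : ∃ g : Z ⟶ G.obj X, g ≫ G.map (toTop X) = f := by
  obtain ⟨e, he⟩ := exists_toTop_eq X
  obtain ⟨g, hg⟩ := hf
  refine ⟨g ≫ (h.μIso ⟨⊤, X.A⟩ (idem X.D)).hom ≫ G.map e.inv, ?_⟩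
  rw [Category.assoc, Category.assoc, ← G.map_comp, ← he, Iso.inv_hom_id_assoc,
    h.μIso_map_proj, hg]

omit [IsStiff D] in
theorem isLUB_map_idem (k : h.PreservesJoins) (L : LowerSet (ZI C)) :
    IsLUB (toZI '' (h.map '' (preservesCentralIdempotents_embedding (C := C)).image L))
      (toZI (h.map (idem L))) := by
  rw [Set.image_image]
  exact k _ _ (isLUB_idem L)

omit [IsStiff D] in
-- `G` sends `idem X.D` to the join of the images of the `a ∈ X.D`. This join is universal in `D`
-- and absorbed by `G X`, so the images of the pieces `⟨⊤, X.A ⊗ a⟩` are jointly epic.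
theorem map_hom_ext (k : h.PreservesJoins) (hD : HasUniversalJoins D) {X : Completion C} {Y : D}
    {f g : G.obj X ⟶ Y}
    (H : ∀ (a : CentralIdempotent C), toZI a ∈ X.D →
      ∀ p : (⟨⊤, X.A ⊗ a.obj⟩ : Completion C) ⟶ X, p ≫ toTop X = topHom (proj X.A a) →
        G.map p ≫ f = G.map p ≫ g) : f = g := by
  have := isIso_proj_map h X
  refine hD.proj_ext (h.infClosed_map (PreservesCentralIdempotents.infClosed_image_lowerSet _ X.D))
    (isLUB_map_idem h k X.D) ?_
  rintro _ ⟨_, ⟨a, ha, rfl⟩, rfl⟩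
  rw [← h.μIso_map_proj, Category.assoc, Category.assoc]
  congr 1
  obtain ⟨m, -⟩ := toZI_eq_iff.1 (toZI_map_embedding a)
  obtain ⟨e, he⟩ := exists_principal_proj X a ha
  have h1 := H a ha _ he
  rw [G.map_comp, Category.assoc, Category.assoc, cancel_epi] at h1
  rw [← whiskerLeft_hom_proj X m, G.map_comp, Category.assoc, Category.assoc, h1]

end One

variable {G₁ G₂ : Completion C ⥤ D} [G₁.LaxMonoidal] [G₂.LaxMonoidal]
  (h₁ : PreservesCentralIdempotents G₁) (h₂ : PreservesCentralIdempotents G₂)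

include h₂ in
omit [G₁.LaxMonoidal] in
theorem natTrans_ext {s t : G₁ ⟶ G₂} (h : ∀ A : C, s.app ⟨⊤, A⟩ = t.app ⟨⊤, A⟩) : s = t := by
  ext X
  have := mono_map_toTop h₂ X
  rw [← cancel_mono (G₂.map (toTop X)), ← s.naturality, ← t.naturality, h]

theorem toTop_tensor (X Y : Completion C) :
    (toTop X ⊗ₘ toTop Y) ≫ μ embeddingFunctor X.A Y.A = toTop (X.tensor Y) := by
  rw [MonoidalCategory.tensorHom_def, whiskerRight_ofHom, whiskerLeft_ofHom]
  have h : (𝟙 X.A ▷ Y.A ≫ X.A ◁ 𝟙 Y.A) ≫ 𝟙 (X.A ⊗ Y.A) = 𝟙 (X.A ⊗ Y.A) := by simp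
  refine (congrArg (· ≫ _) (ofHom_comp_ofHom _ _ _ _)).trans ?_
  exact (ofHom_comp_ofHom _ _ _ _).trans
    (congrArg (ofHom (X := X.tensor Y) (Y := ⟨⊤, X.A ⊗ Y.A⟩) le_top) h)

/-- The component at `X` is forced: it must lift `G₁ (toTop X) ≫ c` through the monomorphism `G₂
(toTop X)`. The lift exists because `G₁ X` absorbs `G₁ (idem X.D)` and hence, by `hle`, the larger
`G₂ (idem X.D)`. -/
theorem exists_natTrans (k₁ : h₁.PreservesJoins) (hD : HasUniversalJoins D)
    (hle : ∀ L : LowerSet (ZI C), h₁.map (idem L) ≤ h₂.map (idem L))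
    (c : ∀ A : C, G₁.obj ⟨⊤, A⟩ ⟶ G₂.obj ⟨⊤, A⟩)
    (hc : ∀ {A B : C} (f : A ⟶ B), G₁.map (topHom f) ≫ c B = c A ≫ G₂.map (topHom f))
    (hε : ε G₁ ≫ c (𝟙_ C) = ε G₂)
    (hμ : ∀ A B : C, μ G₁ ⟨⊤, A⟩ ⟨⊤, B⟩ ≫ G₁.map (μ embeddingFunctor A B) ≫ c (A ⊗ B) =
      (c A ⊗ₘ c B) ≫ μ G₂ ⟨⊤, A⟩ ⟨⊤, B⟩ ≫ G₂.map (μ embeddingFunctor A B)) :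
    ∃ t : G₁ ⟶ G₂, NatTrans.IsMonoidal t ∧ ∀ A : C, t.app ⟨⊤, A⟩ = c A := by
  have hmono := mono_map_toTop h₂
  have hex : ∀ X : Completion C, ∃ g : G₁.obj X ⟶ G₂.obj X,
      g ≫ G₂.map (toTop X) = G₁.map (toTop X) ≫ c X.A := fun X => by
    have := isIso_proj_map h₁ X
    have := isIso_proj_of_le (Z := G₁.obj X) (hle X.D)
    exact exists_factor_map_toTop h₂ _ (restrictsTo_of_isIso_proj _ _)
  choose φ hφ using hex
  have htop : ∀ A : C, φ ⟨⊤, A⟩ = c A := fun A => by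
    have h := hφ ⟨⊤, A⟩
    have e : toTop (⟨⊤, A⟩ : Completion C) = 𝟙 _ := rfl
    rw [e, G₂.map_id, G₁.map_id, Category.comp_id, Category.id_comp] at h
    exact h
  have hp : ∀ (X : Completion C) (a : CentralIdempotent C)
      (p : (⟨⊤, X.A ⊗ a.obj⟩ : Completion C) ⟶ X), p ≫ toTop X = topHom (proj X.A a) →
      G₁.map p ≫ φ X = c _ ≫ G₂.map p := fun X a p hp => by
    rw [← cancel_mono (G₂.map (toTop X)), Category.assoc, Category.assoc, hφ, ← G₂.map_comp,
      ← G₁.map_comp_assoc, hp, hc]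
  refine ⟨⟨φ, fun {X Y} η => ?_⟩, ⟨?_, fun X Y => ?_⟩, htop⟩
  · rw [← cancel_mono (G₂.map (toTop Y)), Category.assoc, Category.assoc, hφ, ← G₂.map_comp,
      ← G₁.map_comp_assoc]
    -- On a piece `⟨⊤, X.A ⊗ a⟩` both `p ≫ η ≫ toTop Y` and the transformation come from `C`, where
    -- `hc` applies.
    refine map_hom_ext h₁ k₁ hD fun a ha p hp' => ?_
    rw [← Category.assoc, ← G₁.map_comp, comp_eq_ofHom_app _ a ha p hp', hc,
      reassoc_of% (hp X a p hp'), ← G₂.map_comp, comp_eq_ofHom_app _ a ha p hp']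
  · exact (congrArg (ε G₁ ≫ ·) (htop (𝟙_ C))).trans hε
  -- Since `toTop` is compatible with tensor products, this monomorphism reduces multiplicativity to
  -- objects of `C`, where it is `hμ`.
  · rw [← cancel_mono (G₂.map (toTop (X.tensor Y)))]
    have e1 : G₁.map (toTop X ⊗ₘ toTop Y) ≫ G₁.map (μ embeddingFunctor X.A Y.A) =
        G₁.map (toTop (X.tensor Y)) := (G₁.map_comp _ _).symm.trans (congrArg _ (toTop_tensor X Y))
    have e2 : G₂.map (toTop X ⊗ₘ toTop Y) ≫ G₂.map (μ embeddingFunctor X.A Y.A) =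
        G₂.map (toTop (X.tensor Y)) := (G₂.map_comp _ _).symm.trans (congrArg _ (toTop_tensor X Y))
    have e3 : φ (X.tensor Y) ≫ G₂.map (toTop (X.tensor Y)) =
        G₁.map (toTop X ⊗ₘ toTop Y) ≫ G₁.map (μ embeddingFunctor X.A Y.A) ≫ c (X.A ⊗ Y.A) :=
      (hφ _).trans ((congrArg (· ≫ _) e1.symm).trans (Category.assoc _ _ _))
    have e4 : (φ X ⊗ₘ φ Y) ≫ (G₂.map (toTop X) ⊗ₘ G₂.map (toTop Y)) =
        (G₁.map (toTop X) ⊗ₘ G₁.map (toTop Y)) ≫ (c X.A ⊗ₘ c Y.A) := by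
      rw [tensorHom_comp_tensorHom, tensorHom_comp_tensorHom, hφ, hφ]
    have e5 := reassoc_of% e4
    have s1 : (μ G₁ X Y ≫ φ (X.tensor Y)) ≫ G₂.map (toTop (X.tensor Y)) =
        μ G₁ X Y ≫ G₁.map (toTop X ⊗ₘ toTop Y) ≫ G₁.map (μ embeddingFunctor X.A Y.A) ≫
          c (X.A ⊗ Y.A) := (Category.assoc _ _ _).trans (congrArg (μ G₁ X Y ≫ ·) e3)
    have s2 : (G₁.map (toTop X) ⊗ₘ G₁.map (toTop Y)) ≫ μ G₁ ⟨⊤, X.A⟩ ⟨⊤, Y.A⟩ ≫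
          G₁.map (μ embeddingFunctor X.A Y.A) ≫ c (X.A ⊗ Y.A) =
        (G₁.map (toTop X) ⊗ₘ G₁.map (toTop Y)) ≫ (c X.A ⊗ₘ c Y.A) ≫ μ G₂ ⟨⊤, X.A⟩ ⟨⊤, Y.A⟩ ≫
          G₂.map (μ embeddingFunctor X.A Y.A) := congrArg _ (hμ X.A Y.A)
    have s3 : (φ X ⊗ₘ φ Y) ≫ μ G₂ X Y ≫ G₂.map (toTop X ⊗ₘ toTop Y) ≫
          G₂.map (μ embeddingFunctor X.A Y.A) =
        ((φ X ⊗ₘ φ Y) ≫ μ G₂ X Y) ≫ G₂.map (toTop (X.tensor Y)) :=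
      (congrArg (fun t => (φ X ⊗ₘ φ Y) ≫ μ G₂ X Y ≫ t) e2).trans (Category.assoc _ _ _).symm
    exact s1.trans ((μ_natural_assoc G₁ (toTop X) (toTop Y) _).symm.trans (s2.trans
      ((e5 _).symm.trans ((congrArg ((φ X ⊗ₘ φ Y) ≫ ·)
        (μ_natural_assoc G₂ (toTop X) (toTop Y) _)).trans s3))))

end Completion
end Uniqueness
-- Unique extension of monoidal natural isomorphisms
section Uniqueness

universe v₁ v₂ u₁ u₂

open Functor.LaxMonoidal

variable {C : Type u₁} [Category.{v₁} C] [MonoidalCategory C] [IsStiff C]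
  {D : Type u₂} [Category.{v₂} D] [MonoidalCategory D] [IsStiff D]

namespace Completion

omit [IsStiff D] in
-- `G₁ (idem L)` is the join of the `G₁ (E a)`, `a ∈ L`. By `γ` these agree with the `G₂ (E a)`,
-- which lie below `G₂ (idem L)` by monotonicity alone.
theorem map_idem_le_of_iso {G₁ G₂ : Completion C ⥤ D} [G₁.LaxMonoidal] [G₂.LaxMonoidal]
    (h₁ : PreservesCentralIdempotents G₁) (h₂ : PreservesCentralIdempotents G₂)
    (k₁ : h₁.PreservesJoins) (γ : embeddingFunctor (C := C) ⋙ G₁ ≅ embeddingFunctor ⋙ G₂)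
    [NatTrans.IsMonoidal γ.hom] (L : LowerSet (ZI C)) :
    h₁.map (idem L) ≤ h₂.map (idem L) := by
  refine toZI_le_toZI.1 ((isLUB_map_idem h₁ k₁ L).2 ?_)
  rintro _ ⟨_, ⟨_, ⟨a, ha, rfl⟩, rfl⟩, rfl⟩
  rw [← PreservesCentralIdempotents.toZI_map_comp preservesCentralIdempotents_embedding h₁,
    PreservesCentralIdempotents.toZI_map_natIso γ _
      (preservesCentralIdempotents_embedding.comp h₂),
    PreservesCentralIdempotents.toZI_map_comp preservesCentralIdempotents_embedding h₂]
  exact toZI_le_toZI.2 (h₂.mono (le_of_isLUB (isLUB_idem L) _ ⟨a, ha, rfl⟩))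

theorem exists_lift (hD : HasUniversalJoins D) {G₁ G₂ : LaxMonoidalFunctor (Completion C) D}
    (h₁ : PreservesCentralIdempotents G₁.toFunctor) (h₂ : PreservesCentralIdempotents G₂.toFunctor)
    (k₁ : h₁.PreservesJoins) (γ : laxComp (embedding C) G₁ ≅ laxComp (embedding C) G₂) :
    ∃ t : G₁ ⟶ G₂, ∀ A : C, t.hom.app ((embedding C).obj A) = γ.hom.hom.app A := by
  let γ' : embeddingFunctor (C := C) ⋙ G₁.toFunctor ≅ embeddingFunctor ⋙ G₂.toFunctor :=
    laxIsoNatIso γ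
  have hm : NatTrans.IsMonoidal γ'.hom := γ.hom.isMonoidal
  have hu := hm.unit
  have ht := hm.tensor
  simp only [comp_ε, comp_μ] at hu ht
  have h1 : ε G₁.toFunctor ≫ γ'.hom.app (𝟙_ C) = ε G₂.toFunctor := by
    have e₁ := (congrArg (ε G₁.toFunctor ≫ ·) (G₁.map_id (unitObj C))).trans (Category.comp_id _)
    have e₂ := (congrArg (ε G₂.toFunctor ≫ ·) (G₂.map_id (unitObj C))).trans (Category.comp_id _)
    exact (congrArg (· ≫ γ'.hom.app (𝟙_ C)) e₁).symm.trans (hu.trans e₂)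
  obtain ⟨t, ht, h⟩ := exists_natTrans h₁ h₂ k₁ hD
    (map_idem_le_of_iso h₁ h₂ k₁ γ') (fun A => γ'.hom.app A)
    (fun f => γ'.hom.naturality f) h1 fun A B => (Category.assoc _ _ _).symm.trans (ht A B)
  exact ⟨⟨t, ht⟩, h⟩

theorem lift_ext {G₁ G₂ : LaxMonoidalFunctor (Completion C) D}
    (h₂ : PreservesCentralIdempotents G₂.toFunctor) {s t : G₁ ⟶ G₂}
    (h : ∀ A : C, s.hom.app ((embedding C).obj A) = t.hom.app ((embedding C).obj A)) : s = t :=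
  LaxMonoidalFunctor.hom_ext (natTrans_ext h₂ h)

/-- Monoidal natural isomorphisms extend uniquely along the embedding. -/
theorem existsUnique_iso (hD : HasUniversalJoins D) {G₁ G₂ : LaxMonoidalFunctor (Completion C) D}
    (h₁ : IsJoinMorphism G₁.toFunctor) (h₂ : IsJoinMorphism G₂.toFunctor)
    (γ : laxComp (embedding C) G₁ ≅ laxComp (embedding C) G₂) :
    ∃! φ : G₁ ≅ G₂, ∀ A : C, φ.hom.hom.app ((embedding C).obj A) = γ.hom.hom.app A := by
  obtain ⟨h₁, k₁⟩ := h₁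
  obtain ⟨h₂, k₂⟩ := h₂
  -- Both `γ` and its inverse are extended; the extensions are mutually inverse because their
  -- composites are identities on the embedding.
  obtain ⟨s, hs⟩ := exists_lift hD h₁ h₂ k₁ γ
  obtain ⟨t, ht⟩ := exists_lift hD h₂ h₁ k₂ γ.symm
  refine ⟨⟨s, t, lift_ext h₁ fun A => ?_, lift_ext h₂ fun A => ?_⟩, hs, fun φ hφ =>
    Iso.ext (lift_ext h₂ fun A => (hφ A).trans (hs A).symm)⟩
  · exact (congrArg₂ (· ≫ ·) (hs A) (ht A)).trans ((laxIsoNatIso γ).hom_inv_id_app A)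
  · exact (congrArg₂ (· ≫ ·) (ht A) (hs A)).trans ((laxIsoNatIso γ).inv_hom_id_app A)

end Completion
end Uniqueness

/-! ### The adjunction -/

section Adjunction

/-- The free completion as an object of `MonCat_j`. -/
noncomputable abbrev MonCatS.completion (C : MonCatS.{u}) : MonCatJ.{u} :=
  { carrier := Completion C.carrier, isJ := inMonCatJ_completion C.carrier }

/-- The class of the embedding. -/
noncomputable abbrev MonCatS.toCompletion (C : MonCatS.{u}) : C ⟶ forgetJS.obj C.completion :=
  MonCatS.homMk (D := C.completion.toS) (embedding C.carrier)
    Completion.preservesCentralIdempotents_embedding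

/-- Morphisms are isomorphism classes, so surjectivity is the existence of extensions and
injectivity is the extension of monoidal isomorphisms. -/
theorem MonCatS.toCompletion_comp_bijective (C : MonCatS.{u}) (D : MonCatJ.{u}) :
    Function.Bijective fun f : C.completion ⟶ D => C.toCompletion ≫ forgetJS.map f := by
  have := D.isJ.stiff
  have hD := D.isJ.joins
  constructor
  · rintro ⟨F⟩ ⟨G⟩ h
    obtain ⟨γ⟩ := Quotient.exact h
    obtain ⟨φ, -⟩ := Completion.existsUnique_iso hD F.2 G.2 γ
    exact Quotient.sound ⟨φ⟩
  · rintro ⟨F⟩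
    obtain ⟨G, hG, h⟩ := exists_extension hD F.1 F.2
    exact ⟨Quotient.mk _ ⟨G, hG⟩, Quotient.sound ⟨eqToIso h⟩⟩

/-- The equivalence of hom-sets. -/
noncomputable def completionHomEquiv (C : MonCatS.{u}) (D : MonCatJ.{u}) :
    (C.completion ⟶ D) ≃ (C ⟶ forgetJS.obj D) :=
  Equiv.ofBijective _ (C.toCompletion_comp_bijective D)

theorem completionHomEquiv_comp (C : MonCatS.{u}) (D D' : MonCatJ.{u}) (g : D ⟶ D')
    (f : C.completion ⟶ D) :
    completionHomEquiv C D' (f ≫ g) = completionHomEquiv C D f ≫ forgetJS.map g := by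
  change C.toCompletion ≫ forgetJS.map (f ≫ g) = (C.toCompletion ≫ forgetJS.map f) ≫ forgetJS.map g
  rw [forgetJS.map_comp, Category.assoc]

end Adjunction
end CentralIdem

open CentralIdem in
theorem mainTheorem4 :
    (∀ (C : Type u) [SmallCategory C] [MonoidalCategory C] [IsStiff C],
      InMonCatJ (Completion C) ∧
      PreservesCentralIdempotents (embedding C).toFunctor ∧
      ∀ (D : Type v) [Category.{w} D] [MonoidalCategory D] [IsStiff D],
        HasUniversalJoins D →
        (∀ F : LaxMonoidalFunctor C D, PreservesCentralIdempotents F.toFunctor →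
          ∃ Fhat : LaxMonoidalFunctor (Completion C) D,
            IsJoinMorphism Fhat.toFunctor ∧ laxComp (embedding C) Fhat = F) ∧
        (∀ G₁ G₂ : LaxMonoidalFunctor (Completion C) D,
          IsJoinMorphism G₁.toFunctor → IsJoinMorphism G₂.toFunctor →
          ∀ γ : laxComp (embedding C) G₁ ≅ laxComp (embedding C) G₂,
            ∃! φ : G₁ ≅ G₂, ∀ A : C,
              φ.hom.hom.app ((embedding C).obj A) = γ.hom.hom.app A)) ∧
    (∃ (hD : ∀ C : MonCatS.{u}, InMonCatJ (Completion C.carrier))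
        (hE : ∀ C : MonCatS.{u},
          PreservesCentralIdempotents (embedding C.carrier).toFunctor)
        (L : MonCatS.{u} ⥤ MonCatJ.{u})
        (hL : ∀ C : MonCatS.{u},
          L.obj C = { carrier := Completion C.carrier, isJ := hD C })
        (adj : L ⊣ forgetJS.{u}),
      ∀ C : MonCatS.{u},
        adj.unit.app C ≫ forgetJS.map (eqToHom (hL C)) =
          MonCatS.homMk (D := MonCatJ.toS { carrier := Completion C.carrier, isJ := hD C })
            (embedding C.carrier) (hE C)) := by
  refine ⟨fun C _ _ _ => ⟨inMonCatJ_completion C,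
      Completion.preservesCentralIdempotents_embedding, fun D _ _ _ hD =>
        ⟨fun F hF => exists_extension hD F hF, fun _ _ h₁ h₂ γ =>
          Completion.existsUnique_iso hD h₁ h₂ γ⟩⟩,
    fun C => inMonCatJ_completion C.carrier,
    fun _ => Completion.preservesCentralIdempotents_embedding,
    Adjunction.leftAdjointOfEquiv (F_obj := MonCatS.completion) completionHomEquiv completionHomEquiv_comp,
    fun _ => rfl,
    Adjunction.adjunctionOfEquivLeft completionHomEquiv completionHomEquiv_comp, fun C => ?_⟩
  -- The object equality holds by `rfl`, so its `eqToHom` is an identity. The unit is the image of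
  -- an identity under the hom-set bijection, that is, the embedding followed by an identity.
  refine (congrArg (_ ≫ ·) (forgetJS.map_id C.completion)).trans ((Category.comp_id _).trans ?_)
  exact (congrArg (C.toCompletion ≫ ·) (forgetJS.map_id C.completion)).trans (Category.comp_id _)
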